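/- Let $r>0$ (interest rate), $T>0$ (maturity) and $S_0$ (current price of the underlying). Suppose finitely many European put prices and finitely many American put prices with maturity $T$ are quoted, for strikes $0<K^E_1<\dots<K^E_n$ and $0<K^A_1<\dots<K^A_m$. Let $E,A:[0,\infty)\to\mathbb R$ be the linear interpolations of the quotes, starting from the value $0$ at strike $0$, and continued after the last strike with slope $e^{-rT}$ for $E$ and slope $1$ for $A$. Assume: (European conditions) $E$ is increasing and convex with $E(0)=0$; $(e^{-rT}K-S_0)_+\le E(K)\le e^{-rT}K$ for all $K\ge 0$; and $E'(K+)<e^{-rT}$ whenever $K\ge0$ and $E(K)>e^{-rT}K-S_0$. (American conditions) $A$ is increasing and convex; $A'(K+)K-A(K)\ge E'(K+)K-E(K)$, $\max\{E(K),K-S_0\}\le A(K)$ and $A(K)\le E(e^{rT}K)$ for all $K\ge0$. Then $E(K)=e^{-rT}\int (K-x)_+\,\mu(dx)$ for all $K\ge 0$, for a finitely supported probability law $\mu$ on $[0,\infty)$ with mean $S_0e^{rT}$, and the following splitting algorithm, started at $t=0$ with $(s,\mu,A)=(S_0,\mu,A)$, terminates. At time $t$, with price $s$, law $\mu$, American prices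 $A$, $L=T-t$ and $E(K)=e^{-rL}\int(K-x)_+\mu(dx)$: 1. If $A(K)=\max\{E(K),(K-s)_+\}$ for all $K\ge 0$, the price grows at rate $r$ until $T$, where it jumps to the law $\mu$. Stop. 2. Otherwise let $\tilde K=\inf\{K\ge0:A(K)=K-s\}$ and extend $A|_{[0,\tilde K]}$ to $\tilde A$ on $[0,\infty)$: continue linearly with slope $A'(\tilde K-)$ up to the first atom $K_p\ge\tilde K$ of $\mu$ at which this line $g$ violates $g'(K+)K-g(K)\ge E'(K+)K-E(K)$; from $K_p$ on, $\tilde A$ is linear between atoms of $\mu$, with slope $E'(k+)+(\tilde A(k)-E(k))/k$ after each atom $k\ge K_p$. Let $f_1,\dots,f_N$ be the linear pieces of $\tilde A$ with positive slope, in increasing order of slope. 3. Let $\bar A(K,\theta)=E(e^{r(L-\theta)}K)$, with atoms $u_k(\theta)=ke^{-r(L-\theta)}$ ($k$ an atom of $\mu$). Let $t_c$ be the infimum of all $\theta\in[0,L]$ with $\bar A(u_k(\theta),\theta)<f_j(u_k(\theta))$ for some $k,j$. Let $K^*$ be the smallest positive atom $u_k(t_c)$ at which $\bar A(\cdot,t_c)$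 meets some $f_j$, and let $f_i(K)=a(K-S_d)$ be the one of smallest slope among the $f_j$ meeting it there. 4. With $p_d=e^{rt_c}a$, $p_u=1-p_d$ and $S_u=(se^{rt_c}-p_dS_d)/p_u$, the price grows at rate $r$ until $t^*=t+t_c$, where it jumps to $S_d$ with probability $p_d$ and to $S_u$ with probability $p_u$. 5. With $\kappa=K^*e^{r(T-t^*)}$, put $\mu_1=p_d^{-1}[\mu|_{[0,\kappa)}+(p_d-\mu[0,\kappa))\delta_{\kappa}]$, $\mu_2=p_u^{-1}[(\mu[0,\kappa]-p_d)\delta_\kappa+\mu|_{(\kappa,\infty)}]$, $A_1=e^{rt_c}p_d^{-1}\max\{0,f_1,\dots,f_i\}$, $A_2=e^{rt_c}p_u^{-1}(\max\{f_i,\dots,f_N,e^{-rt_c}K-s\}-f_i)$, and continue independently at time $t^*$ from $(S_d,\mu_1,A_1)$ and from $(S_u,\mu_2,A_2)$. The resulting finite probability space $(\Omega,\mathbb Q)$ and price process $(S_t)_{t\ge0}$ (which equals $S_0$ at time $0$, so that a jump prescribed at time $0$ takes place immediately after time $0$, and which grows at rate $r$ after $T$) have the following properties. With respect to the natural filtration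 of $S$, $(e^{-rt}S_t)_{t\ge0}$ is a $\mathbb Q$-martingale; and for every $K\ge0$ $$e^{-rT}\mathbb E^{\mathbb Q}(K-S_T)_+=E(K),\qquad \sup_{0\le\tau\le T}\mathbb E^{\mathbb Q}[e^{-r\tau}(K-S_\tau)_+]=A(K),$$ the supremum being over stopping times $\tau$. Consequently there is no model-independent arbitrage when, for every $K\ge0$, European and American puts with strike $K$ can be bought and sold at time $0$ at the prices $E(K)$ and $A(K)$: no semi-static portfolio (cash, fixed positions in finitely many puts, and a self-financing position in the underlying altered at finitely many times; American puts held long are exercised at times depending only on the past, and those sold short are exercised by their holders at arbitrary times in $[0,T]$) has strictly negative initial value and non-negative wealth at maturity for every non-negative price path started at $S_0$ and all exercise times of the holders. -/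

import Mathlib

open MeasureTheory
open scoped NNReal

noncomputable section

namespace AmericanPut

/-! ### Price functions of finitely many quoted options -/

/-- Linear interpolation, started at the point `p`, through the listed points
`(strike, price)`, continued after the last point with slope `σ`. -/
def interpolateFrom (σ : ℝ) : ℝ × ℝ → List (ℝ × ℝ) → ℝ → ℝ
  | p, [], K => p.2 + σ * (K - p.1)
  | p, q :: l, K =>
      if K ≤ q.1 then p.2 + (q.2 - p.2) / (q.1 - p.1) * (K - p.1)
      else interpolateFrom σ q l K

/-- The price function obtained from a list of quotes `(strike, price)`: it is `0` at strike `0`,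
linear between consecutive strikes, and has slope `σ` after the last strike. -/
def interpolate (σ : ℝ) (quotes : List (ℝ × ℝ)) : ℝ → ℝ :=
  interpolateFrom σ (0, 0) quotes

/-- The strikes are positive and listed in strictly increasing order. -/
def StrikesIncreasing (quotes : List (ℝ × ℝ)) : Prop :=
  ((0 : ℝ) :: quotes.map Prod.fst).Pairwise (· < ·)

/-- The right derivative `F'(K+)`. -/
def rightDeriv (F : ℝ → ℝ) (K : ℝ) : ℝ := derivWithin F (Set.Ioi K) K

/-- The left derivative `F'(K-)`. -/
def leftDeriv (F : ℝ → ℝ) (K : ℝ) : ℝ := derivWithin F (Set.Iio K) K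

/-- The conditions on a European put price function with spot price `S₀`. -/
structure EuropeanConditions (r T S₀ : ℝ) (E : ℝ → ℝ) : Prop where
  increasing : MonotoneOn E (Set.Ici 0)
  convex : ConvexOn ℝ (Set.Ici 0) E
  zero : E 0 = 0
  lower : ∀ K, 0 ≤ K → max (Real.exp (-(r * T)) * K - S₀) 0 ≤ E K
  upper : ∀ K, 0 ≤ K → E K ≤ Real.exp (-(r * T)) * K
  slope : ∀ K, 0 ≤ K → Real.exp (-(r * T)) * K - S₀ < E K →
    rightDeriv E K < Real.exp (-(r * T))

/-- The conditions on an American put price function `A`, relative to the co-terminal European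
put price function `E`. -/
structure AmericanConditions (r T S₀ : ℝ) (A E : ℝ → ℝ) : Prop where
  increasing : MonotoneOn A (Set.Ici 0)
  convex : ConvexOn ℝ (Set.Ici 0) A
  legendre : ∀ K, 0 ≤ K → rightDeriv E K * K - E K ≤ rightDeriv A K * K - A K
  lower : ∀ K, 0 ≤ K → max (E K) (K - S₀) ≤ A K
  upper : ∀ K, 0 ≤ K → A K ≤ E (Real.exp (r * T) * K)

/-! ### Finitely supported laws at maturity

A law `p₁ δ_{k₁} + ⋯ + pₙ δ_{kₙ}` is the finitely supported function `kᵢ ↦ pᵢ`. -/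

/-- European put price under the law `μ` with remaining contract length `L`. -/
def europeanPut (r L : ℝ) (μ : ℝ →₀ ℝ) (K : ℝ) : ℝ :=
  Real.exp (-(r * L)) * μ.sum fun k p => p * max (K - k) 0

/-- `μ` is a probability law on `[0, ∞)` whose put prices at maturity `T` are given by `E`. -/
structure IsImpliedLaw (r T S₀ : ℝ) (E : ℝ → ℝ) (μ : ℝ →₀ ℝ) : Prop where
  mass_nonneg : ∀ k, 0 ≤ μ k
  atoms_nonneg : ∀ k ∈ μ.support, 0 ≤ k
  mass_one : (μ.sum fun _ p => p) = 1
  mean : (μ.sum fun k p => p * k) = S₀ * Real.exp (r * T)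
  price : ∀ K, 0 ≤ K → europeanPut r T μ K = E K

/-- The part of `μ` sent to the lower node, when a mass `p` is split off at the atom `k`:
`p⁻¹ (μ restricted to [0, k) + (p - μ[0, k)) δ_k)`. -/
def lowerLaw (μ : ℝ →₀ ℝ) (k p : ℝ) : ℝ →₀ ℝ :=
  p⁻¹ • (μ.filter (fun x => x < k) +
    Finsupp.single k (p - (μ.filter (fun x => x < k)).sum fun _ q => q))

/-- The part of `μ` sent to the upper node:
`(1 - p)⁻¹ ((μ[0, k] - p) δ_k + μ restricted to (k, ∞))`. -/
def upperLaw (μ : ℝ →₀ ℝ) (k p : ℝ) : ℝ →₀ ℝ :=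
  (1 - p)⁻¹ • (Finsupp.single k (((μ.filter (fun x => x ≤ k)).sum fun _ q => q) - p) +
    μ.filter (fun x => k < x))

/-! ### The splitting algorithm

A linear function `K ↦ a K - d` is coded by the pair `(a, d)`; for `a > 0` it is `a (K - d / a)`. -/

/-- Value of the linear function `(a, d)` at `K`. -/
def lineEval (f : ℝ × ℝ) (K : ℝ) : ℝ := f.1 * K - f.2

/-- `f` is one of the (increasing) linear pieces of `F` on `[0, ∞)`. -/
def IsPiece (F : ℝ → ℝ) (f : ℝ × ℝ) : Prop :=
  0 < f.1 ∧ ∃ a b : ℝ, 0 ≤ a ∧ a < b ∧ ∀ K ∈ Set.Icc a b, F K = lineEval f K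

/-- Pointwise maximum of a finite set of linear functions. -/
def lineMax (P : Set (ℝ × ℝ)) (K : ℝ) : ℝ := sSup ((fun f => lineEval f K) '' P)

/-- The smallest strike at which immediate exercise is optimal, `inf {K ≥ 0 : A K = K - s}`. -/
def exerciseStrike (s : ℝ) (A : ℝ → ℝ) : ℝ := sInf {K | 0 ≤ K ∧ A K = K - s}

/-- The last linear piece of `A` before the strike `exerciseStrike s A`, prolonged to all strikes. -/
def prolongation (s : ℝ) (A : ℝ → ℝ) (K : ℝ) : ℝ :=
  A (exerciseStrike s A) + leftDeriv A (exerciseStrike s A) * (K - exerciseStrike s A)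

/-- `Aext` is the extension of `A`: it agrees with `A` up to `exerciseStrike s A`, from there on it is
the prolonged last piece up to the first atom `Kp` of `μ` at which the prolonged piece `g`
violates `g'(K+) K - g(K) ≥ E'(K+) K - E(K)`; from `Kp` on it is linear between atoms, and its slope
after each atom is the one for which this inequality is an equality at the atom. -/
structure IsExtension (s : ℝ) (μ : ℝ →₀ ℝ) (E A Aext : ℝ → ℝ) (Kp : ℝ) : Prop where
  before : ∀ K, 0 ≤ K → K ≤ exerciseStrike s A → Aext K = A K
  first : IsLeast {k | k ∈ μ.support ∧ exerciseStrike s A ≤ k ∧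
    leftDeriv A (exerciseStrike s A) * k - prolongation s A k < rightDeriv E k * k - E k} Kp
  middle : ∀ K, exerciseStrike s A ≤ K → K ≤ Kp → Aext K = prolongation s A K
  after : ∀ k ∈ μ.support, Kp ≤ k → ∀ K, k ≤ K → (∀ k' ∈ μ.support, k < k' → K ≤ k') →
    Aext K = Aext k + (rightDeriv E k + (Aext k - E k) / k) * (K - k)

/-- The upper bound for American prices when a time `t` of the contract length `L` has passed. -/
def upperBound (r L : ℝ) (E : ℝ → ℝ) (K t : ℝ) : ℝ := E (Real.exp (r * (L - t)) * K)

/-- The time-`t` value of the atom `k`, that is, the corresponding atom of `upperBound`. -/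
def discountedAtom (r L k t : ℝ) : ℝ := k * Real.exp (-(r * (L - t)))

/-- `tc` is the critical time: the infimum over all atoms `k` of `μ` and all linear pieces `f` of
the extension `Aext` of the times at which the upper bound falls below `f` at the atom. -/
def IsCriticalTime (r L : ℝ) (μ : ℝ →₀ ℝ) (E Aext : ℝ → ℝ) (tc : ℝ) : Prop :=
  IsGLB {t | 0 ≤ t ∧ t ≤ L ∧ ∃ k ∈ μ.support, ∃ f, IsPiece Aext f ∧
    upperBound r L E (discountedAtom r L k t) t < lineEval f (discountedAtom r L k t)} tc

/-- `Kc` is the critical strike: the smallest positive atom of the upper bound at the critical time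
`tc` at which the upper bound meets a linear piece of `Aext`. -/
def IsCriticalStrike (r L : ℝ) (μ : ℝ →₀ ℝ) (E Aext : ℝ → ℝ) (tc Kc : ℝ) : Prop :=
  IsLeast {u | ∃ k ∈ μ.support, 0 < k ∧ u = discountedAtom r L k tc ∧
    ∃ f, IsPiece Aext f ∧ lineEval f u = upperBound r L E u tc} Kc

/-- `f` is the linear piece of `Aext` to be embedded: it meets the upper bound at the critical
strike, and if two pieces do (at a kink of `Aext`), it is the left one. -/
def IsEmbeddedPiece (r L : ℝ) (E Aext : ℝ → ℝ) (tc Kc : ℝ) (f : ℝ × ℝ) : Prop :=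
  (IsPiece Aext f ∧ lineEval f Kc = upperBound r L E Kc tc) ∧
    ∀ g, IsPiece Aext g → lineEval g Kc = upperBound r L E Kc tc → f.1 ≤ g.1

/-- The mass `p_d` that jumps down when `f` is embedded after the time `tc`. -/
def downMass (r tc : ℝ) (f : ℝ × ℝ) : ℝ := Real.exp (r * tc) * f.1

/-- The lower price `S_d`, the zero of `f`. -/
def downSpot (f : ℝ × ℝ) : ℝ := f.2 / f.1

/-- The upper price `S_u = (S e^{r tc} - p_d S_d) / p_u`. -/
def upSpot (r s tc : ℝ) (f : ℝ × ℝ) : ℝ :=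
  (s * Real.exp (r * tc) - downMass r tc f * downSpot f) / (1 - downMass r tc f)

/-- `A₁ = e^{r tc} p_d⁻¹ max {0, f₁, …, f_k}`, where `f_k = f`. -/
def lowerAmerican (r tc : ℝ) (Aext : ℝ → ℝ) (f : ℝ × ℝ) (K : ℝ) : ℝ :=
  Real.exp (r * tc) / downMass r tc f *
    lineMax ({((0 : ℝ), (0 : ℝ))} ∪ {g | IsPiece Aext g ∧ g.1 ≤ f.1}) K

/-- `A₂ = e^{r tc} p_u⁻¹ (max {f_k, f_{k+1}, …, f_N, e^{-r tc} K - S} - f_k)`, where `f_k = f`. -/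
def upperAmerican (r s tc : ℝ) (Aext : ℝ → ℝ) (f : ℝ × ℝ) (K : ℝ) : ℝ :=
  Real.exp (r * tc) / (1 - downMass r tc f) *
    (lineMax ({g | IsPiece Aext g ∧ f.1 ≤ g.1} ∪ {(Real.exp (-(r * tc)), s)}) K - lineEval f K)

/-- A price tree. `embed t s μ` is a node at time `t` with price `s` from which the price grows at
the interest rate up to maturity and then jumps to the law `μ`. `split t s t' p d u` is a node at
time `t` with price `s` from which the price grows at the interest rate up to time `t'`, where it
continues in the subtree `d` with probability `p` and in `u` with probability `1 - p`. -/
inductive PriceTree : Type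
  | embed (t s : ℝ) (μ : ℝ →₀ ℝ) : PriceTree
  | split (t s t' p : ℝ) (d u : PriceTree) : PriceTree

/-- `Builds r T t s μ A M`: the splitting algorithm, run with maturity `T` at time `t` from the
spot price `s`, the law `μ` at maturity and the American price function `A`, terminates and
returns the price tree `M`. -/
inductive Builds (r T : ℝ) : ℝ → ℝ → (ℝ →₀ ℝ) → (ℝ → ℝ) → PriceTree → Prop
  | embed (t s : ℝ) (μ : ℝ →₀ ℝ) (A : ℝ → ℝ)
      (trivial_picture : ∀ K, 0 ≤ K → A K = max (europeanPut r (T - t) μ K) (max (K - s) 0)) :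
      Builds r T t s μ A (PriceTree.embed t s μ)
  | split (t s : ℝ) (μ : ℝ →₀ ℝ) (A Aext : ℝ → ℝ) (Kp tc Kc : ℝ) (f : ℝ × ℝ) (d u : PriceTree)
      (nontrivial_picture :
        ¬ ∀ K, 0 ≤ K → A K = max (europeanPut r (T - t) μ K) (max (K - s) 0))
      (extension : IsExtension s μ (europeanPut r (T - t) μ) A Aext Kp)
      (critical_time : IsCriticalTime r (T - t) μ (europeanPut r (T - t) μ) Aext tc)
      (critical_strike : IsCriticalStrike r (T - t) μ (europeanPut r (T - t) μ) Aext tc Kc)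
      (piece : IsEmbeddedPiece r (T - t) (europeanPut r (T - t) μ) Aext tc Kc f)
      (down : Builds r T (t + tc) (downSpot f)
        (lowerLaw μ (Kc * Real.exp (r * (T - (t + tc)))) (downMass r tc f))
        (lowerAmerican r tc Aext f) d)
      (up : Builds r T (t + tc) (upSpot r s tc f)
        (upperLaw μ (Kc * Real.exp (r * (T - (t + tc)))) (downMass r tc f))
        (upperAmerican r s tc Aext f) u) :
      Builds r T t s μ A (PriceTree.split t s (t + tc) (downMass r tc f) d u)

/-! ### The market model of a price tree -/

namespace PriceTree

/-- The outcomes: a branch of the tree, together with an atom of the law at its end. -/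
def Outcome : PriceTree → Type
  | embed _ _ μ => {k : ℝ // k ∈ μ.support}
  | split _ _ _ _ d u => d.Outcome ⊕ u.Outcome

instance (M : PriceTree) : MeasurableSpace M.Outcome := ⊤

/-- The probability of an outcome. -/
def weight : (M : PriceTree) → M.Outcome → ℝ
  | embed _ _ μ, x => μ x.1
  | split _ _ _ p d _, Sum.inl ω => p * d.weight ω
  | split _ _ _ p _ u, Sum.inr ω => (1 - p) * u.weight ω

/-- The pricing measure. -/
def prob (M : PriceTree) : Measure M.Outcome :=
  Measure.sum fun ω => ENNReal.ofReal (M.weight ω) • Measure.dirac ω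

/-- The price at the root. -/
def rootPrice : PriceTree → ℝ
  | embed _ s _ => s
  | split _ s _ _ _ _ => s

/-- The price at time `v` along the branch `ω`: growth at rate `r` between the jumps; after the
maturity `T` the price grows at rate `r`. -/
def branchPrice (r T : ℝ) : (M : PriceTree) → ℝ → M.Outcome → ℝ
  | embed t s _, v, x =>
      if v < T then s * Real.exp (r * (v - t)) else x.1 * Real.exp (r * (v - T))
  | split t s t' _ d _, v, Sum.inl ω =>
      if v < t' then s * Real.exp (r * (v - t)) else d.branchPrice r T v ω
  | split t s t' _ _ u, v, Sum.inr ω =>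
      if v < t' then s * Real.exp (r * (v - t)) else u.branchPrice r T v ω

/-- The price process. At time `0` it is the price at the root, so jumps that the tree
places at time `0` take place immediately after time `0`. -/
def spot (r T : ℝ) (M : PriceTree) (v : ℝ≥0) (ω : M.Outcome) : ℝ :=
  if v = 0 then M.rootPrice else M.branchPrice r T v ω

theorem stronglyMeasurable_spot (r T : ℝ) (M : PriceTree) (v : ℝ≥0) :
    StronglyMeasurable (M.spot r T v) :=
  Measurable.stronglyMeasurable measurable_from_top

/-- The natural filtration of the price process. -/
def filtration (r T : ℝ) (M : PriceTree) :
    Filtration ℝ≥0 (inferInstance : MeasurableSpace M.Outcome) :=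
  Filtration.natural (M.spot r T) (M.stronglyMeasurable_spot r T)

/-- The expected discounted payoffs `𝔼[e^{-r τ} (K - S_τ)₊]` over all stopping times `τ ≤ T`. -/
def exerciseValues (r : ℝ) (T : ℝ≥0) (M : PriceTree) (K : ℝ) : Set ℝ :=
  {v | ∃ τ : M.Outcome → ℝ≥0,
    IsStoppingTime (M.filtration r T) (fun ω => (τ ω : WithTop ℝ≥0)) ∧ (∀ ω, τ ω ≤ T) ∧
    v = ∫ ω, Real.exp (-(r * τ ω)) * max (K - M.spot r T (τ ω) ω) 0 ∂M.prob}

end PriceTree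

/-! ### Model-independent arbitrage -/

/-- A scenario: a non-negative price path of the underlying started at `S₀`, together with the
times at which the holders of `n` American options exercise. -/
structure Scenario (S₀ : ℝ) (T : ℝ≥0) (n : ℕ) where
  path : ℝ≥0 → ℝ
  path_nonneg : ∀ t, 0 ≤ path t
  path_zero : path 0 = S₀
  exercise : Fin n → ℝ≥0
  exercise_le : ∀ j, exercise j ≤ T

/-- The two scenarios cannot be distinguished by what has been observed up to time `t`. -/
def Scenario.AgreeUpTo {S₀ : ℝ} {T : ℝ≥0} {n : ℕ} (t : ℝ≥0) (θ θ' : Scenario S₀ T n) : Prop :=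
  (∀ v ≤ t, θ.path v = θ'.path v) ∧
    ∀ j, (θ.exercise j ≤ t ∨ θ'.exercise j ≤ t) → θ.exercise j = θ'.exercise j

/-- A random time that is determined by the past. -/
def NonAnticipating {S₀ : ℝ} {T : ℝ≥0} {n : ℕ} (σ : Scenario S₀ T n → ℝ≥0) : Prop :=
  ∀ θ θ', Scenario.AgreeUpTo (σ θ) θ θ' → σ θ' = σ θ

/-- A semi-static portfolio: cash, fixed positions in finitely many European puts, in
finitely many American puts held long (each exercised at a non-anticipating time) and in
finitely many American puts sold short (exercised by their holders), and a self-financing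
position in the underlying that is altered at finitely many non-anticipating times. -/
structure SemiStaticPortfolio (S₀ : ℝ) (T : ℝ≥0) where
  cash : ℝ
  numEuropean : ℕ
  europeanStrike : Fin numEuropean → ℝ
  europeanStrike_nonneg : ∀ i, 0 ≤ europeanStrike i
  europeanPosition : Fin numEuropean → ℝ
  numShort : ℕ
  shortStrike : Fin numShort → ℝ
  shortStrike_nonneg : ∀ i, 0 ≤ shortStrike i
  shortPosition : Fin numShort → ℝ
  shortPosition_nonneg : ∀ i, 0 ≤ shortPosition i
  numLong : ℕ
  longStrike : Fin numLong → ℝ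
  longStrike_nonneg : ∀ i, 0 ≤ longStrike i
  longPosition : Fin numLong → ℝ
  longPosition_nonneg : ∀ i, 0 ≤ longPosition i
  exerciseTime : Fin numLong → Scenario S₀ T numShort → ℝ≥0
  exerciseTime_le : ∀ i θ, exerciseTime i θ ≤ T
  exerciseTime_nonAnticipating : ∀ i, NonAnticipating (exerciseTime i)
  numTrades : ℕ
  tradeTime : Fin (numTrades + 1) → Scenario S₀ T numShort → ℝ≥0
  tradeTime_mono : ∀ θ, Monotone fun l => tradeTime l θ
  tradeTime_le : ∀ l θ, tradeTime l θ ≤ T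
  tradeTime_nonAnticipating : ∀ l, NonAnticipating (tradeTime l)
  holding : Fin numTrades → Scenario S₀ T numShort → ℝ
  holding_nonAnticipating : ∀ l θ θ', Scenario.AgreeUpTo (tradeTime l.castSucc θ) θ θ' →
    holding l θ' = holding l θ

namespace SemiStaticPortfolio

variable {S₀ : ℝ} {T : ℝ≥0}

/-- The value at time `0`, where puts with strike `K` cost `E K` (European), `A K` (American). -/
def initialValue (P : SemiStaticPortfolio S₀ T) (A E : ℝ → ℝ) : ℝ :=
  P.cash + ∑ i, P.europeanPosition i * E (P.europeanStrike i) +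
    ∑ i, P.longPosition i * A (P.longStrike i) - ∑ i, P.shortPosition i * A (P.shortStrike i)

/-- The discounted wealth at maturity in the scenario `θ`. -/
def terminalValue (r : ℝ) (P : SemiStaticPortfolio S₀ T) (θ : Scenario S₀ T P.numShort) : ℝ :=
  P.cash +
    ∑ i, P.europeanPosition i *
      (Real.exp (-(r * T)) * max (P.europeanStrike i - θ.path T) 0) +
    ∑ i, P.longPosition i * (Real.exp (-(r * P.exerciseTime i θ)) *
      max (P.longStrike i - θ.path (P.exerciseTime i θ)) 0) -
    ∑ i, P.shortPosition i * (Real.exp (-(r * θ.exercise i)) *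
      max (P.shortStrike i - θ.path (θ.exercise i)) 0) +
    ∑ l : Fin P.numTrades, P.holding l θ *
      (Real.exp (-(r * P.tradeTime l.succ θ)) * θ.path (P.tradeTime l.succ θ) -
        Real.exp (-(r * P.tradeTime l.castSucc θ)) * θ.path (P.tradeTime l.castSucc θ))

end SemiStaticPortfolio

/-- There is a semi-static portfolio with strictly negative initial value and non-negative
wealth at maturity in every scenario. -/
def ModelIndependentArbitrage (r S₀ : ℝ) (T : ℝ≥0) (A E : ℝ → ℝ) : Prop :=
  ∃ P : SemiStaticPortfolio S₀ T,
    P.initialValue A E < 0 ∧ ∀ θ : Scenario S₀ T P.numShort, 0 ≤ P.terminalValue r θ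

end AmericanPut

end

namespace AmericanPut

open Filter Topology

/-! ### Convex piecewise linear functions on `[0, ∞)` -/

/-! The algorithm is backward induction for the optimal stopping problem, read in reverse on convex
piecewise linear price curves. The invariant of a node is `Node`: the put prices `E` of the law `μ`
satisfy `E ≤ A` and `A K ≤ E (e^{rL} K)`, the line `K - s` lies below `A`, and `(A - E) / K` is
increasing. The last condition is the comparison of the intercepts of tangents, integrated by
`Polyhedral.legendre_mono`. The quotes yield such a node by `exists_root`: convexity turns the slope
jumps of `E` into masses, and the slope condition forces the mean.

In a node that is not trivial, the part of `A` where immediate exercise is optimal is replaced by an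
extension that stays below `A` and keeps the monotone quotient (`Node.exists_extended`); it plays
the role of a continuation value. As time passes, the upper bound `E (e^{r(L-θ)} K)` sinks to `E`,
while the extension exceeds `E` at some atom. Hence at some `tc < L` the bound first touches a piece
`f` of the extension, at an atom (`Node.exists_step`). In terms of strikes at maturity, `f` is then
a supporting line of `E` at the atom `κ`. Its slope lies between the one-sided slopes of `E`, which
says `μ[0, κ) ≤ p_d ≤ μ[0, κ]`, and its zero is the discounted mean of the lower part of `μ`.
Cutting `μ` at `κ` and the extension at `Kc` along the same line gives two nodes that satisfy the
invariant again (`node_lower`, `node_upper`), and `A` is the maximum of immediate exercise and the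
discounted mean of the two new curves (`american_eq`).

Termination rests on the pieces that differ from `E` by a multiple of the strike just after their
first contact. Such a bound piece never touches the upper bound as above (`not_bound_of_touch`), and
the extension creates only bound pieces. A split never increases the number of atoms; the number of
free pieces drops in the lower node, and in the upper node either an atom or a free piece
disappears. The lexicographic order on these two numbers is well-founded.

In the resulting tree, induction on the branches gives the martingale property and identifies `A` as
the value of stopping. Two points need care because information is that of the price alone. The two
branches of a split may show the same price; this price is then extreme for both laws, hence
deterministic afterwards, and exercising at once costs nothing (`american_attained`). A jump at time
`0` becomes visible only later, so exercise is delayed by a small `δ` and the supremum is approached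
by right-continuity (`exists_exercise_gt`). Integrating the wealth of a portfolio over the model,
with holders of short puts exercising almost optimally, excludes arbitrage (`not_arbitrage`). -/

theorem lineEval_continuous (f : ℝ × ℝ) : Continuous (lineEval f) := by
  unfold lineEval; fun_prop

theorem lineEval_ext {f g : ℝ × ℝ} {x y : ℝ} (hxy : x < y) (hx : lineEval f x = lineEval g x)
    (hy : lineEval f y = lineEval g y) : f = g := by
  unfold lineEval at hx hy
  have h : (f.1 - g.1) * (y - x) = 0 := by linarith
  have h1 : f.1 = g.1 := by
    rcases mul_eq_zero.1 h with h | h <;> linarith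
  refine Prod.ext h1 ?_
  rw [h1] at hx
  linarith

theorem lineEval_le_of_le {f g : ℝ × ℝ} {x y : ℝ} (hx : lineEval f x ≤ lineEval g x)
    (h : f.1 ≤ g.1) (hxy : x ≤ y) : lineEval f y ≤ lineEval g y := by
  unfold lineEval at *
  nlinarith [mul_le_mul_of_nonneg_right h (sub_nonneg.2 hxy)]

theorem lineEval_le_of_ge {f g : ℝ × ℝ} {x y : ℝ} (hx : lineEval f x ≤ lineEval g x)
    (h : g.1 ≤ f.1) (hyx : y ≤ x) : lineEval f y ≤ lineEval g y := by
  unfold lineEval at *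
  nlinarith [mul_le_mul_of_nonneg_right h (sub_nonneg.2 hyx)]

theorem lineEval_lt_of_lt {f g : ℝ × ℝ} {x y : ℝ} (hx : lineEval f x ≤ lineEval g x)
    (h : f.1 < g.1) (hxy : x < y) : lineEval f y < lineEval g y := by
  unfold lineEval at *
  nlinarith [mul_lt_mul_of_pos_right h (sub_pos.2 hxy)]

theorem slope_le_of_lineEval_le {f g : ℝ × ℝ} {x y : ℝ} (hxy : x < y)
    (hx : lineEval g x ≤ lineEval f x) (hy : lineEval f y ≤ lineEval g y) : f.1 ≤ g.1 := by
  by_contra! h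
  exact absurd hy (not_le.2 (lineEval_lt_of_lt hx h hxy))

/-- On `[0, ∞)` the function `F` is the maximum of the finitely many linear functions in `P`. -/
structure IsMaxOf (P : Finset (ℝ × ℝ)) (F : ℝ → ℝ) : Prop where
  le : ∀ f ∈ P, ∀ K, 0 ≤ K → lineEval f K ≤ F K
  attained : ∀ K, 0 ≤ K → ∃ f ∈ P, F K = lineEval f K

/-- On `[0, ∞)` the function `F` is convex and piecewise linear with finitely many pieces. -/
def Polyhedral (F : ℝ → ℝ) : Prop := ∃ P, IsMaxOf P F

theorem Polyhedral.congr {F G : ℝ → ℝ} (hF : Polyhedral F) (h : ∀ K, 0 ≤ K → G K = F K) :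
    Polyhedral G := by
  obtain ⟨P, hP⟩ := hF
  exact ⟨P, fun f hf K hK => (h K hK).symm ▸ hP.le f hf K hK,
    fun K hK => (h K hK).symm ▸ hP.attained K hK⟩

theorem polyhedral_lineEval (f : ℝ × ℝ) : Polyhedral (lineEval f) :=
  ⟨{f}, by simp, by simp⟩

theorem polyhedral_zero : Polyhedral (fun _ => 0) :=
  (polyhedral_lineEval (0, 0)).congr (by simp [lineEval])

theorem Polyhedral.add {F G : ℝ → ℝ} (hF : Polyhedral F) (hG : Polyhedral G) :
    Polyhedral (fun K => F K + G K) := by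
  classical
  obtain ⟨P, hP⟩ := hF
  obtain ⟨Q, hQ⟩ := hG
  have key : ∀ (f g : ℝ × ℝ) K, lineEval (f + g) K = lineEval f K + lineEval g K := by
    intro f g K; simp only [lineEval, Prod.fst_add, Prod.snd_add]; ring
  refine ⟨(P ×ˢ Q).image (fun x => x.1 + x.2), ?_, ?_⟩
  · intro f hf K hK
    obtain ⟨⟨a, b⟩, hab, rfl⟩ := Finset.mem_image.1 hf
    rw [Finset.mem_product] at hab
    rw [key]
    exact add_le_add (hP.le _ hab.1 K hK) (hQ.le _ hab.2 K hK)
  · intro K hK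
    obtain ⟨f, hf, hfK⟩ := hP.attained K hK
    obtain ⟨g, hg, hgK⟩ := hQ.attained K hK
    exact ⟨f + g, Finset.mem_image.2 ⟨(f, g), Finset.mem_product.2 ⟨hf, hg⟩, rfl⟩,
      by rw [key, hfK, hgK]⟩

theorem Polyhedral.const_mul {F : ℝ → ℝ} (hF : Polyhedral F) {c : ℝ} (hc : 0 ≤ c) :
    Polyhedral (fun K => c * F K) := by
  classical
  obtain ⟨P, hP⟩ := hF
  have key : ∀ (f : ℝ × ℝ) K, lineEval (c • f) K = c * lineEval f K := by
    intro f K; simp only [lineEval, Prod.smul_fst, Prod.smul_snd, smul_eq_mul]; ring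
  refine ⟨P.image (fun x => c • x), ?_, ?_⟩
  · intro f hf K hK
    obtain ⟨a, ha, rfl⟩ := Finset.mem_image.1 hf
    rw [key]
    exact mul_le_mul_of_nonneg_left (hP.le _ ha K hK) hc
  · intro K hK
    obtain ⟨f, hf, hfK⟩ := hP.attained K hK
    exact ⟨c • f, Finset.mem_image_of_mem _ hf, by rw [key, hfK]⟩

theorem Polyhedral.max {F G : ℝ → ℝ} (hF : Polyhedral F) (hG : Polyhedral G) :
    Polyhedral (fun K => max (F K) (G K)) := by
  classical
  obtain ⟨P, hP⟩ := hF
  obtain ⟨Q, hQ⟩ := hG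
  refine ⟨P ∪ Q, ?_, ?_⟩
  · intro f hf K hK
    rcases Finset.mem_union.1 hf with h | h
    · exact le_max_of_le_left (hP.le _ h K hK)
    · exact le_max_of_le_right (hQ.le _ h K hK)
  · intro K hK
    rcases le_total (F K) (G K) with h | h
    · obtain ⟨g, hg, hgK⟩ := hQ.attained K hK
      exact ⟨g, Finset.mem_union_right _ hg, by rw [max_eq_right h, hgK]⟩
    · obtain ⟨g, hg, hgK⟩ := hP.attained K hK
      exact ⟨g, Finset.mem_union_left _ hg, by rw [max_eq_left h, hgK]⟩

/-- Two functions that meet at `x` may be glued there if a common supporting line separates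
their slopes. -/
theorem Polyhedral.glue {F G H : ℝ → ℝ} {x : ℝ} {l : ℝ × ℝ} (hx : 0 ≤ x) (hF : Polyhedral F)
    (hG : Polyhedral G) (hFx : F x = lineEval l x) (hGx : G x = lineEval l x)
    (hlF : ∀ K, 0 ≤ K → K ≤ x → lineEval l K ≤ F K) (hlG : ∀ K, x ≤ K → lineEval l K ≤ G K)
    (hHF : ∀ K, 0 ≤ K → K ≤ x → H K = F K) (hHG : ∀ K, x ≤ K → H K = G K) : Polyhedral H := by
  classical
  obtain ⟨P, hP⟩ := hF
  obtain ⟨Q, hQ⟩ := hG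
  -- Left of `x` only lines of `P` at most as steep as `l` can be active, right of `x` only lines of
  -- `Q` at least as steep. Discarding the rest keeps each line below `H` on the other side of `x`
  -- too, where it stays below `l`.
  refine ⟨insert l (P.filter (fun f => f.1 ≤ l.1) ∪ Q.filter (fun f => l.1 ≤ f.1)), ?_, ?_⟩
  · intro f hf K hK
    have hlH : lineEval l K ≤ H K := by
      rcases le_total K x with h | h
      · rw [hHF K hK h]; exact hlF K hK h
      · rw [hHG K h]; exact hlG K h
    rcases Finset.mem_insert.1 hf with rfl | hf
    · exact hlH
    rcases Finset.mem_union.1 hf with hf | hf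
    · rw [Finset.mem_filter] at hf
      rcases le_total K x with h | h
      · rw [hHF K hK h]; exact hP.le f hf.1 K hK
      · exact (lineEval_le_of_le ((hP.le f hf.1 x hx).trans_eq hFx) hf.2 h).trans hlH
    · rw [Finset.mem_filter] at hf
      rcases le_total x K with h | h
      · rw [hHG K h]; exact hQ.le f hf.1 K hK
      · refine le_trans ?_ hlH
        have h1 : lineEval f x ≤ lineEval l x := (hQ.le f hf.1 x hx).trans_eq hGx
        exact lineEval_le_of_ge h1 hf.2 h
  · intro K hK
    rcases lt_trichotomy K x with h | h | h
    · obtain ⟨f, hf, hfK⟩ := hP.attained K hK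
      refine ⟨f, Finset.mem_insert_of_mem (Finset.mem_union_left _ (Finset.mem_filter.2
        ⟨hf, ?_⟩)), by rw [hHF K hK h.le, hfK]⟩
      exact slope_le_of_lineEval_le h ((hlF K hK h.le).trans_eq hfK)
        ((hP.le f hf x hx).trans_eq hFx)
    · subst h
      exact ⟨l, Finset.mem_insert_self _ _, by rw [hHF K hK le_rfl, hFx]⟩
    · obtain ⟨f, hf, hfK⟩ := hQ.attained K hK
      refine ⟨f, Finset.mem_insert_of_mem (Finset.mem_union_right _ (Finset.mem_filter.2
        ⟨hf, ?_⟩)), by rw [hHG K h.le, hfK]⟩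
      exact slope_le_of_lineEval_le h ((hQ.le f hf x hx).trans_eq hGx)
        ((hlG K h.le).trans_eq hfK)

theorem Polyhedral.convex {F : ℝ → ℝ} (hF : Polyhedral F) {x y z : ℝ} (hx : 0 ≤ x) (hxz : x ≤ z)
    (hzy : z ≤ y) : (y - x) * F z ≤ (y - z) * F x + (z - x) * F y := by
  obtain ⟨P, hP⟩ := hF
  obtain ⟨f, hf, hfz⟩ := hP.attained z (hx.trans hxz)
  have h1 := mul_le_mul_of_nonneg_left (hP.le f hf x hx) (sub_nonneg.2 hzy)
  have h2 := mul_le_mul_of_nonneg_left (hP.le f hf y (hx.trans (hxz.trans hzy)))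
    (sub_nonneg.2 hxz)
  rw [hfz]
  unfold lineEval at *
  linarith

/-- A line below `F` that touches `F` at two points touches it in between. -/
theorem Polyhedral.eq_of_touch {F : ℝ → ℝ} (hF : Polyhedral F) {f : ℝ × ℝ} {x y z : ℝ}
    (hle : ∀ K, 0 ≤ K → lineEval f K ≤ F K) (hx : 0 ≤ x) (hxz : x ≤ z) (hzy : z ≤ y)
    (hfx : F x = lineEval f x) (hfy : F y = lineEval f y) : F z = lineEval f z := by
  refine le_antisymm ?_ (hle z (hx.trans hxz))
  rcases (hxz.trans hzy).eq_or_lt with h | h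
  · have : z = x := by linarith
    subst this; exact hfx.le
  · have h1 := hF.convex hx hxz hzy
    rw [hfx, hfy] at h1
    have h2 : (y - x) * F z ≤ (y - x) * lineEval f z := by
      unfold lineEval at *; linarith
    exact le_of_mul_le_mul_left h2 (sub_pos.2 h)

/-! ### Local pieces and points of contact. -/

theorem IsMaxOf.exists_right {P : Finset (ℝ × ℝ)} {F : ℝ → ℝ} (hF : IsMaxOf P F) {K : ℝ}
    (hK : 0 ≤ K) : ∃ g ∈ P, ∃ y, K < y ∧ ∀ z ∈ Set.Icc K y, F z = lineEval g z := by
  classical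
  obtain ⟨f₀, hf₀, hf₀K⟩ := hF.attained K hK
  obtain ⟨g, hg, hmax⟩ := (P.filter (fun f => F K = lineEval f K)).exists_max_image Prod.fst
    ⟨f₀, Finset.mem_filter.2 ⟨hf₀, hf₀K⟩⟩
  rw [Finset.mem_filter] at hg
  have h : ∀ f ∈ P, ∀ᶠ z in 𝓝[≥] K, lineEval f z ≤ lineEval g z := by
    intro f hf
    rcases (hF.le f hf K hK).lt_or_eq with h | h
    · rw [hg.2] at h
      have := (lineEval_continuous f).continuousAt.eventually_lt
        (lineEval_continuous g).continuousAt h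
      filter_upwards [this.filter_mono nhdsWithin_le_nhds] with z hz using hz.le
    · filter_upwards [self_mem_nhdsWithin] with z hz
      exact lineEval_le_of_le (h.trans hg.2).le
        (hmax f (Finset.mem_filter.2 ⟨hf, h.symm⟩)) hz
  have h2 := (Finset.eventually_all P).2 h
  obtain ⟨y, hy, hsub⟩ := mem_nhdsGE_iff_exists_Icc_subset.1 h2
  refine ⟨g, hg.1, y, hy, fun z hz => ?_⟩
  obtain ⟨f, hf, hfz⟩ := hF.attained z (hK.trans hz.1)
  exact le_antisymm (hfz.trans_le (hsub hz f hf)) (hF.le g hg.1 z (hK.trans hz.1))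

/-- Of the lines active at `K`, the flattest dominates to the left, as the steepest does to the
right. The inactive lines stay strictly below nearby by continuity, and there are finitely many. -/
theorem IsMaxOf.exists_left {P : Finset (ℝ × ℝ)} {F : ℝ → ℝ} (hF : IsMaxOf P F) {K : ℝ}
    (hK : 0 < K) : ∃ g ∈ P, ∃ w, 0 ≤ w ∧ w < K ∧ ∀ z ∈ Set.Icc w K, F z = lineEval g z := by
  classical
  obtain ⟨f₀, hf₀, hf₀K⟩ := hF.attained K hK.le
  obtain ⟨g, hg, hmin⟩ := (P.filter (fun f => F K = lineEval f K)).exists_min_image Prod.fst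
    ⟨f₀, Finset.mem_filter.2 ⟨hf₀, hf₀K⟩⟩
  rw [Finset.mem_filter] at hg
  have h : ∀ f ∈ P, ∀ᶠ z in 𝓝[≤] K, lineEval f z ≤ lineEval g z := by
    intro f hf
    rcases (hF.le f hf K hK.le).lt_or_eq with h | h
    · rw [hg.2] at h
      have := (lineEval_continuous f).continuousAt.eventually_lt
        (lineEval_continuous g).continuousAt h
      filter_upwards [this.filter_mono nhdsWithin_le_nhds] with z hz using hz.le
    · filter_upwards [self_mem_nhdsWithin] with z hz
      have h1 := hmin f (Finset.mem_filter.2 ⟨hf, h.symm⟩)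
      have h2 := h.trans hg.2
      exact lineEval_le_of_ge h2.le h1 hz
  have h2 := (Finset.eventually_all P).2 h
  obtain ⟨y, hy, hsub⟩ := mem_nhdsLE_iff_exists_Icc_subset.1 h2
  refine ⟨g, hg.1, max 0 y, le_max_left _ _, max_lt hK hy, fun z hz => ?_⟩
  have hz0 : 0 ≤ z := (le_max_left _ _).trans hz.1
  obtain ⟨f, hf, hfz⟩ := hF.attained z hz0
  exact le_antisymm (hfz.trans_le (hsub ⟨(le_max_right _ _).trans hz.1, hz.2⟩ f hf))
    (hF.le g hg.1 z hz0)

theorem Polyhedral.exists_right {F : ℝ → ℝ} (hF : Polyhedral F) {K : ℝ} (hK : 0 ≤ K) :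
    ∃ g : ℝ × ℝ, (∀ x, 0 ≤ x → lineEval g x ≤ F x) ∧
      ∃ y, K < y ∧ ∀ z ∈ Set.Icc K y, F z = lineEval g z := by
  obtain ⟨P, hP⟩ := hF
  obtain ⟨g, hg, h⟩ := hP.exists_right hK
  exact ⟨g, hP.le g hg, h⟩

theorem Polyhedral.exists_left {F : ℝ → ℝ} (hF : Polyhedral F) {K : ℝ} (hK : 0 < K) :
    ∃ g : ℝ × ℝ, (∀ x, 0 ≤ x → lineEval g x ≤ F x) ∧
      ∃ w, 0 ≤ w ∧ w < K ∧ ∀ z ∈ Set.Icc w K, F z = lineEval g z := by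
  obtain ⟨P, hP⟩ := hF
  obtain ⟨g, hg, h⟩ := hP.exists_left hK
  exact ⟨g, hP.le g hg, h⟩

theorem IsMaxOf.mem_of_isPiece {P : Finset (ℝ × ℝ)} {F : ℝ → ℝ} (hF : IsMaxOf P F) {f : ℝ × ℝ}
    (hf : IsPiece F f) : f ∈ P := by
  obtain ⟨-, a, b, ha, hab, h⟩ := hf
  obtain ⟨g, hg, y, hy, hgy⟩ := hF.exists_right ha
  have : f = g := by
    refine lineEval_ext (x := a) (y := min b y) (lt_min hab hy) ?_ ?_
    · rw [← h a ⟨le_rfl, hab.le⟩, ← hgy a ⟨le_rfl, hy.le⟩]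
    · rw [← h _ ⟨le_min hab.le hy.le, min_le_left _ _⟩,
        ← hgy _ ⟨le_min hab.le hy.le, min_le_right _ _⟩]
  exact this ▸ hg

theorem Polyhedral.finite_pieces {F : ℝ → ℝ} (hF : Polyhedral F) : {f | IsPiece F f}.Finite := by
  obtain ⟨P, hP⟩ := hF
  exact P.finite_toSet.subset fun f hf => hP.mem_of_isPiece hf

theorem Polyhedral.lineEval_le_of_isPiece {F : ℝ → ℝ} (hF : Polyhedral F) {f : ℝ × ℝ}
    (hf : IsPiece F f) {K : ℝ} (hK : 0 ≤ K) : lineEval f K ≤ F K := by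
  obtain ⟨P, hP⟩ := hF
  exact hP.le f (hP.mem_of_isPiece hf) K hK

/-- A line below `F` that touches `F` has a first point of contact. -/
theorem Polyhedral.exists_isLeast_contact {F : ℝ → ℝ} (hF : Polyhedral F) {f : ℝ × ℝ}
    (hle : ∀ K, 0 ≤ K → lineEval f K ≤ F K) (hne : ∃ K, 0 ≤ K ∧ F K = lineEval f K) :
    ∃ x, IsLeast {K | 0 ≤ K ∧ F K = lineEval f K} x := by
  have hbdd : BddBelow {K | 0 ≤ K ∧ F K = lineEval f K} := ⟨0, fun K hK => hK.1⟩
  set x := sInf {K | 0 ≤ K ∧ F K = lineEval f K} with hx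
  have hx0 : 0 ≤ x := le_csInf hne fun K hK => hK.1
  refine ⟨x, ⟨hx0, ?_⟩, fun K hK => csInf_le hbdd hK⟩
  -- The infimum is itself a contact: `F` is affine on some `[x, y]`, and a line below it that
  -- touches it before `y` either touches at `x` or coincides with it.
  obtain ⟨g, hg, y, hy, hgy⟩ := hF.exists_right hx0
  obtain ⟨z, ⟨hz0, hz⟩, hzy⟩ := exists_lt_of_csInf_lt hne (hx ▸ hy)
  have hxz : x ≤ z := csInf_le hbdd ⟨hz0, hz⟩
  have e1 := hgy x ⟨le_rfl, hy.le⟩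
  have e2 := hgy z ⟨hxz, hzy.le⟩
  have e3 := hgy y ⟨hy.le, le_rfl⟩
  have l1 := hle x hx0
  have l3 := hle y (hx0.trans hy.le)
  rw [e1] at l1 ⊢
  rw [e3] at l3
  rw [e2] at hz
  rcases hxz.eq_or_lt with h | h
  · rw [h]; exact hz
  · have h1 := slope_le_of_lineEval_le hzy hz.le l3
    have h2 := slope_le_of_lineEval_le h l1 hz.le
    have h3 : f.1 = g.1 := le_antisymm h1 h2
    unfold lineEval at hz ⊢
    rw [h3] at hz ⊢
    linarith

theorem Polyhedral.div_mono {F : ℝ → ℝ} (hF : Polyhedral F) (h0 : F 0 ≤ 0) {x y : ℝ} (hx : 0 ≤ x)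
    (hxy : x ≤ y) : F x * y ≤ F y * x := by
  have := hF.convex le_rfl hx hxy
  nlinarith [mul_nonneg (sub_nonneg.2 hxy) (neg_nonneg.2 h0)]

/-- At every strike a non-negative `F` with `F 0 = 0` follows a piece or vanishes. -/
theorem Polyhedral.exists_piece_or_zero {F : ℝ → ℝ} (hF : Polyhedral F) (h0 : F 0 = 0)
    (hpos : ∀ K, 0 ≤ K → 0 ≤ F K) {K : ℝ} (hK : 0 ≤ K) :
    ∃ g : ℝ × ℝ, (IsPiece F g ∨ g = (0, 0)) ∧ F K = lineEval g K := by
  obtain ⟨g, hg, y, hy, hgy⟩ := hF.exists_right hK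
  have e1 := hgy K ⟨le_rfl, hy.le⟩
  by_cases h : 0 < g.1
  · exact ⟨g, Or.inl ⟨h, K, y, hK, hy, hgy⟩, e1⟩
  -- A line of slope at most `0` that is at most `0` at the origin is non-positive, so the
  -- non-negative `F` vanishes at `K`.
  · refine ⟨(0, 0), Or.inr rfl, ?_⟩
    have h1 := hg 0 le_rfl
    have h2 := hpos K hK
    rw [h0] at h1
    rw [e1] at h2 ⊢
    unfold lineEval at *
    have : g.1 * K ≤ 0 := mul_nonpos_of_nonpos_of_nonneg (not_lt.1 h) hK
    simp only [zero_mul, sub_zero]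
    linarith

/-! ### One-sided derivatives and intercepts of chords. -/

theorem hasDerivAt_lineEval (g : ℝ × ℝ) (K : ℝ) : HasDerivAt (lineEval g) g.1 K := by
  have : HasDerivAt (fun x => g.1 * x - g.2) (g.1 * 1) K :=
    ((hasDerivAt_id K).const_mul g.1).sub_const _
  rwa [mul_one] at this

theorem rightDeriv_eq {F : ℝ → ℝ} {g : ℝ × ℝ} {K y : ℝ} (hy : K < y)
    (h : ∀ z ∈ Set.Icc K y, F z = lineEval g z) : rightDeriv F K = g.1 := by
  have h1 := (hasDerivAt_lineEval g K).hasDerivWithinAt (s := Set.Ioi K)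
  have h2 : HasDerivWithinAt F g.1 (Set.Ioi K) K := by
    refine h1.congr_of_eventuallyEq ?_ (h K ⟨le_rfl, hy.le⟩)
    filter_upwards [Ioo_mem_nhdsGT hy] with z hz using h z ⟨hz.1.le, hz.2.le⟩
  exact h2.derivWithin (uniqueDiffWithinAt_Ioi K)

theorem leftDeriv_eq {F : ℝ → ℝ} {g : ℝ × ℝ} {K w : ℝ} (hw : w < K)
    (h : ∀ z ∈ Set.Icc w K, F z = lineEval g z) : leftDeriv F K = g.1 := by
  have h1 := (hasDerivAt_lineEval g K).hasDerivWithinAt (s := Set.Iio K)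
  have h2 : HasDerivWithinAt F g.1 (Set.Iio K) K := by
    refine h1.congr_of_eventuallyEq ?_ (h K ⟨hw.le, le_rfl⟩)
    filter_upwards [Ioo_mem_nhdsLT hw] with z hz using h z ⟨hz.1.le, hz.2.le⟩
  exact h2.derivWithin (uniqueDiffWithinAt_Iio K)

/-- A convex function is flatter, in the sense of the intercepts of its tangents, to the left of a
point of contact with a supporting line. -/
theorem Polyhedral.intercept_le {F : ℝ → ℝ} (hF : Polyhedral F) {f : ℝ × ℝ} {x y z : ℝ}
    (hle : ∀ K, 0 ≤ K → lineEval f K ≤ F K) (hx : 0 ≤ x) (hxy : x ≤ y) (hyz : y ≤ z)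
    (hz : F z = lineEval f z) : F y * x - F x * y ≤ f.2 * (y - x) := by
  rcases hxy.eq_or_lt with h | h
  · subst h; simp
  have h1 := hF.convex hx hxy hyz
  rw [hz] at h1
  have h2 := hle x hx
  have hzx : 0 < z - x := by linarith
  have key : (z - x) * (F y * x - F x * y) ≤ (z - x) * (f.2 * (y - x)) := by
    have a1 := mul_le_mul_of_nonneg_left h1 hx
    have a2 := mul_le_mul_of_nonneg_left h2 (mul_nonneg (sub_nonneg.2 hxy) (hx.trans (hxy.trans hyz)))
    unfold lineEval at *
    nlinarith
  exact le_of_mul_le_mul_left key hzx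

end AmericanPut

namespace AmericanPut

open Filter Topology

/-! ### Finitely supported laws and European put prices -/

/-- The integral of `φ` with respect to the finitely supported (signed) measure `μ`. -/
noncomputable def expect (μ : ℝ →₀ ℝ) (φ : ℝ → ℝ) : ℝ := μ.sum fun k p => p * φ k

theorem expect_add_left (μ ν : ℝ →₀ ℝ) (φ : ℝ → ℝ) : expect (μ + ν) φ = expect μ φ + expect ν φ :=
  Finsupp.sum_add_index' (by simp) (by intros; ring)

theorem expect_smul_left (c : ℝ) (μ : ℝ →₀ ℝ) (φ : ℝ → ℝ) : expect (c • μ) φ = c * expect μ φ := by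
  unfold expect
  rw [Finsupp.sum_smul_index' (by simp), Finsupp.mul_sum]
  simp [mul_assoc]

theorem expect_single (k p : ℝ) (φ : ℝ → ℝ) : expect (Finsupp.single k p) φ = p * φ k :=
  Finsupp.sum_single_index (by simp)

theorem expect_eq_sum (μ : ℝ →₀ ℝ) (φ : ℝ → ℝ) : expect μ φ = ∑ k ∈ μ.support, μ k * φ k := rfl

theorem expect_congr {μ : ℝ →₀ ℝ} {φ ψ : ℝ → ℝ} (h : ∀ k ∈ μ.support, φ k = ψ k) :
    expect μ φ = expect μ ψ :=
  Finset.sum_congr rfl fun k hk => by simp only [h k hk]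

theorem expect_add (μ : ℝ →₀ ℝ) (φ ψ : ℝ → ℝ) :
    expect μ (fun k => φ k + ψ k) = expect μ φ + expect μ ψ := by
  simp only [expect_eq_sum, mul_add, Finset.sum_add_distrib]

theorem expect_const_mul (μ : ℝ →₀ ℝ) (c : ℝ) (φ : ℝ → ℝ) :
    expect μ (fun k => c * φ k) = c * expect μ φ := by
  simp only [expect_eq_sum, Finset.mul_sum]
  exact Finset.sum_congr rfl fun k _ => by ring

theorem expect_mono {μ : ℝ →₀ ℝ} (hμ : ∀ k, 0 ≤ μ k) {φ ψ : ℝ → ℝ}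
    (h : ∀ k ∈ μ.support, φ k ≤ ψ k) : expect μ φ ≤ expect μ ψ :=
  Finset.sum_le_sum fun k hk => mul_le_mul_of_nonneg_left (h k hk) (hμ k)

theorem expect_filter (μ : ℝ →₀ ℝ) (q : ℝ → Prop) [DecidablePred q] (φ : ℝ → ℝ) :
    expect (μ.filter q) φ = expect μ (fun k => if q k then φ k else 0) := by
  rw [expect_eq_sum, expect_eq_sum, Finsupp.support_filter, Finset.sum_filter]
  refine Finset.sum_congr rfl fun k _ => ?_
  split_ifs with h
  · rw [Finsupp.filter_apply_pos q μ h]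
  · simp

/-- `μ` is a probability law on `[0, ∞)`, whose mean is `s` discounted over the period `L`. -/
structure IsLaw (r L s : ℝ) (μ : ℝ →₀ ℝ) : Prop where
  nonneg : ∀ k, 0 ≤ μ k
  atoms : ∀ k ∈ μ.support, 0 ≤ k
  mass : expect μ (fun _ => 1) = 1
  mean : expect μ (fun k => k) = s * Real.exp (r * L)

theorem europeanPut_eq (r L : ℝ) (μ : ℝ →₀ ℝ) (K : ℝ) :
    europeanPut r L μ K = Real.exp (-(r * L)) * expect μ (fun k => max (K - k) 0) := rfl

namespace IsLaw

variable {r L s : ℝ} {μ : ℝ →₀ ℝ}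

theorem pos (h : IsLaw r L s μ) {k : ℝ} (hk : k ∈ μ.support) : 0 < μ k :=
  (h.nonneg k).lt_of_ne (Finsupp.mem_support_iff.1 hk).symm

theorem support_nonempty (h : IsLaw r L s μ) : μ.support.Nonempty := by
  by_contra h0
  have := h.mass
  rw [expect_eq_sum, Finset.not_nonempty_iff_eq_empty.1 h0] at this
  simp at this

theorem expect_const (h : IsLaw r L s μ) (c : ℝ) : expect μ (fun _ => c) = c := by
  have := expect_const_mul μ c (fun _ => 1)
  simpa [h.mass] using this

theorem expect_affine (h : IsLaw r L s μ) (K : ℝ) :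
    expect μ (fun k => K - k) = K - s * Real.exp (r * L) := by
  have := expect_add μ (fun _ => K) (fun k => (-1) * k)
  rw [h.expect_const, expect_const_mul, h.mean] at this
  rw [show (fun k : ℝ => K - k) = fun k => K + (-1) * k by ext; ring, this]
  ring

theorem discount_affine (h : IsLaw r L s μ) (K : ℝ) :
    Real.exp (-(r * L)) * expect μ (fun k => K - k) = Real.exp (-(r * L)) * K - s := by
  rw [h.expect_affine, mul_sub, mul_left_comm, ← Real.exp_add]
  simp

theorem mean_nonneg (h : IsLaw r L s μ) : 0 ≤ s := by
  have h1 : 0 ≤ s * Real.exp (r * L) := by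
    rw [← h.mean, expect_eq_sum]
    exact Finset.sum_nonneg fun k hk => mul_nonneg (h.nonneg k) (h.atoms k hk)
  exact nonneg_of_mul_nonneg_left h1 (Real.exp_pos _)

theorem put_nonneg (h : IsLaw r L s μ) (K : ℝ) : 0 ≤ europeanPut r L μ K := by
  rw [europeanPut_eq, expect_eq_sum]
  exact mul_nonneg (Real.exp_pos _).le
    (Finset.sum_nonneg fun k _ => mul_nonneg (h.nonneg k) (le_max_right _ _))

theorem put_eq_zero (_h : IsLaw r L s μ) {K : ℝ} (hK : ∀ k ∈ μ.support, K ≤ k) :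
    europeanPut r L μ K = 0 := by
  rw [europeanPut_eq, expect_congr (ψ := fun _ => 0)]
  · simp [expect_eq_sum]
  · intro k hk
    exact max_eq_right (by linarith [hK k hk])

theorem put_zero (h : IsLaw r L s μ) : europeanPut r L μ 0 = 0 := h.put_eq_zero h.atoms

theorem put_lower (h : IsLaw r L s μ) (K : ℝ) :
    Real.exp (-(r * L)) * K - s ≤ europeanPut r L μ K := by
  rw [← h.discount_affine, europeanPut_eq]
  exact mul_le_mul_of_nonneg_left (expect_mono h.nonneg fun k _ => le_max_left _ _)
    (Real.exp_pos _).le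

theorem put_eq_of_ge (h : IsLaw r L s μ) {K : ℝ} (hK : ∀ k ∈ μ.support, k ≤ K) :
    europeanPut r L μ K = Real.exp (-(r * L)) * K - s := by
  rw [← h.discount_affine, europeanPut_eq]
  congr 1
  exact expect_congr fun k hk => max_eq_left (by linarith [hK k hk])

theorem put_sub_le (h : IsLaw r L s μ) {x y : ℝ} (hxy : x ≤ y) :
    europeanPut r L μ y - europeanPut r L μ x ≤ Real.exp (-(r * L)) * (y - x) := by
  rw [europeanPut_eq, europeanPut_eq, ← mul_sub]
  refine mul_le_mul_of_nonneg_left ?_ (Real.exp_pos _).le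
  rw [sub_le_iff_le_add]
  have := expect_add μ (fun _ => y - x) (fun k => max (x - k) 0)
  rw [h.expect_const] at this
  rw [← this]
  refine expect_mono h.nonneg fun k _ => ?_
  refine max_le ?_ ?_
  · linarith [le_max_left (x - k) 0]
  · linarith [le_max_right (x - k) 0]

/-- The slope is at most `e^{-rL}` and the value at `x` at least `e^{-rL} x - s`, so no chord meets
the vertical axis below `-s`. -/
theorem put_intercept_le (h : IsLaw r L s μ) {x y : ℝ} (hx : 0 ≤ x) (hxy : x ≤ y) :
    europeanPut r L μ y * x - europeanPut r L μ x * y ≤ s * (y - x) := by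
  have h1 := mul_le_mul_of_nonneg_left (h.put_sub_le hxy) hx
  have h2 := mul_le_mul_of_nonneg_right (h.put_lower x) (sub_nonneg.2 hxy)
  nlinarith

/-- Each payoff has its only kink at its atom, and no atom lies strictly between `x` and `y`. -/
theorem put_affine (_h : IsLaw r L s μ) {x y z : ℝ} (hxz : x ≤ z) (hzy : z ≤ y)
    (hno : ∀ k ∈ μ.support, x < k → y ≤ k) :
    (y - x) * europeanPut r L μ z =
      (y - z) * europeanPut r L μ x + (z - x) * europeanPut r L μ y := by
  simp only [europeanPut_eq]
  have h1 := expect_const_mul μ (y - x) (fun k => max (z - k) 0)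
  have h2 := expect_const_mul μ (y - z) (fun k => max (x - k) 0)
  have h3 := expect_const_mul μ (z - x) (fun k => max (y - k) 0)
  have h4 := expect_add μ (fun k => (y - z) * max (x - k) 0) (fun k => (z - x) * max (y - k) 0)
  have h5 : expect μ (fun k => (y - x) * max (z - k) 0) =
      expect μ (fun k => (y - z) * max (x - k) 0 + (z - x) * max (y - k) 0) := by
    refine expect_congr fun k hk => ?_
    rcases le_or_gt k x with hkx | hkx
    · rw [max_eq_left (by linarith), max_eq_left (by linarith), max_eq_left (by linarith)]
      ring
    · have := hno k hk hkx
      rw [max_eq_right (by linarith), max_eq_right (by linarith), max_eq_right (by linarith)]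
      ring
  rw [h1, h4, h2, h3] at h5
  linear_combination Real.exp (-(r * L)) * h5

end IsLaw

theorem polyhedral_max_sub (k : ℝ) : Polyhedral (fun K => max (K - k) 0) := by
  have := (polyhedral_lineEval (1, k)).max polyhedral_zero
  exact this.congr fun K _ => by simp [lineEval]

theorem polyhedral_expect {ν : ℝ →₀ ℝ} (hν : ∀ k, 0 ≤ ν k) :
    Polyhedral (fun K => expect ν (fun k => max (K - k) 0)) := by
  simp only [expect_eq_sum]
  generalize ν.support = t
  induction t using Finset.induction_on with
  | empty => simpa using polyhedral_zero
  | insert a t ha ih =>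
    simp only [Finset.sum_insert ha]
    exact ((polyhedral_max_sub a).const_mul (hν a)).add ih

theorem IsLaw.polyhedral_put {r L s : ℝ} {μ : ℝ →₀ ℝ} (h : IsLaw r L s μ) :
    Polyhedral (europeanPut r L μ) :=
  (polyhedral_expect h.nonneg).const_mul (Real.exp_pos _).le

/-- The line followed by the put price function to the right of an atom extends to the
next one. -/
theorem IsLaw.put_eq_right {r L s : ℝ} {μ : ℝ →₀ ℝ} (h : IsLaw r L s μ) {k K : ℝ} (hk : 0 ≤ k)
    (hkK : k ≤ K) (hno : ∀ k' ∈ μ.support, k < k' → K ≤ k') :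
    europeanPut r L μ K =
      europeanPut r L μ k + rightDeriv (europeanPut r L μ) k * (K - k) := by
  obtain ⟨g, -, y, hy, hgy⟩ := h.polyhedral_put.exists_right hk
  rw [rightDeriv_eq hy hgy]
  rcases hkK.eq_or_lt with rfl | hlt
  · simp
  have hz : k < min y K := lt_min hy hlt
  have h1 := h.put_affine hz.le (min_le_right y K) hno
  rw [hgy _ ⟨hz.le, min_le_left _ _⟩, hgy k ⟨le_rfl, hy.le⟩] at h1
  rw [hgy k ⟨le_rfl, hy.le⟩]
  have h2 : (min y K - k) * europeanPut r L μ K =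
      (min y K - k) * (lineEval g k + g.1 * (K - k)) := by
    unfold lineEval at *; linarith
  exact mul_left_cancel₀ (sub_pos.2 hz).ne' h2

end AmericanPut

/-! ### The invariant of the algorithm. -/

namespace AmericanPut

open Filter Topology

/-- The standing conditions on a node of the algorithm: spot price `s`, remaining contract length
`L`, law `μ` at maturity and American price function `A`. -/
structure Node (r L s : ℝ) (μ : ℝ →₀ ℝ) (A : ℝ → ℝ) : Prop where
  rate_pos : 0 < r
  length_pos : 0 < L
  law : IsLaw r L s μ
  polyhedral : Polyhedral A
  zero : A 0 = 0
  legendre : ∀ x y, 0 < x → x ≤ y →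
    (A x - europeanPut r L μ x) * y ≤ (A y - europeanPut r L μ y) * x
  european_le : ∀ K, 0 ≤ K → europeanPut r L μ K ≤ A K
  intrinsic_le : ∀ K, 0 ≤ K → K - s ≤ A K
  le_upper : ∀ K, 0 ≤ K → A K ≤ europeanPut r L μ (Real.exp (r * L) * K)

/-! ### The root node -/

/-- A broken line is a signed combination of put payoffs weighted by its slope jumps, which add up
to the last slope. A first segment of slope `m` contributes `m` at `p.1` and `-m` at `q.1`, so that
beyond `q.1` only the increment `q.2 - p.2` remains. -/
theorem exists_expect_interpolateFrom (σ : ℝ) (l : List (ℝ × ℝ)) (p : ℝ × ℝ)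
    (hl : (p.1 :: l.map Prod.fst).Pairwise (· < ·)) :
    ∃ ν : ℝ →₀ ℝ, (∀ k ∈ ν.support, p.1 ≤ k) ∧ expect ν (fun _ => 1) = σ ∧
      ∀ K, p.1 ≤ K → interpolateFrom σ p l K = p.2 + expect ν (fun k => max (K - k) 0) := by
  induction l generalizing p with
  | nil =>
    refine ⟨Finsupp.single p.1 σ, ?_, ?_, ?_⟩
    · intro k hk
      rw [Finset.mem_singleton.1 (Finsupp.support_single_subset hk)]
    · rw [expect_single, mul_one]
    · intro K hK
      rw [expect_single, max_eq_left (by linarith), interpolateFrom]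
  | cons q l ih =>
    rw [List.map_cons, List.pairwise_cons] at hl
    obtain ⟨ν, h1, h2, h3⟩ := ih q hl.2
    have hpq : p.1 < q.1 := hl.1 _ (List.mem_cons_self ..)
    set m := (q.2 - p.2) / (q.1 - p.1) with hm
    have hm' : m * (q.1 - p.1) = q.2 - p.2 := div_mul_cancel₀ _ (sub_pos.2 hpq).ne'
    refine ⟨ν + Finsupp.single p.1 m + Finsupp.single q.1 (-m), ?_, ?_, ?_⟩
    · classical
      intro k hk
      rcases Finset.mem_union.1 (Finsupp.support_add hk) with hk | hk
      · rcases Finset.mem_union.1 (Finsupp.support_add hk) with hk | hk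
        · exact hpq.le.trans (h1 k hk)
        · rw [Finset.mem_singleton.1 (Finsupp.support_single_subset hk)]
      · rw [Finset.mem_singleton.1 (Finsupp.support_single_subset hk)]
        exact hpq.le
    · rw [expect_add_left, expect_add_left, expect_single, expect_single, h2]
      ring
    · intro K hK
      rw [expect_add_left, expect_add_left, expect_single, expect_single, interpolateFrom,
        max_eq_left (by linarith : 0 ≤ K - p.1)]
      split_ifs with h
      · rw [max_eq_right (by linarith : K - q.1 ≤ 0), expect_congr (ψ := fun _ => 0)]
        · rw [← hm]
          simp [expect_eq_sum]
        · intro k hk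
          exact max_eq_right (by linarith [h1 k hk])
      · rw [h3 K (by linarith), max_eq_left (by linarith : 0 ≤ K - q.1)]
        linarith

theorem exists_expect_interpolate (σ : ℝ) (l : List (ℝ × ℝ)) (hl : StrikesIncreasing l) :
    ∃ ν : ℝ →₀ ℝ, (∀ k ∈ ν.support, 0 ≤ k) ∧ expect ν (fun _ => 1) = σ ∧
      ∀ K, 0 ≤ K → interpolate σ l K = expect ν (fun k => max (K - k) 0) := by
  obtain ⟨ν, h1, h2, h3⟩ := exists_expect_interpolateFrom σ l (0, 0) hl
  exact ⟨ν, h1, h2, fun K hK => by rw [interpolate, h3 K hK, zero_add]⟩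

/-- Convexity and monotonicity make the masses non-negative. -/
theorem nonneg_of_convexOn {ν : ℝ →₀ ℝ} (hν : ∀ k ∈ ν.support, 0 ≤ k) {F : ℝ → ℝ}
    (hF : ∀ K, 0 ≤ K → F K = expect ν (fun k => max (K - k) 0)) (hm : MonotoneOn F (Set.Ici 0))
    (hc : ConvexOn ℝ (Set.Ici 0) F) (k : ℝ) : 0 ≤ ν k := by
  by_cases hk : k ∈ ν.support
  swap
  · rw [Finsupp.notMem_support_iff.1 hk]
  have hk0 := hν k hk
  obtain ⟨ε, hε, hsep⟩ : ∃ ε > 0, ∀ x ∈ ν.support.erase k, ε ≤ |x - k| := by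
    rcases (ν.support.erase k).eq_empty_or_nonempty with h | h
    · exact ⟨1, one_pos, by simp [h]⟩
    · obtain ⟨x, hx, hmin⟩ := (ν.support.erase k).exists_min_image (fun x => |x - k|) h
      exact ⟨|x - k|, abs_pos.2 (sub_ne_zero.2 (Finset.ne_of_mem_erase hx)), hmin⟩
  have hsplit : ∀ K, expect ν (fun x => max (K - x) 0) = ν k * max (K - k) 0 +
      ∑ x ∈ ν.support.erase k, ν x * max (K - x) 0 := fun K => by
    rw [expect_eq_sum, Finset.add_sum_erase _ (fun x => ν x * max (K - x) 0) hk]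
  -- At the atom `0` there is no room on the left for convexity, and monotonicity on `[0, ε]`
  -- replaces it. Elsewhere the second difference with step `δ` isolates `ν k`, since all other
  -- payoffs are affine on `[k - δ, k + δ]`.
  rcases hk0.eq_or_lt with h0 | h0
  · subst h0
    have h1 := hm (Set.mem_Ici.2 le_rfl) (Set.mem_Ici.2 hε.le) hε.le
    rw [hF 0 le_rfl, hF ε hε.le, hsplit, hsplit] at h1
    have e : ∀ x ∈ ν.support.erase 0, max (ε - x) 0 = 0 ∧ max (0 - x) 0 = 0 := by
      intro x hx
      have h2 := hsep x hx
      have h3 := hν x (Finset.mem_of_mem_erase hx)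
      rw [sub_zero, abs_of_nonneg h3] at h2
      exact ⟨max_eq_right (by linarith), max_eq_right (by linarith)⟩
    rw [Finset.sum_eq_zero fun x hx => by rw [(e x hx).2, mul_zero],
      Finset.sum_eq_zero fun x hx => by rw [(e x hx).1, mul_zero], max_eq_left (by linarith),
      max_eq_left (by linarith)] at h1
    simp only [sub_zero, mul_zero, add_zero] at h1
    exact nonneg_of_mul_nonneg_left h1 hε
  · set δ := min ε k with hδ
    have hδ0 : 0 < δ := lt_min hε h0
    have hδε : δ ≤ ε := min_le_left _ _
    have hδk : δ ≤ k := min_le_right _ _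
    have h1 := hc.2 (x := k - δ) (y := k + δ) (Set.mem_Ici.2 (by linarith))
      (Set.mem_Ici.2 (by linarith)) (by norm_num : (0 : ℝ) ≤ 1 / 2)
      (by norm_num : (0 : ℝ) ≤ 1 / 2) (by norm_num)
    simp only [smul_eq_mul] at h1
    rw [show 1 / 2 * (k - δ) + 1 / 2 * (k + δ) = k by ring, hF (k - δ) (by linarith),
      hF (k + δ) (by linarith), hF k h0.le, hsplit, hsplit, hsplit, max_eq_right (by linarith),
      max_eq_right (by linarith), max_eq_left (by linarith)] at h1
    have e : ∑ x ∈ ν.support.erase k, ν x * max (k - x) 0 =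
        1 / 2 * ∑ x ∈ ν.support.erase k, ν x * max (k - δ - x) 0 +
        1 / 2 * ∑ x ∈ ν.support.erase k, ν x * max (k + δ - x) 0 := by
      rw [Finset.mul_sum, Finset.mul_sum, ← Finset.sum_add_distrib]
      refine Finset.sum_congr rfl fun x hx => ?_
      have h2 := hsep x hx
      rcases le_abs.1 h2 with h3 | h3
      · rw [max_eq_right (by linarith), max_eq_right (by linarith), max_eq_right (by linarith)]
        ring
      · rw [max_eq_left (by linarith), max_eq_left (by linarith), max_eq_left (by linarith)]
        ring
    have h3 : 0 ≤ ν k * δ := by linarith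
    exact nonneg_of_mul_nonneg_left h3 hδ0

theorem Polyhedral.continuousOn {F : ℝ → ℝ} (hF : Polyhedral F) {a b : ℝ} (ha : 0 < a) :
    ContinuousOn F (Set.Icc a b) := by
  have h : ConvexOn ℝ (Set.Ioi (0 : ℝ)) F := by
    refine ⟨convex_Ioi 0, fun x hx y hy α β hα hβ hαβ => ?_⟩
    obtain ⟨P, hP⟩ := hF
    have hz : 0 ≤ α • x + β • y := add_nonneg (mul_nonneg hα (le_of_lt hx)) (mul_nonneg hβ (le_of_lt hy))
    obtain ⟨f, hf, hfz⟩ := hP.attained _ hz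
    have h1 := mul_le_mul_of_nonneg_left (hP.le f hf x (le_of_lt hx)) hα
    have h2 := mul_le_mul_of_nonneg_left (hP.le f hf y (le_of_lt hy)) hβ
    rw [hfz]
    simp only [lineEval, smul_eq_mul] at *
    have h3 : f.2 = α * f.2 + β * f.2 := by rw [← add_mul, hαβ, one_mul]
    nlinarith
  exact (h.continuousOn isOpen_Ioi).mono fun x hx => lt_of_lt_of_le ha hx.1

/-- The comparison of the intercepts of tangents, integrated. -/
theorem Polyhedral.legendre_mono {A E : ℝ → ℝ} (hA : Polyhedral A) (hE : Polyhedral E)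
    (h : ∀ K, 0 ≤ K → rightDeriv E K * K - E K ≤ rightDeriv A K * K - A K) {x y : ℝ} (hx : 0 < x)
    (hxy : x ≤ y) : (A x - E x) * y ≤ (A y - E y) * x := by
  -- The hypothesis compares the right derivatives of `E z / z` and `A z / z`, whose numerators are
  -- the intercepts of the tangents.
  have hderiv : ∀ {F : ℝ → ℝ}, Polyhedral F → ∀ K, 0 < K → HasDerivWithinAt (fun z => F z / z)
      ((rightDeriv F K * K - F K) / K ^ 2) (Set.Ici K) K := by
    intro F hF K hK
    obtain ⟨g, -, z, hz, hgz⟩ := hF.exists_right hK.le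
    have h1 : HasDerivWithinAt F g.1 (Set.Ici K) K := by
      refine (hasDerivAt_lineEval g K).hasDerivWithinAt.congr_of_eventuallyEq ?_
        (hgz K ⟨le_rfl, hz.le⟩)
      filter_upwards [Icc_mem_nhdsGE hz] with w hw using hgz w hw
    rw [rightDeriv_eq hz hgz]
    have h2 : HasDerivWithinAt (fun z => F z / z) ((g.1 * K - F K * 1) / K ^ 2) (Set.Ici K) K :=
      h1.div (hasDerivWithinAt_id K (Set.Ici K)) hK.ne'
    rwa [mul_one] at h2
  have hy : 0 < y := hx.trans_le hxy
  have key : E y / y ≤ A y / y + (E x / x - A x / x) := by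
    refine image_le_of_deriv_right_le_deriv_boundary (f := fun z => E z / z)
      (f' := fun K => (rightDeriv E K * K - E K) / K ^ 2)
      (B := fun z => A z / z + (E x / x - A x / x))
      (B' := fun K => (rightDeriv A K * K - A K) / K ^ 2) (a := x) (b := y) ?_ ?_ ?_ ?_ ?_ ?_
      ⟨hxy, le_rfl⟩
    · exact (hE.continuousOn hx).div continuousOn_id fun z hz => (hx.trans_le hz.1).ne'
    · intro z hz; exact hderiv hE z (hx.trans_le hz.1)
    · simp
    · exact ((hA.continuousOn hx).div continuousOn_id fun z hz =>
        (hx.trans_le hz.1).ne').add continuousOn_const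
    · intro z hz; exact (hderiv hA z (hx.trans_le hz.1)).add_const _
    · intro z hz
      exact div_le_div_of_nonneg_right (h z (hx.le.trans hz.1)) (sq_nonneg _)
  have h2 : (A x - E x) / x ≤ (A y - E y) / y := by
    rw [sub_div, sub_div]; linarith
  rwa [div_le_div_iff₀ hx hy] at h2

/-- The slope jumps of `E` are non-negative with sum `e^{-rT}`, so multiplication by `e^{rT}` gives
a probability law. That its discounted mean is `S₀` is where the strict slope condition enters. -/
theorem exists_root {r T S₀ : ℝ} (hr : 0 < r) (hT : 0 < T) {americanQuotes europeanQuotes :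
    List (ℝ × ℝ)} (hAm : StrikesIncreasing americanQuotes) (hEu : StrikesIncreasing europeanQuotes)
    {A E : ℝ → ℝ} (hA : A = interpolate 1 americanQuotes)
    (hE : E = interpolate (Real.exp (-(r * T))) europeanQuotes)
    (hEcond : EuropeanConditions r T S₀ E) (hAcond : AmericanConditions r T S₀ A E) :
    ∃ μ : ℝ →₀ ℝ, IsImpliedLaw r T S₀ E μ ∧ Node r T S₀ μ A := by
  obtain ⟨ν, ν1, ν2, ν3⟩ := exists_expect_interpolate _ _ hEu
  obtain ⟨ξ, ξ1, -, ξ3⟩ := exists_expect_interpolate _ _ hAm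
  rw [← hE] at ν3
  rw [← hA] at ξ3
  have νpos := nonneg_of_convexOn ν1 ν3 hEcond.increasing hEcond.convex
  have ξpos := nonneg_of_convexOn ξ1 ξ3 hAcond.increasing hAcond.convex
  set μ : ℝ →₀ ℝ := Real.exp (r * T) • ν with hμ
  have hsub : ∀ k ∈ μ.support, 0 ≤ k := fun k hk => ν1 k (Finsupp.support_smul hk)
  have hexp : Real.exp (-(r * T)) * Real.exp (r * T) = 1 := by rw [← Real.exp_add]; simp
  have hprice : ∀ K, 0 ≤ K → europeanPut r T μ K = E K := fun K hK => by
    rw [europeanPut_eq, hμ, expect_smul_left, ← mul_assoc, hexp, one_mul, ν3 K hK]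
  have hpos : ∀ k, 0 ≤ μ k := fun k => by
    rw [hμ, Finsupp.smul_apply, smul_eq_mul]
    exact mul_nonneg (Real.exp_pos _).le (νpos k)
  have hmass : expect μ (fun _ => 1) = 1 := by
    rw [hμ, expect_smul_left, ν2, mul_comm, hexp]
  set s := Real.exp (-(r * T)) * expect μ (fun k => k) with hs
  have hlaw' : IsLaw r T s μ := ⟨hpos, hsub, hmass, by
    rw [hs, mul_right_comm, hexp, one_mul]⟩
  -- Beyond all atoms `E` is the line `e^{-rT} K - s`. The lower bound gives `s ≤ S₀`; were it
  -- strict, `E` would exceed `e^{-rT} K - S₀` with slope `e^{-rT}`, which the slope condition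
  -- forbids.
  have hsS : s = S₀ := by
    obtain ⟨N, hN⟩ := μ.support.bddAbove
    have hN' : ∀ k ∈ μ.support, k ≤ max N 0 := fun k hk => (hN hk).trans (le_max_left _ _)
    have hN0 : 0 ≤ max N 0 := le_max_right _ _
    have e1 := hlaw'.put_eq_of_ge hN'
    rw [hprice _ hN0] at e1
    have e2 := hEcond.lower _ hN0
    rw [e1] at e2
    have e3 := (le_max_left _ _).trans e2
    by_contra hne
    have hlt : s < S₀ := lt_of_le_of_ne (by linarith) hne
    have e4 := hEcond.slope _ hN0 (by rw [e1]; linarith)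
    rw [rightDeriv_eq (g := (Real.exp (-(r * T)), s)) (lt_add_one _)] at e4
    · exact lt_irrefl _ e4
    · intro z hz
      rw [← hprice z (hN0.trans hz.1), hlaw'.put_eq_of_ge fun k hk => (hN' k hk).trans hz.1]
      rfl
  rw [hsS] at hlaw'
  refine ⟨μ, ⟨hpos, hsub, ?_, hlaw'.mean, hprice⟩, ?_⟩
  · simpa [expect] using hmass
  have hApoly : Polyhedral A := (polyhedral_expect ξpos).congr ξ3
  have hEpoly : Polyhedral E := hlaw'.polyhedral_put.congr fun K hK => (hprice K hK).symm
  have hA0 : A 0 = 0 := by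
    have h1 := hAcond.upper 0 le_rfl
    have h2 := (le_max_left _ _).trans (hAcond.lower 0 le_rfl)
    rw [mul_zero, hEcond.zero] at h1
    rw [hEcond.zero] at h2
    exact le_antisymm h1 h2
  refine ⟨hr, hT, hlaw', hApoly, hA0, ?_, ?_, ?_, ?_⟩
  · intro x y hx hxy
    rw [hprice x hx.le, hprice y (hx.le.trans hxy)]
    exact hApoly.legendre_mono hEpoly hAcond.legendre hx hxy
  · intro K hK
    rw [hprice K hK]
    exact (le_max_left _ _).trans (hAcond.lower K hK)
  · intro K hK
    exact (le_max_right _ _).trans (hAcond.lower K hK)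
  · intro K hK
    rw [hprice _ (mul_nonneg (Real.exp_pos _).le hK)]
    exact hAcond.upper K hK

end AmericanPut

namespace AmericanPut

open Filter Topology

/-! ### The extension of the American price function -/

/-- Monotonicity of `D x / x`, in a form without division, is transitive through the common point
`b`. -/
theorem glue_div_mono {D : ℝ → ℝ} {b B : ℝ} (hb : 0 < b)
    (h1 : ∀ x y, 0 < x → x ≤ y → y ≤ b → D x * y ≤ D y * x)
    (h2 : ∀ x y, b ≤ x → x ≤ y → y ≤ B → D x * y ≤ D y * x) {x y : ℝ} (hx : 0 < x) (hxy : x ≤ y)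
    (hy : y ≤ B) : D x * y ≤ D y * x := by
  rcases le_total y b with h | h
  · exact h1 x y hx hxy h
  rcases le_total b x with h' | h'
  · exact h2 x y h' hxy hy
  have e1 := mul_le_mul_of_nonneg_right (h1 x b hx h' le_rfl) (hb.le.trans h)
  have e2 := mul_le_mul_of_nonneg_right (h2 b y le_rfl h hy) hx.le
  have : b * (D x * y) ≤ b * (D y * x) := by nlinarith
  exact le_of_mul_le_mul_left this hb

/-- A node whose American prices are those of the model without splitting. -/
def IsTrivial (r L s : ℝ) (μ : ℝ →₀ ℝ) (A : ℝ → ℝ) : Prop :=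
  ∀ K, 0 ≤ K → A K = max (europeanPut r L μ K) (max (K - s) 0)

/-- The extension `Aext` of the American price function of a node: it follows `A` up to `Kt`, the
line `g` up to `Kp`, and `E K + c K` afterwards. -/
structure Extended (r L s : ℝ) (μ : ℝ →₀ ℝ) (A Aext : ℝ → ℝ) (Kt Kp : ℝ) (g : ℝ × ℝ) (c : ℝ) :
    Prop where
  Kt_pos : 0 < Kt
  Kt_le : Kt ≤ Kp
  eq_A : ∀ K, 0 ≤ K → K ≤ Kt → Aext K = A K
  eq_line : ∀ K, Kt ≤ K → K ≤ Kp → Aext K = lineEval g K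
  eq_tail : ∀ K, Kp ≤ K → Aext K = europeanPut r L μ K + c * K
  line_lt : ∀ K, Kp < K → lineEval g K < Aext K
  line_le : ∀ K, 0 ≤ K → lineEval g K ≤ Aext K
  slope_lt : g.1 < 1
  left : ∃ w, 0 ≤ w ∧ w < Kt ∧ ∀ z ∈ Set.Icc w Kt, A z = lineEval g z
  exercise : ∀ K, Kt ≤ K → A K = K - s
  polyhedral : Polyhedral Aext
  le_A : ∀ K, 0 ≤ K → Aext K ≤ A K
  legendre : ∀ x y, 0 < x → x ≤ y →
    (Aext x - europeanPut r L μ x) * y ≤ (Aext y - europeanPut r L μ y) * x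
  european_le : ∀ K, 0 ≤ K → europeanPut r L μ K ≤ Aext K

namespace Node

variable {r L s : ℝ} {μ : ℝ →₀ ℝ} {A : ℝ → ℝ}

theorem nonneg (h : Node r L s μ A) {K : ℝ} (hK : 0 ≤ K) : 0 ≤ A K :=
  (h.law.put_nonneg K).trans (h.european_le K hK)

theorem isTrivial_of_le (h : Node r L s μ A)
    (hle : ∀ K, 0 ≤ K → A K ≤ max (europeanPut r L μ K) (K - s)) : IsTrivial r L s μ A := by
  intro K hK
  refine le_antisymm ((hle K hK).trans (max_le_max le_rfl (le_max_left _ _))) ?_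
  exact max_le (h.european_le K hK) (max_le (h.intrinsic_le K hK) (h.nonneg hK))

theorem upper_eq (h : Node r L s μ A) {K : ℝ}
    (hK : ∀ k ∈ μ.support, k ≤ Real.exp (r * L) * K) :
    europeanPut r L μ (Real.exp (r * L) * K) = K - s := by
  rw [h.law.put_eq_of_ge hK, ← mul_assoc, ← Real.exp_add]
  simp

/-- If `s = 0`, the upper bound is at most `K = K - s`, so immediate exercise is always optimal and
the picture is trivial. -/
theorem spot_pos (h : Node r L s μ A) (hnt : ¬ IsTrivial r L s μ A) : 0 < s := by
  refine h.law.mean_nonneg.lt_of_ne fun h0 => hnt ?_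
  refine h.isTrivial_of_le fun K hK => le_max_of_le_right ?_
  refine (h.le_upper K hK).trans ?_
  have h1 : 0 ≤ Real.exp (r * L) * K := mul_nonneg (Real.exp_pos _).le hK
  have h2 := h.law.put_sub_le h1
  rw [h.law.put_zero, sub_zero, sub_zero, ← mul_assoc, ← Real.exp_add] at h2
  rw [← h0]
  simpa using h2

/-- For a line `a K - d` the tangent intercept in the Legendre condition is `d`. Along the prolonged
piece `g` the quotient `(Aext - E) / K` increases as long as the intercepts of `E` stay below `g.2`;
from the first atom where they exceed it, `E K + c K` keeps the quotient constant. -/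
theorem exists_extended (h : Node r L s μ A) (hnt : ¬ IsTrivial r L s μ A) :
    ∃ Aext Kt Kp g c, Extended r L s μ A Aext Kt Kp g c ∧
      IsExtension s μ (europeanPut r L μ) A Aext Kp := by
  have hs := h.spot_pos hnt
  have hexp : 0 < Real.exp (r * L) := Real.exp_pos _
  have hexp1 : 1 ≤ Real.exp (r * L) := Real.one_le_exp (mul_pos h.rate_pos h.length_pos).le
  obtain ⟨kN, hkN, hkmax⟩ := μ.support.exists_max_image id h.law.support_nonempty
  have hkN0 := h.law.atoms kN hkN
  -- From `Z` on, `e^{rL} K` lies beyond every atom, the upper bound equals `K - s`, and so does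
  -- `A`.
  set Z := kN / Real.exp (r * L) with hZ
  have hZ0 : 0 ≤ Z := div_nonneg hkN0 hexp.le
  have hZk : Z ≤ kN := div_le_self hkN0 hexp1
  have hZA : ∀ K, Z ≤ K → A K = K - s := fun K hK => by
    have hK0 := hZ0.trans hK
    refine le_antisymm ?_ (h.intrinsic_le K hK0)
    refine (h.le_upper K hK0).trans_eq (h.upper_eq fun k hk => (hkmax k hk).trans ?_)
    simp only [id]
    rw [hZ, div_le_iff₀ hexp] at hK
    linarith
  have hl1 : ∀ K, lineEval (1, s) K = K - s := fun K => by simp [lineEval]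
  obtain ⟨Kt, ⟨hKt0, hKt⟩, hKtmin⟩ := h.polyhedral.exists_isLeast_contact (f := (1, s))
    (fun K hK => by rw [hl1]; exact h.intrinsic_le K hK) ⟨Z, hZ0, by rw [hl1]; exact hZA Z le_rfl⟩
  have hKtZ : Kt ≤ Z := hKtmin ⟨hZ0, by rw [hl1]; exact hZA Z le_rfl⟩
  have hstrike : exerciseStrike s A = Kt := by
    refine IsLeast.csInf_eq ⟨⟨hKt0, by rw [← hl1]; exact hKt⟩, fun K hK => hKtmin ⟨hK.1, ?_⟩⟩
    rw [hl1]; exact hK.2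
  have hKtpos : 0 < Kt := by
    refine hKt0.lt_of_ne fun h0 => ?_
    rw [← h0, h.zero, hl1] at hKt
    linarith
  have hex : ∀ K, Kt ≤ K → A K = K - s := fun K hK => by
    have hm : K ≤ max K Z := le_max_left _ _
    have := h.polyhedral.eq_of_touch (f := (1, s))
      (fun K hK => by rw [hl1]; exact h.intrinsic_le K hK) hKt0 hK hm hKt
      (by rw [hl1]; exact hZA _ (le_max_right _ _))
    rwa [hl1] at this
  obtain ⟨g, hgle, w, hw0, hwKt, hgw⟩ := h.polyhedral.exists_left hKtpos
  have hld : leftDeriv A Kt = g.1 := leftDeriv_eq hwKt hgw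
  have hgKt : lineEval g Kt = Kt - s := by rw [← hgw Kt ⟨hwKt.le, le_rfl⟩, hex Kt le_rfl]
  have hprol : ∀ K, prolongation s A K = lineEval g K := fun K => by
    rw [prolongation, hstrike, hld, hex Kt le_rfl, ← hgKt]
    unfold lineEval; ring
  have hg1 : g.1 < 1 := by
    have h1 : w - s < A w := lt_of_le_of_ne (h.intrinsic_le w hw0) fun h1 =>
      absurd (hKtmin ⟨hw0, by rw [hl1]; exact h1.symm⟩) (not_le.2 hwKt)
    rw [hgw w ⟨le_rfl, hwKt.le⟩] at h1
    unfold lineEval at *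
    by_contra! hc
    nlinarith [mul_le_mul_of_nonneg_right hc (sub_pos.2 hwKt).le]
  have hg2 : g.2 < s := by
    unfold lineEval at hgKt
    nlinarith [mul_lt_mul_of_pos_right hg1 hKtpos]
  set E := europeanPut r L μ with hE
  have hEpoly : Polyhedral E := h.law.polyhedral_put
  have hviol : ∀ k, (leftDeriv A (exerciseStrike s A) * k - prolongation s A k <
      rightDeriv E k * k - E k) ↔ g.2 < rightDeriv E k * k - E k := fun k => by
    rw [hstrike, hld, hprol]
    unfold lineEval
    rw [sub_sub_cancel]
  set V : Finset ℝ := μ.support.filter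
    (fun k => Kt ≤ k ∧ g.2 < rightDeriv E k * k - E k) with hV
  -- Right of the largest atom `E` is the line `e^{-rL} K - s`, whose intercept `s` exceeds `g.2`; a
  -- violation therefore occurs.
  have hVne : V.Nonempty := by
    refine ⟨kN, Finset.mem_filter.2 ⟨hkN, hKtZ.trans hZk, ?_⟩⟩
    rw [rightDeriv_eq (g := (Real.exp (-(r * L)), s)) (lt_add_one kN), hE,
      h.law.put_eq_of_ge (K := kN) hkmax]
    · simpa using hg2
    · intro z hz
      exact h.law.put_eq_of_ge fun k hk => (hkmax k hk).trans hz.1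
  obtain ⟨Kp, hKpV, hKpmin⟩ := V.exists_min_image id hVne
  obtain ⟨hKpμ, hKtKp, hKpviol⟩ := Finset.mem_filter.1 hKpV
  have hKp0 : 0 < Kp := hKtpos.trans_le hKtKp
  have hnv : ∀ k ∈ μ.support, Kt ≤ k → k < Kp → rightDeriv E k * k - E k ≤ g.2 := by
    intro k hk hk1 hk2
    by_contra! hc
    exact absurd (hKpmin k (Finset.mem_filter.2 ⟨hk, hk1, hc⟩)) (not_le.2 hk2)
  set c := (lineEval g Kp - E Kp) / Kp with hc
  have hcKp : E Kp + c * Kp = lineEval g Kp := by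
    rw [hc, div_mul_cancel₀ _ hKp0.ne']; ring
  -- the put price function before `Kp`
  obtain ⟨x₀, hx₀, hx₀Kp, hx₀no, hx₀I⟩ : ∃ x₀, 0 ≤ x₀ ∧ x₀ < Kp ∧
      (∀ k ∈ μ.support, x₀ < k → Kp ≤ k) ∧ rightDeriv E x₀ * x₀ - E x₀ ≤ g.2 := by
    by_cases hcase : (μ.support.filter (fun k => Kt ≤ k ∧ k < Kp)).Nonempty
    · obtain ⟨k, hk, hmax⟩ := Finset.exists_max_image _ id hcase
      obtain ⟨hk1, hk2, hk3⟩ := Finset.mem_filter.1 hk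
      refine ⟨k, hKt0.trans hk2, hk3, fun k' hk' hlt => ?_, hnv k hk1 hk2 hk3⟩
      by_contra! hc'
      exact absurd (hmax k' (Finset.mem_filter.2 ⟨hk', hk2.trans hlt.le, hc'⟩)) (not_le.2 hlt)
    · obtain ⟨y₀, hy₀, hmax⟩ := (insert w (μ.support.filter (fun k => k < Kt))).exists_max_image id
        ⟨w, Finset.mem_insert_self _ _⟩
      have hwy : w ≤ y₀ := hmax w (Finset.mem_insert_self _ _)
      have hyKt : y₀ < Kt := by
        rcases Finset.mem_insert.1 hy₀ with rfl | hy
        · exact hwKt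
        · exact (Finset.mem_filter.1 hy).2
      have hxpos : 0 < (y₀ + Kt) / 2 := by linarith
      have hxKt : (y₀ + Kt) / 2 < Kt := by linarith
      have hno : ∀ k ∈ μ.support, (y₀ + Kt) / 2 < k → Kp ≤ k := by
        intro k hk hlt
        by_contra! hc'
        rcases lt_or_ge k Kt with h1 | h1
        · have := hmax k (Finset.mem_insert_of_mem (Finset.mem_filter.2 ⟨hk, h1⟩))
          simp only [id] at this
          linarith
        · exact hcase ⟨k, Finset.mem_filter.2 ⟨hk, h1, hc'⟩⟩
      refine ⟨(y₀ + Kt) / 2, hxpos.le, hxKt.trans_le hKtKp, hno, ?_⟩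
      have e1 := h.legendre _ _ hxpos hxKt.le
      have e2 := h.law.put_eq_right hxpos.le hxKt.le
        (fun k hk hlt => hKtKp.trans (hno k hk hlt))
      rw [← hE] at e1 e2
      rw [e2, hgw _ ⟨by linarith, hxKt.le⟩, hgw Kt ⟨hwKt.le, le_rfl⟩] at e1
      set x := (y₀ + Kt) / 2
      unfold lineEval at e1
      have : (Kt - x) * (rightDeriv E x * x - E x) ≤ (Kt - x) * g.2 := by nlinarith
      exact le_of_mul_le_mul_left this (sub_pos.2 hxKt)
  have hmid : ∀ x y, 0 ≤ x → x ≤ y → y ≤ Kp → E y * x - E x * y ≤ g.2 * (y - x) := by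
    intro x y hx hxy hy
    obtain ⟨l, hl, y', hy', hly⟩ := hEpoly.exists_right hx₀
    have e1 := h.law.put_eq_right hx₀ hx₀Kp.le hx₀no
    rw [← hE, rightDeriv_eq hy' hly, hly x₀ ⟨le_rfl, hy'.le⟩] at e1
    rw [rightDeriv_eq hy' hly, hly x₀ ⟨le_rfl, hy'.le⟩] at hx₀I
    refine (hEpoly.intercept_le hl hx hxy hy (by rw [e1]; unfold lineEval; ring)).trans ?_
    refine mul_le_mul_of_nonneg_right ?_ (sub_nonneg.2 hxy)
    unfold lineEval at hx₀I
    linarith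
  -- the tail lies above the line
  obtain ⟨l, hl, y', hy', hly⟩ := hEpoly.exists_right hKp0.le
  rw [rightDeriv_eq hy' hly] at hKpviol
  -- The tail and `g` agree at `Kp`, so the violation, an inequality between intercepts, becomes one
  -- between slopes.
  have hslope : g.1 < l.1 + c := by
    have : g.1 * Kp < (l.1 + c) * Kp := by
      unfold lineEval at *; linarith
    exact lt_of_mul_lt_mul_right this hKp0.le
  have htail : ∀ K, Kp ≤ K → lineEval g K + (l.1 + c - g.1) * (K - Kp) ≤ E K + c * K := by
    intro K hK
    have e1 := hl K (hKp0.le.trans hK)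
    have e2 := hly Kp ⟨le_rfl, hy'.le⟩
    unfold lineEval at *
    linarith
  have htail' : ∀ K, Kp ≤ K → lineEval g K ≤ E K + c * K := fun K hK => by
    have := mul_nonneg (sub_pos.2 hslope).le (sub_nonneg.2 hK)
    linarith [htail K hK]
  set Aext : ℝ → ℝ := fun K =>
    if K ≤ Kt then A K else if K ≤ Kp then lineEval g K else E K + c * K with hAext
  have eqA : ∀ K, 0 ≤ K → K ≤ Kt → Aext K = A K := fun K _ hK => by simp [hAext, hK]
  have eqLine : ∀ K, Kt ≤ K → K ≤ Kp → Aext K = lineEval g K := fun K hK hK' => by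
    rcases hK.eq_or_lt with rfl | h1
    · rw [eqA Kt hKt0 le_rfl, hgw Kt ⟨hwKt.le, le_rfl⟩]
    · simp [hAext, not_le.2 h1, hK']
  have eqTail : ∀ K, Kp ≤ K → Aext K = E K + c * K := fun K hK => by
    rcases hK.eq_or_lt with rfl | h1
    · rw [eqLine Kp hKtKp le_rfl, hcKp]
    · simp [hAext, not_le.2 h1, not_le.2 (hKtKp.trans_lt h1)]
  have hlineA : ∀ K, 0 ≤ K → lineEval g K ≤ Aext K := by
    intro K hK
    rcases le_total K Kt with h1 | h1
    · rw [eqA K hK h1]; exact hgle K hK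
    rcases le_total K Kp with h2 | h2
    · rw [eqLine K h1 h2]
    · rw [eqTail K h2]; exact htail' K h2
  have hpoly : Polyhedral Aext := by
    have h1 : Polyhedral (fun K => if K ≤ Kt then A K else lineEval g K) := by
      refine Polyhedral.glue (l := g) hKt0 h.polyhedral (polyhedral_lineEval g)
        (hgw Kt ⟨hwKt.le, le_rfl⟩) rfl (fun K hK _ => hgle K hK) (fun _ _ => le_rfl)
        (fun K _ hK => by simp [hK]) (fun K hK => ?_)
      rcases hK.eq_or_lt with rfl | hlt
      · simp [hgw Kt ⟨hwKt.le, le_rfl⟩]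
      · simp [not_le.2 hlt]
    have h2 : Polyhedral (fun K => E K + c * K) :=
      (hEpoly.add (polyhedral_lineEval (c, 0))).congr fun K _ => by simp [lineEval]
    have h3 : ∀ K, 0 ≤ K → K ≤ Kp → Aext K = if K ≤ Kt then A K else lineEval g K := by
      intro K hK hKKp
      split_ifs with hle
      · exact eqA K hK hle
      · exact eqLine K (not_le.1 hle).le hKKp
    refine Polyhedral.glue (l := g) hKp0.le h1 h2 ?_ hcKp (fun K hK hK' => ?_) htail' h3 eqTail
    · rw [← h3 Kp hKp0.le le_rfl, eqLine Kp hKtKp le_rfl]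
    · rw [← h3 K hK hK']; exact hlineA K hK
  have hleg : ∀ x y, 0 < x → x ≤ y → (Aext x - E x) * y ≤ (Aext y - E y) * x := by
    intro x y hx hxy
    refine glue_div_mono (D := fun K => Aext K - E K) (b := Kp) (B := y) hKp0 ?_ ?_ hx hxy le_rfl
    · intro x y hx hxy hy
      refine glue_div_mono (D := fun K => Aext K - E K) (b := Kt) (B := Kp) hKtpos ?_ ?_ hx hxy hy
      · intro x y hx hxy hy
        simp only [eqA x hx.le (hxy.trans hy), eqA y (hx.le.trans hxy) hy]
        exact h.legendre x y hx hxy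
      · intro x y hx hxy hy
        simp only [eqLine x hx (hxy.trans hy), eqLine y (hx.trans hxy) hy]
        have := hmid x y (hKt0.trans hx) hxy hy
        unfold lineEval
        linarith
    · intro x y hx hxy _
      simp only [eqTail x hx, eqTail y (hx.trans hxy)]
      apply le_of_eq; ring
  refine ⟨Aext, Kt, Kp, g, c, ?_, ?_⟩
  · refine ⟨hKtpos, hKtKp, eqA, eqLine, eqTail, ?_, hlineA, hg1, ⟨w, hw0, hwKt, hgw⟩, hex, hpoly,
      ?_, hleg, ?_⟩
    · intro K hK
      rw [eqTail K hK.le]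
      have := mul_pos (sub_pos.2 hslope) (sub_pos.2 hK)
      linarith [htail K hK.le]
    · intro K hK
      rcases le_total K Kt with h1 | h1
      · rw [eqA K hK h1]
      have hgK : ∀ K, Kt ≤ K → lineEval g K ≤ K - s := fun K hK => by
        rw [← hl1]
        exact lineEval_le_of_le (hgKt.trans (hl1 Kt).symm).le hg1.le hK
      rcases le_total K Kp with h2 | h2
      · rw [eqLine K h1 h2, hex K h1]
        exact hgK K h1
      · rw [eqTail K h2, hex K h1]
        -- Chords of the tail have intercept at least `-s`, like those of `E`, and at `Kp` the tail
        -- is at most `Kp - s`; hence it remains below `K - s`.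
        have e1 := h.law.put_intercept_le hKp0.le h2
        rw [← hE] at e1
        have e2 := mul_le_mul_of_nonneg_right (hgK Kp hKtKp) hK
        rw [← hcKp] at e2
        have : Kp * (E K + c * K) ≤ Kp * (K - s) := by nlinarith
        exact le_of_mul_le_mul_left this hKp0
    · intro K hK
      rcases le_total K Kt with h1 | h1
      · rw [eqA K hK h1]; exact h.european_le K hK
      have e1 := hleg Kt K hKtpos h1
      have e2 : 0 ≤ Aext Kt - E Kt := by
        rw [eqA Kt hKt0 le_rfl]; exact sub_nonneg.2 (h.european_le Kt hKt0)
      have e3 : 0 ≤ (Aext K - E K) * Kt := (mul_nonneg e2 hK).trans e1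
      exact sub_nonneg.1 (nonneg_of_mul_nonneg_left e3 hKtpos)
  · refine ⟨?_, ⟨⟨hKpμ, ?_, ?_⟩, ?_⟩, ?_, ?_⟩
    · rw [hstrike]; exact eqA
    · rw [hstrike]; exact hKtKp
    · rw [hviol, rightDeriv_eq hy' hly]; exact hKpviol
    · rintro k ⟨hk1, hk2, hk3⟩
      rw [hviol] at hk3
      rw [hstrike] at hk2
      exact hKpmin k (Finset.mem_filter.2 ⟨hk1, hk2, hk3⟩)
    · intro K hK hK'
      rw [hstrike] at hK
      rw [hprol, eqLine K hK hK']
    · intro k hk hkKp K hkK hno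
      have hk0 : 0 < k := hKp0.trans_le hkKp
      rw [eqTail k hkKp, eqTail K (hkKp.trans hkK), hE, h.law.put_eq_right hk0.le hkK hno, ← hE,
        add_sub_cancel_left, mul_div_cancel_right₀ _ hk0.ne']
      ring

end Node

end AmericanPut

namespace AmericanPut

open Filter Topology

/-! ### Pieces of the extension that are tied to the European prices -/

/-- The line `f`, first met by `F` at `x > 0`, differs from `E` by a multiple of the strike
immediately after `x`. -/
def Bound (F E : ℝ → ℝ) (f : ℝ × ℝ) : Prop :=
  ∃ x y c, 0 < x ∧ x < y ∧ F x = lineEval f x ∧ (∀ K, 0 ≤ K → K < x → lineEval f K < F K) ∧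
    ∀ K ∈ Set.Icc x y, E K = lineEval f K - c * K

theorem Polyhedral.isPiece_first_contact {F : ℝ → ℝ} (hF : Polyhedral F) {f : ℝ × ℝ} {a b : ℝ}
    (hle : ∀ K, 0 ≤ K → lineEval f K ≤ F K) (ha : 0 ≤ a)
    (h : ∀ K ∈ Set.Icc a b, F K = lineEval f K) (hab : a ≤ b) :
    ∃ x, 0 ≤ x ∧ x ≤ a ∧ (∀ K ∈ Set.Icc x b, F K = lineEval f K) ∧
      ∀ K, 0 ≤ K → K < x → lineEval f K < F K := by
  obtain ⟨x, ⟨hx0, hx⟩, hmin⟩ := hF.exists_isLeast_contact hle ⟨a, ha, h a ⟨le_rfl, hab⟩⟩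
  refine ⟨x, hx0, hmin ⟨ha, h a ⟨le_rfl, hab⟩⟩, fun K hK => ?_, fun K hK hKx => ?_⟩
  · exact hF.eq_of_touch hle hx0 hK.1 hK.2 hx (h b ⟨hab, le_rfl⟩)
  · exact lt_of_le_of_ne (hle K hK) fun h' => absurd (hmin ⟨hK, h'.symm⟩) (not_le.2 hKx)

namespace Extended

variable {r L s : ℝ} {μ : ℝ →₀ ℝ} {A Aext : ℝ → ℝ} {Kt Kp c : ℝ} {g : ℝ × ℝ}

/-- A piece of the extension is either a piece of the original function of slope less than `1`, or
tied to the European prices. -/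
theorem piece_cases (h : Extended r L s μ A Aext Kt Kp g c) {f : ℝ × ℝ} (hf : IsPiece Aext f) :
    (f.1 ≤ g.1 ∧ ∃ a b, 0 ≤ a ∧ a < b ∧ b ≤ Kt ∧ ∀ K ∈ Set.Icc a b, A K = lineEval f K) ∨
      (Bound Aext (europeanPut r L μ) f ∧ g.1 < f.1) := by
  obtain ⟨hf0, a, b, ha, hab, hfab⟩ := hf
  have hle : ∀ K, 0 ≤ K → lineEval f K ≤ Aext K := fun K hK =>
    h.polyhedral.lineEval_le_of_isPiece ⟨hf0, a, b, ha, hab, hfab⟩ hK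
  have hgKt : Aext Kt = lineEval g Kt := h.eq_line Kt le_rfl h.Kt_le
  have hgKp : Aext Kp = lineEval g Kp := h.eq_line Kp h.Kt_le le_rfl
  rcases lt_or_ge a Kt with h1 | h1
  · left
    refine ⟨?_, a, min b Kt, ha, lt_min hab h1, min_le_right _ _, fun K hK => ?_⟩
    · refine slope_le_of_lineEval_le h1 ?_ ((hle Kt h.Kt_pos.le).trans_eq hgKt)
      exact (h.line_le a ha).trans_eq (hfab a ⟨le_rfl, hab.le⟩)
    · rw [← h.eq_A K (ha.trans hK.1) (hK.2.trans (min_le_right _ _))]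
      exact hfab K ⟨hK.1, hK.2.trans (min_le_left _ _)⟩
  rcases lt_or_ge a Kp with h2 | h2
  · left
    have hfg : f = g := by
      refine lineEval_ext (x := a) (y := min b Kp) (lt_min hab h2) ?_ ?_
      · rw [← hfab a ⟨le_rfl, hab.le⟩, h.eq_line a h1 h2.le]
      · rw [← hfab _ ⟨le_min hab.le h2.le, min_le_left _ _⟩,
          h.eq_line _ (le_min (h1.trans hab.le) h.Kt_le) (min_le_right _ _)]
    subst hfg
    obtain ⟨w, hw0, hw, hwA⟩ := h.left
    exact ⟨le_rfl, w, Kt, hw0, hw, le_rfl, hwA⟩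
  · right
    have hKp0 : 0 < Kp := h.Kt_pos.trans_le h.Kt_le
    have hlt : g.1 < f.1 := by
      refine lt_of_not_ge fun hge => ?_
      have e1 := h.line_lt b (h2.trans_lt hab)
      rw [hfab b ⟨hab.le, le_rfl⟩] at e1
      exact absurd (lineEval_le_of_le ((hle Kp hKp0.le).trans_eq hgKp) hge (h2.trans hab.le))
        (not_le.2 e1)
    obtain ⟨x, hx0, hxa, hxb, hxlt⟩ := h.polyhedral.isPiece_first_contact hle ha hfab hab.le
    -- The first contact is not before `Kp`: there `f` would already be at or above the flatter line
    -- `g`, and at `Kp` strictly above it.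
    have hKpx : Kp ≤ x := by
      by_contra! hc
      have e1 := hxb x ⟨le_rfl, hxa.trans hab.le⟩
      have e2 := hxb Kp ⟨hc.le, h2.trans hab.le⟩
      have e3 := h.line_le x hx0
      rw [e1] at e3
      rw [hgKp] at e2
      exact absurd e2 (lineEval_lt_of_lt e3 hlt hc).ne
    refine ⟨⟨x, b, c, hKp0.trans_le hKpx, hxa.trans_lt hab, hxb x ⟨le_rfl, hxa.trans hab.le⟩, hxlt,
      fun K hK => ?_⟩, hlt⟩
    rw [← hxb K hK, h.eq_tail K (hKpx.trans hK.1)]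
    ring

theorem isPiece_of_left (_h : Extended r L s μ A Aext Kt Kp g c) {f : ℝ × ℝ} (hf0 : 0 < f.1)
    (hf : ∃ a b, 0 ≤ a ∧ a < b ∧ b ≤ Kt ∧ ∀ K ∈ Set.Icc a b, A K = lineEval f K) :
    IsPiece A f := by
  obtain ⟨a, b, ha, hab, -, h1⟩ := hf
  exact ⟨hf0, a, b, ha, hab, h1⟩

/-- For the pieces before the exercise strike it does not matter whether `A` or its extension is
considered. -/
theorem bound_iff (h : Extended r L s μ A Aext Kt Kp g c) {E : ℝ → ℝ} {f : ℝ × ℝ}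
    (hf : ∃ a b, 0 ≤ a ∧ a < b ∧ b ≤ Kt ∧ ∀ K ∈ Set.Icc a b, A K = lineEval f K) :
    Bound A E f ↔ Bound Aext E f := by
  obtain ⟨a, b, ha, hab, hb, hfab⟩ := hf
  constructor
  · rintro ⟨x, y, c', hx, hxy, e1, e2, e3⟩
    have hxa : x ≤ a := by
      by_contra! hc
      exact absurd (hfab a ⟨le_rfl, hab.le⟩) (e2 a ha hc).ne'
    have hxK : x ≤ Kt := hxa.trans (hab.le.trans hb)
    refine ⟨x, y, c', hx, hxy, by rw [h.eq_A x hx.le hxK, e1], fun K hK hKx => ?_, e3⟩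
    rw [h.eq_A K hK (hKx.le.trans hxK)]
    exact e2 K hK hKx
  · rintro ⟨x, y, c', hx, hxy, e1, e2, e3⟩
    have hxa : x ≤ a := by
      by_contra! hc
      have := e2 a ha hc
      rw [h.eq_A a ha (hab.le.trans hb)] at this
      exact absurd (hfab a ⟨le_rfl, hab.le⟩) this.ne'
    have hxK : x ≤ Kt := hxa.trans (hab.le.trans hb)
    refine ⟨x, y, c', hx, hxy, by rw [← h.eq_A x hx.le hxK, e1], fun K hK hKx => ?_, e3⟩
    rw [← h.eq_A K hK (hKx.le.trans hxK)]
    exact e2 K hK hKx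

end Extended

/-- A line that lies below the upper bound and touches it is not tied to the European prices. -/
theorem not_bound_of_touch {E F : ℝ → ℝ} {f : ℝ × ℝ} {lam Kc : ℝ} (hE : Polyhedral E)
    (hlam : 1 < lam) (hF : ∀ K, 0 ≤ K → F K ≤ E (lam * K))
    (hf : ∀ K, 0 ≤ K → lineEval f K ≤ E (lam * K)) (hKc : 0 < Kc)
    (htouch : lineEval f Kc = E (lam * Kc)) : ¬ Bound F E f := by
  rintro ⟨x, y, c, hx, hxy, -, hlt, hEf⟩
  have hlam0 : 0 < lam := one_pos.trans hlam
  have hxl : lam * (x / lam) = x := mul_div_cancel₀ _ hlam0.ne'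
  have hyl : lam * (y / lam) = y := mul_div_cancel₀ _ hlam0.ne'
  have hx' : 0 < x / lam := div_pos hx hlam0
  have e1 := hf _ hx'.le
  rw [hxl, hEf x ⟨le_rfl, hxy.le⟩] at e1
  -- the supporting line of `E` on `[x, y]`
  have hsup : lineEval f (lam * Kc) - c * (lam * Kc) ≤ E (lam * Kc) := by
    obtain ⟨l, hl, y', hy', hly⟩ := hE.exists_right hx.le
    have : l = (f.1 - c, f.2) := by
      refine lineEval_ext (x := x) (y := min y y') (lt_min hxy hy') ?_ ?_
      · rw [← hly x ⟨le_rfl, hy'.le⟩, hEf x ⟨le_rfl, hxy.le⟩]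
        simp only [lineEval]; ring
      · rw [← hly _ ⟨le_min hxy.le hy'.le, min_le_right _ _⟩,
          hEf _ ⟨le_min hxy.le hy'.le, min_le_left _ _⟩]
        simp only [lineEval]; ring
    have h1 := hl (lam * Kc) (mul_pos hlam0 hKc).le
    rw [this] at h1
    simp only [lineEval] at *
    linarith
  rw [← htouch] at hsup
  -- The bound at `x / lam` and the contact at `Kc` force `f.1 = lam * (f.1 - c)`. Then `f` also
  -- touches the upper bound at `x / lam`. But `x / lam` precedes the first contact of `f` with `F`,
  -- so that `f < F ≤ E (lam * ·)` there.
  have h1 : f.1 ≤ lam * (f.1 - c) := by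
    have hx2 : x = lam * (x / lam) := hxl.symm
    set z := x / lam
    have : f.1 * z ≤ (lam * (f.1 - c)) * z := by
      unfold lineEval at e1
      rw [hx2] at e1
      linarith
    exact le_of_mul_le_mul_right this hx'
  have h2 : lam * (f.1 - c) ≤ f.1 := by
    have : (lam * (f.1 - c)) * Kc ≤ f.1 * Kc := by
      unfold lineEval at hsup
      linarith
    exact le_of_mul_le_mul_right this hKc
  have h3 : f.1 = lam * (f.1 - c) := le_antisymm h1 h2
  have h4 := hF _ hx'.le
  rw [hxl, hEf x ⟨le_rfl, hxy.le⟩] at h4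
  have h5 := hlt _ hx'.le (div_lt_self hx hlam)
  have h6 : lineEval f x - c * x = lineEval f (x / lam) := by
    have hx2 : x = lam * (x / lam) := hxl.symm
    set z := x / lam
    unfold lineEval
    rw [hx2]
    linear_combination -z * h3
  linarith

/-! ### The critical time -/

/-- The data of a splitting step: after the time `tc` the upper bound touches the piece `f` of the
extension at the strike `Kc`, the time-`tc` value of the atom `κ`. -/
structure Step (r L s : ℝ) (μ : ℝ →₀ ℝ) (Aext : ℝ → ℝ) (tc Kc κ : ℝ) (f : ℝ × ℝ) : Prop where
  tc_nonneg : 0 ≤ tc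
  tc_lt : tc < L
  atom : κ ∈ μ.support
  atom_pos : 0 < κ
  Kc_eq : Kc = discountedAtom r L κ tc
  piece : IsPiece Aext f
  touch : lineEval f Kc = upperBound r L (europeanPut r L μ) Kc tc
  le_upper : ∀ K, 0 ≤ K → Aext K ≤ upperBound r L (europeanPut r L μ) K tc

theorem upperBound_discountedAtom (r L k t : ℝ) (E : ℝ → ℝ) :
    upperBound r L E (discountedAtom r L k t) t = E k := by
  rw [upperBound, discountedAtom, mul_left_comm, ← Real.exp_add]
  simp

theorem discountedAtom_nonneg {r L k t : ℝ} (hk : 0 ≤ k) : 0 ≤ discountedAtom r L k t :=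
  mul_nonneg hk (Real.exp_pos _).le

/-- To lie below the upper bound, it suffices to do so at the atoms. -/
theorem IsLaw.le_of_le_atoms {r L s : ℝ} {μ : ℝ →₀ ℝ} (h : IsLaw r L s μ) (hs : 0 < s) {F : ℝ → ℝ} {Kp c : ℝ}
    (hF : Polyhedral F) (hF0 : F 0 = 0) (htail : ∀ K, Kp ≤ K → F K = europeanPut r L μ K + c * K)
    {q : ℝ} (hq : 0 < q)
    (hat : ∀ k ∈ μ.support, F (q * k) ≤ europeanPut r L μ k) (K : ℝ) (hK : 0 ≤ K) :
    F (q * K) ≤ europeanPut r L μ K := by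
  have hle : ∀ k ∈ μ.support, 0 ≤ q * k := fun k hk => mul_nonneg hq.le (h.atoms k hk)
  have hqK := mul_nonneg hq.le hK
  by_cases hup : ∃ k ∈ μ.support, K ≤ k
  · -- the next atom
    obtain ⟨k₂, hk₂, hmin⟩ := (μ.support.filter (fun k => K ≤ k)).exists_min_image id
      (by obtain ⟨k, hk, hKk⟩ := hup; exact ⟨k, Finset.mem_filter.2 ⟨hk, hKk⟩⟩)
    obtain ⟨hk₂μ, hKk₂⟩ := Finset.mem_filter.1 hk₂
    -- the previous atom, or zero
    obtain ⟨k₁, hk₁, hmax⟩ := (insert 0 (μ.support.filter (fun k => k ≤ K))).exists_max_image id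
      ⟨0, Finset.mem_insert_self _ _⟩
    have hk₁0 : 0 ≤ k₁ := hmax 0 (Finset.mem_insert_self _ _)
    have hk₁K : k₁ ≤ K := by
      rcases Finset.mem_insert.1 hk₁ with rfl | h1
      · exact hK
      · exact (Finset.mem_filter.1 h1).2
    have hat₁ : F (q * k₁) ≤ europeanPut r L μ k₁ := by
      rcases Finset.mem_insert.1 hk₁ with rfl | h1
      · rw [mul_zero, hF0, h.put_zero]
      · exact hat _ (Finset.mem_filter.1 h1).1
    have hno : ∀ k ∈ μ.support, k₁ < k → k₂ ≤ k := by
      intro k hk hlt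
      rcases le_total k K with h1 | h1
      · exact absurd (hmax k (Finset.mem_insert_of_mem (Finset.mem_filter.2 ⟨hk, h1⟩)))
          (not_le.2 hlt)
      · exact hmin k (Finset.mem_filter.2 ⟨hk, h1⟩)
    rcases (hk₁K.trans hKk₂).eq_or_lt with heq | hlt
    · have : K = k₁ := by linarith
      rw [this]; exact hat₁
    have e1 := h.put_affine hk₁K hKk₂ hno
    have e2 := hF.convex (mul_nonneg hq.le hk₁0) (mul_le_mul_of_nonneg_left hk₁K hq.le)
      (mul_le_mul_of_nonneg_left hKk₂ hq.le)
    have e3 := mul_le_mul_of_nonneg_left hat₁ (sub_nonneg.2 hKk₂)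
    have e4 := mul_le_mul_of_nonneg_left (hat k₂ hk₂μ) (sub_nonneg.2 hk₁K)
    have e5 : (k₂ - k₁) * F (q * K) ≤ (k₂ - K) * F (q * k₁) + (K - k₁) * F (q * k₂) := by
      have : q * ((k₂ - k₁) * F (q * K)) ≤
          q * ((k₂ - K) * F (q * k₁) + (K - k₁) * F (q * k₂)) := by linarith
      exact le_of_mul_le_mul_left this hq
    have : (k₂ - k₁) * F (q * K) ≤ (k₂ - k₁) * europeanPut r L μ K := by linarith
    exact le_of_mul_le_mul_left this (sub_pos.2 hlt)
  -- Beyond the last atom `E` is a line with intercept `s`, and `F` eventually follows a line with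
  -- the same intercept. Comparison at the last atom orders the slopes, hence the values at a far
  -- strike `Y`, and convexity of `F` fills the gap.
  · push Not at hup
    obtain ⟨kN, hkN, hmax⟩ := μ.support.exists_max_image id h.support_nonempty
    have hkN0 := h.atoms kN hkN
    have hlt := hup kN hkN
    have hE : ∀ z, kN ≤ z → europeanPut r L μ z = Real.exp (-(r * L)) * z - s := fun z hz =>
      h.put_eq_of_ge fun k hk => (hmax k hk).trans hz
    have hkNpos : 0 < kN := by
      refine hkN0.lt_of_ne fun h0 => ?_
      have := hE 0 h0.ge
      rw [h.put_zero] at this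
      linarith
    -- the line followed by `F` at large strikes
    set Y := max (max Kp kN) (q * K) with hY
    have hYK : q * K ≤ Y := le_max_right _ _
    have hYN : kN ≤ Y := (le_max_right _ _).trans (le_max_left _ _)
    have hYp : Kp ≤ Y := (le_max_left _ _).trans (le_max_left _ _)
    set σ := Real.exp (-(r * L)) + c with hσ
    have hFY : ∀ z, Y ≤ z → F z = σ * z - s := fun z hz => by
      rw [htail z (hYp.trans hz), hE z (hYN.trans hz)]; ring
    have hsup : ∀ z, 0 ≤ z → σ * z - s ≤ F z := by
      intro z hz
      rcases le_total Y z with h1 | h1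
      · exact (hFY z h1).ge
      have e1 := hF.convex hz h1 (by linarith : Y ≤ Y + 1)
      rw [hFY Y le_rfl, hFY (Y + 1) (by linarith)] at e1
      linarith
    -- its slope is at most that of the upper bound
    have e2 := hat kN hkN
    rw [hE kN le_rfl] at e2
    have hslope : σ * q ≤ Real.exp (-(r * L)) := by
      have e1 := hsup _ (hle kN hkN)
      have : σ * q * kN ≤ Real.exp (-(r * L)) * kN := by linarith
      exact le_of_mul_le_mul_right this hkNpos
    rw [hE K hlt.le]
    have e3 := hF.convex (hle kN hkN) (mul_le_mul_of_nonneg_left hlt.le hq.le) hYK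
    rw [hFY Y le_rfl] at e3
    have hlt' : q * kN < Y := (mul_lt_mul_of_pos_left hlt hq).trans_le hYK
    have e4 := mul_le_mul_of_nonneg_left e2 (sub_nonneg.2 hYK)
    have e5 : σ * Y ≤ Real.exp (-(r * L)) * (Y / q) := by
      have := mul_le_mul_of_nonneg_right hslope (div_nonneg (hqK.trans hYK) hq.le)
      rwa [mul_assoc, mul_div_cancel₀ _ hq.ne'] at this
    have e6 := mul_le_mul_of_nonneg_left e5
      (sub_nonneg.2 (mul_le_mul_of_nonneg_left hlt.le hq.le))
    have e7 : (Y - q * kN) * F (q * K) ≤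
        (Y - q * kN) * (Real.exp (-(r * L)) * K - s) := by
      have hYq : Y = q * (Y / q) := (mul_div_cancel₀ _ hq.ne').symm
      set w := Y / q
      rw [hYq] at e3 e4 e6 ⊢
      linarith
    exact le_of_mul_le_mul_left e7 (sub_pos.2 hlt')

/-- A node that is not trivial can be split. -/
theorem Node.exists_step {r L s : ℝ} {μ : ℝ →₀ ℝ} {A Aext : ℝ → ℝ} {Kt Kp c : ℝ} {g : ℝ × ℝ}
    (h : Node r L s μ A) (hnt : ¬ IsTrivial r L s μ A)
    (hext : Extended r L s μ A Aext Kt Kp g c) :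
    ∃ tc Kc κ f, Step r L s μ Aext tc Kc κ f ∧
      IsCriticalTime r L μ (europeanPut r L μ) Aext tc ∧
      IsCriticalStrike r L μ (europeanPut r L μ) Aext tc Kc ∧
      IsEmbeddedPiece r L (europeanPut r L μ) Aext tc Kc f := by
  classical
  set E := europeanPut r L μ with hE
  have hL := h.length_pos
  have hA0 : Aext 0 = 0 := by rw [hext.eq_A 0 le_rfl hext.Kt_pos.le, h.zero]
  have hApos : ∀ K, 0 ≤ K → 0 ≤ Aext K := fun K hK =>
    (h.law.put_nonneg K).trans (hext.european_le K hK)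
  have hu0 : ∀ k ∈ μ.support, ∀ t, 0 ≤ discountedAtom r L k t := fun k hk t =>
    discountedAtom_nonneg (h.law.atoms k hk)
  have hle : ∀ f, IsPiece Aext f → ∀ K, 0 ≤ K → lineEval f K ≤ Aext K := fun f hf K hK =>
    hext.polyhedral.lineEval_le_of_isPiece hf hK
  -- the extension exceeds the European price at some atom
  have hex : ∃ k ∈ μ.support, E k < Aext k := by
    by_contra! hc
    refine hnt (h.isTrivial_of_le fun K hK => ?_)
    rcases le_total K Kt with h1 | h1
    · refine le_max_of_le_left ?_
      rw [← hext.eq_A K hK h1]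
      have := h.law.le_of_le_atoms (h.spot_pos hnt) hext.polyhedral hA0 hext.eq_tail one_pos
        (fun k hk => by rw [one_mul]; exact hc k hk) K hK
      rwa [one_mul] at this
    · exact le_max_of_le_right (hext.exercise K h1).le
  have hpieceAt : ∀ K, 0 ≤ K → 0 < Aext K → ∃ f, IsPiece Aext f ∧ Aext K = lineEval f K := by
    intro K hK hpos
    obtain ⟨f, hf | rfl, hfK⟩ := hext.polyhedral.exists_piece_or_zero hA0 hApos hK
    · exact ⟨f, hf, hfK⟩
    · rw [hfK] at hpos
      simp [lineEval] at hpos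
  set V : Set ℝ := {t | 0 ≤ t ∧ t ≤ L ∧ ∃ k ∈ μ.support, ∃ f, IsPiece Aext f ∧
    upperBound r L E (discountedAtom r L k t) t < lineEval f (discountedAtom r L k t)} with hV
  have hVdef : ∀ t, t ∈ V ↔ 0 ≤ t ∧ t ≤ L ∧ ∃ k ∈ μ.support, ∃ f, IsPiece Aext f ∧
      E k < lineEval f (discountedAtom r L k t) := by
    intro t
    simp only [hV, Set.mem_ofPred_eq, upperBound_discountedAtom]
  have hcont : ∀ (k : ℝ) (f : ℝ × ℝ), Continuous fun t => lineEval f (discountedAtom r L k t) := by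
    intro k f; unfold lineEval discountedAtom; fun_prop
  have hbdd : BddBelow V := ⟨0, fun t ht => ht.1⟩
  -- a violation just before `L`
  obtain ⟨t₁, ht₁V, ht₁L⟩ : ∃ t ∈ V, t < L := by
    obtain ⟨k, hk, hkA⟩ := hex
    have hk0 := h.law.atoms k hk
    obtain ⟨f, hf, hfk⟩ := hpieceAt k hk0 ((h.law.put_nonneg k).trans_lt hkA)
    have hL' : discountedAtom r L k L = k := by simp [discountedAtom]
    have hev : ∀ᶠ t in 𝓝 L, E k < lineEval f (discountedAtom r L k t) := by
      refine (hcont k f).continuousAt.eventually_const_lt ?_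
      change E k < lineEval f (discountedAtom r L k L)
      rw [hL', ← hfk]; exact hkA
    have hev2 : ∀ᶠ t in 𝓝[<] L, 0 < t ∧ t < L := by
      filter_upwards [Ioo_mem_nhdsLT hL] with t ht using ht
    obtain ⟨t, ht1, ht2⟩ := ((hev.filter_mono nhdsWithin_le_nhds).and hev2).exists
    exact ⟨t, (hVdef t).2 ⟨ht2.1.le, ht2.2.le, k, hk, f, hf, ht1⟩, ht2.2⟩
  set tc := sInf V with htc
  have hglb : IsGLB V tc := isGLB_csInf ⟨t₁, ht₁V⟩ hbdd
  have htc0 : 0 ≤ tc := hglb.2 fun t ht => ht.1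
  have htcL : tc < L := (hglb.1 ht₁V).trans_lt ht₁L
  -- no violation at `tc`
  have hno : ∀ k ∈ μ.support, ∀ f, IsPiece Aext f →
      lineEval f (discountedAtom r L k tc) ≤ E k := by
    intro k hk f hf
    by_contra! hc
    -- A violation at `tc > 0` would persist slightly earlier. At `tc = 0` there is no earlier time,
    -- and the bound on `A` in the node is used.
    rcases htc0.eq_or_lt with h0 | h0
    · have e1 := hle f hf _ (hu0 k hk tc)
      have e2 := (hext.le_A _ (hu0 k hk tc)).trans (h.le_upper _ (hu0 k hk tc))
      have e3 := upperBound_discountedAtom r L k tc E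
      rw [upperBound, ← h0, sub_zero] at e3
      rw [← h0] at e1 e2 hc
      linarith
    · have hev : ∀ᶠ t in 𝓝 tc, E k < lineEval f (discountedAtom r L k t) :=
        (hcont k f).continuousAt.eventually_const_lt hc
      have hev2 : ∀ᶠ t in 𝓝[<] tc, 0 < t ∧ t < tc := by
        filter_upwards [Ioo_mem_nhdsLT h0] with t ht using ht
      obtain ⟨t, ht1, ht2⟩ := ((hev.filter_mono nhdsWithin_le_nhds).and hev2).exists
      exact absurd (hglb.1 ((hVdef t).2 ⟨ht2.1.le, ht2.2.le.trans htcL.le, k, hk, f, hf, ht1⟩))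
        (not_le.2 ht2.2)
  have hfin : {f | IsPiece Aext f}.Finite := hext.polyhedral.finite_pieces
  -- a contact at `tc`
  obtain ⟨k₀, hk₀, hk₀pos, f₀, hf₀, hk₀f⟩ : ∃ k ∈ μ.support, 0 < k ∧ ∃ f, IsPiece Aext f ∧
      lineEval f (discountedAtom r L k tc) = E k := by
    -- Without contact all inequalities at positive atoms are strict at `tc`; being finitely many
    -- they persist nearby, against the definition of `tc`. At the atom `0` every piece is at most
    -- `0 = E 0` at all times.
    by_contra! hc
    have hev : ∀ᶠ t in 𝓝 tc, ∀ k ∈ μ.support, ∀ f ∈ {f | IsPiece Aext f},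
        lineEval f (discountedAtom r L k t) ≤ E k := by
      rw [Finset.eventually_all]
      intro k hk
      rw [Set.Finite.eventually_all hfin]
      intro f hf
      rcases (h.law.atoms k hk).eq_or_lt with h0 | h0
      · subst h0
        refine Eventually.of_forall fun t => ?_
        have := hle f hf 0 le_rfl
        rw [hA0] at this
        rw [hE, h.law.put_zero]
        simpa [discountedAtom] using this
      · have := lt_of_le_of_ne (hno k hk f hf) (hc k hk h0 f hf)
        exact ((hcont k f).continuousAt.eventually_lt_const this).mono fun t ht => ht.le
    obtain ⟨ε, hε, hball⟩ := Metric.eventually_nhds_iff.1 hev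
    obtain ⟨t, ht, htε⟩ := exists_lt_of_csInf_lt ⟨t₁, ht₁V⟩ (lt_add_of_pos_right tc hε)
    obtain ⟨-, -, k, hk, f, hf, hlt⟩ := (hVdef t).1 ht
    have hdist : dist t tc < ε := by
      rw [Real.dist_eq, abs_of_nonneg (sub_nonneg.2 (hglb.1 ht))]; linarith
    exact absurd (hball hdist k hk f hf) (not_le.2 hlt)
  -- the critical strike
  set U : Set ℝ := {u | ∃ k ∈ μ.support, 0 < k ∧ u = discountedAtom r L k tc ∧
    ∃ f, IsPiece Aext f ∧ lineEval f u = upperBound r L E u tc} with hU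
  have hUfin : U.Finite := by
    refine (μ.support.finite_toSet.image fun k => discountedAtom r L k tc).subset ?_
    rintro u ⟨k, hk, -, rfl, -⟩
    exact ⟨k, hk, rfl⟩
  have hUne : U.Nonempty := ⟨discountedAtom r L k₀ tc, k₀, hk₀, hk₀pos, rfl, f₀, hf₀, by
    rw [upperBound_discountedAtom]; exact hk₀f⟩
  obtain ⟨Kc, hKcU, hKcmin⟩ := Set.exists_min_image U id hUfin hUne
  obtain ⟨κ, hκ, hκ0, hKc, f₁, hf₁, hf₁Kc⟩ := id hKcU
  obtain ⟨f, ⟨hf, hfKc⟩, hfmin⟩ := Set.exists_min_image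
    {f | IsPiece Aext f ∧ lineEval f Kc = upperBound r L E Kc tc} Prod.fst
    (hfin.subset fun f hf => hf.1) ⟨f₁, hf₁, hf₁Kc⟩
  refine ⟨tc, Kc, κ, f, ⟨htc0, htcL, hκ, hκ0, hKc, hf, hfKc, fun K hK => ?_⟩, hglb,
    ⟨hKcU, fun u hu => hKcmin u hu⟩, ⟨hf, hfKc⟩, fun g hg hgK => hfmin g ⟨hg, hgK⟩⟩
  have hq : 0 < Real.exp (-(r * (L - tc))) := Real.exp_pos _
  have hmul : Real.exp (-(r * (L - tc))) * (Real.exp (r * (L - tc)) * K) = K := by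
    rw [← mul_assoc, ← Real.exp_add]; simp
  have := h.law.le_of_le_atoms (h.spot_pos hnt) hext.polyhedral hA0 hext.eq_tail hq
    (fun k hk => ?_) (Real.exp (r * (L - tc)) * K) (mul_nonneg (Real.exp_pos _).le hK)
  · rwa [hmul] at this
  · rw [mul_comm]
    have hd := hu0 k hk tc
    obtain ⟨g, hg | rfl, hgK⟩ := hext.polyhedral.exists_piece_or_zero hA0 hApos hd
    · exact hgK.trans_le (hno k hk g hg)
    · refine hgK.trans_le ?_
      simpa [lineEval] using h.law.put_nonneg k

end AmericanPut

namespace AmericanPut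

open Filter Topology

/-! ### Splitting a law -/

theorem sum_eq_expect_one (μ : ℝ →₀ ℝ) : (μ.sum fun _ p => p) = expect μ (fun _ => 1) := by
  simp [expect]

theorem lowerLaw_apply_nonneg {μ : ℝ →₀ ℝ} (hμ : ∀ k, 0 ≤ μ k) {κ p : ℝ} (hp : 0 < p)
    (h : expect (μ.filter (fun x => x < κ)) (fun _ => 1) ≤ p) (k : ℝ) : 0 ≤ lowerLaw μ κ p k := by
  rw [lowerLaw, sum_eq_expect_one, Finsupp.smul_apply, Finsupp.add_apply, smul_eq_mul]
  refine mul_nonneg (inv_nonneg.2 hp.le) (add_nonneg ?_ ?_)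
  · rw [Finsupp.filter_apply]; split_ifs; exacts [hμ k, le_rfl]
  · rw [Finsupp.single_apply]; split_ifs; exacts [sub_nonneg.2 h, le_rfl]

theorem upperLaw_apply_nonneg {μ : ℝ →₀ ℝ} (hμ : ∀ k, 0 ≤ μ k) {κ p : ℝ} (hp : p < 1)
    (h : p ≤ expect (μ.filter (fun x => x ≤ κ)) (fun _ => 1)) (k : ℝ) :
    0 ≤ upperLaw μ κ p k := by
  rw [upperLaw, sum_eq_expect_one, Finsupp.smul_apply, Finsupp.add_apply, smul_eq_mul]
  refine mul_nonneg (inv_nonneg.2 (sub_pos.2 hp).le) (add_nonneg ?_ ?_)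
  · rw [Finsupp.single_apply]; split_ifs; exacts [sub_nonneg.2 h, le_rfl]
  · rw [Finsupp.filter_apply]; split_ifs; exacts [hμ k, le_rfl]

theorem lowerLaw_support {μ : ℝ →₀ ℝ} {κ p : ℝ} (hκ : κ ∈ μ.support) {k : ℝ}
    (hk : k ∈ (lowerLaw μ κ p).support) : k ∈ μ.support ∧ k ≤ κ := by
  classical
  rcases Finset.mem_union.1 (Finsupp.support_add (Finsupp.support_smul hk)) with h | h
  · rw [Finsupp.support_filter, Finset.mem_filter] at h
    exact ⟨h.1, h.2.le⟩
  · rw [Finset.mem_singleton.1 (Finsupp.support_single_subset h)]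
    exact ⟨hκ, le_rfl⟩

theorem upperLaw_support {μ : ℝ →₀ ℝ} {κ p : ℝ} (hκ : κ ∈ μ.support) {k : ℝ}
    (hk : k ∈ (upperLaw μ κ p).support) : k ∈ μ.support ∧ κ ≤ k := by
  classical
  rcases Finset.mem_union.1 (Finsupp.support_add (Finsupp.support_smul hk)) with h | h
  · rw [Finset.mem_singleton.1 (Finsupp.support_single_subset h)]
    exact ⟨hκ, le_rfl⟩
  · rw [Finsupp.support_filter, Finset.mem_filter] at h
    exact ⟨h.1, h.2.le⟩

theorem expect_lowerLaw (μ : ℝ →₀ ℝ) {κ p : ℝ} (φ : ℝ → ℝ) (hp : p ≠ 0) :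
    p * expect (lowerLaw μ κ p) φ = expect (μ.filter (fun x => x < κ)) φ +
      (p - expect (μ.filter (fun x => x < κ)) (fun _ => 1)) * φ κ := by
  rw [lowerLaw, sum_eq_expect_one, expect_smul_left, expect_add_left, expect_single,
    mul_inv_cancel_left₀ hp]

/-- Whatever `p` is, the masses put at `κ` add up to `μ[0, κ] - μ[0, κ) = μ {κ}`. -/
theorem lowerLaw_add_upperLaw (μ : ℝ →₀ ℝ) {κ p : ℝ} (hp : p ≠ 0) (hp1 : 1 - p ≠ 0) :
    p • lowerLaw μ κ p + (1 - p) • upperLaw μ κ p = μ := by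
  rw [lowerLaw, upperLaw, smul_inv_smul₀ hp, smul_inv_smul₀ hp1, sum_eq_expect_one,
    sum_eq_expect_one]
  have h : expect (μ.filter (fun x => x ≤ κ)) (fun _ => 1) =
      expect (μ.filter (fun x => x < κ)) (fun _ => 1) + μ κ := by
    have h1 : μ.filter (fun x => x ≤ κ) =
        μ.filter (fun x => x < κ) + Finsupp.single κ (μ κ) := by
      ext k
      simp only [Finsupp.add_apply, Finsupp.filter_apply, Finsupp.single_apply]
      rcases lt_trichotomy k κ with h | rfl | h
      · simp [h, h.le, h.ne']
      · simp
      · simp [not_lt.2 h.le, not_le.2 h, h.ne]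
    rw [h1, expect_add_left, expect_single, mul_one]
  rw [h]
  ext k
  simp only [Finsupp.add_apply, Finsupp.filter_apply, Finsupp.single_apply]
  rcases lt_trichotomy k κ with h | rfl | h
  · simp [h, h.ne', not_lt.2 h.le]
  · simp
  · simp [not_lt.2 h.le, h, h.ne]

theorem expect_split (μ : ℝ →₀ ℝ) {κ p : ℝ} (hp : p ≠ 0) (hp1 : 1 - p ≠ 0) (φ : ℝ → ℝ) :
    expect μ φ = p * expect (lowerLaw μ κ p) φ + (1 - p) * expect (upperLaw μ κ p) φ := by
  conv_lhs => rw [← lowerLaw_add_upperLaw μ (κ := κ) hp hp1]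
  rw [expect_add_left, expect_smul_left, expect_smul_left]

namespace IsLaw

variable {r L s : ℝ} {μ : ℝ →₀ ℝ}

/-- The slope of the put price just left of `κ` is the discounted mass of `[0, κ)`; the chord starts
at the previous atom, or at `0`. -/
theorem exists_put_slope_left (_h : IsLaw r L s μ) {κ : ℝ} (hκ : 0 < κ) :
    ∃ x, 0 ≤ x ∧ x < κ ∧ europeanPut r L μ κ - europeanPut r L μ x =
      Real.exp (-(r * L)) * (expect (μ.filter (fun x => x < κ)) (fun _ => 1) * (κ - x)) := by
  obtain ⟨x, hx, hmax⟩ := (insert 0 (μ.support.filter (fun k => k < κ))).exists_max_image id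
    ⟨0, Finset.mem_insert_self _ _⟩
  have hxκ : x < κ := by
    rcases Finset.mem_insert.1 hx with rfl | h1
    · exact hκ
    · exact (Finset.mem_filter.1 h1).2
  refine ⟨x, hmax 0 (Finset.mem_insert_self _ _), hxκ, ?_⟩
  rw [europeanPut_eq, europeanPut_eq, ← mul_sub, expect_filter]
  congr 1
  rw [sub_eq_iff_eq_add, mul_comm, ← expect_const_mul, ← expect_add]
  refine expect_congr fun k hk => ?_
  rcases lt_or_ge k κ with h1 | h1
  · have : k ≤ x := hmax k (Finset.mem_insert_of_mem (Finset.mem_filter.2 ⟨hk, h1⟩))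
    rw [max_eq_left (by linarith), max_eq_left (by linarith), if_pos h1]
    ring
  · rw [max_eq_right (by linarith), max_eq_right (by linarith), if_neg (not_lt.2 h1)]
    ring

theorem exists_put_slope_right (_h : IsLaw r L s μ) (κ : ℝ) :
    ∃ y, κ < y ∧ europeanPut r L μ y - europeanPut r L μ κ =
      Real.exp (-(r * L)) * (expect (μ.filter (fun x => x ≤ κ)) (fun _ => 1) * (y - κ)) := by
  obtain ⟨y, hy, hmin⟩ :=
    (insert (κ + 1) (μ.support.filter (fun k => κ < k))).exists_min_image id
    ⟨_, Finset.mem_insert_self _ _⟩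
  have hyκ : κ < y := by
    rcases Finset.mem_insert.1 hy with rfl | h1
    · exact lt_add_one κ
    · exact (Finset.mem_filter.1 h1).2
  refine ⟨y, hyκ, ?_⟩
  rw [europeanPut_eq, europeanPut_eq, ← mul_sub, expect_filter]
  congr 1
  rw [sub_eq_iff_eq_add, mul_comm, ← expect_const_mul, ← expect_add]
  refine expect_congr fun k hk => ?_
  rcases le_or_gt k κ with h1 | h1
  · rw [max_eq_left (by linarith), max_eq_left (by linarith), if_pos h1]
    ring
  · have : y ≤ k := hmin k (Finset.mem_insert_of_mem (Finset.mem_filter.2 ⟨hk, h1⟩))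
    rw [max_eq_right (by linarith), max_eq_right (by linarith), if_neg (not_le.2 h1)]
    ring

end IsLaw

/-! ### The two nodes after a split -/

/-- A non-trivial node with its extension and a splitting step. -/
structure SplitNode (r L s : ℝ) (μ : ℝ →₀ ℝ) (A Aext : ℝ → ℝ) (Kt Kp : ℝ) (g : ℝ × ℝ)
    (c tc Kc κ : ℝ) (f : ℝ × ℝ) : Prop where
  node : Node r L s μ A
  ext : Extended r L s μ A Aext Kt Kp g c
  step : Step r L s μ Aext tc Kc κ f

namespace SplitNode

variable {r L s : ℝ} {μ : ℝ →₀ ℝ} {A Aext : ℝ → ℝ} {Kt Kp c tc Kc κ : ℝ} {g f : ℝ × ℝ}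

theorem lam_gt_one (h : SplitNode r L s μ A Aext Kt Kp g c tc Kc κ f) :
    1 < Real.exp (r * (L - tc)) :=
  Real.one_lt_exp_iff.2 (mul_pos h.node.rate_pos (sub_pos.2 h.step.tc_lt))

theorem lam_mul (h : SplitNode r L s μ A Aext Kt Kp g c tc Kc κ f) :
    Real.exp (r * (L - tc)) * Kc = κ := by
  rw [h.step.Kc_eq, discountedAtom, mul_left_comm, ← Real.exp_add]; simp

theorem Kc_eq (h : SplitNode r L s μ A Aext Kt Kp g c tc Kc κ f) :
    Kc = Real.exp (-(r * (L - tc))) * κ := by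
  rw [h.step.Kc_eq, discountedAtom, mul_comm]

theorem Kc_pos (h : SplitNode r L s μ A Aext Kt Kp g c tc Kc κ f) : 0 < Kc := by
  rw [h.Kc_eq]; exact mul_pos (Real.exp_pos _) h.step.atom_pos

theorem Kc_le (h : SplitNode r L s μ A Aext Kt Kp g c tc Kc κ f) : Kc ≤ κ := by
  rw [← h.lam_mul]; exact le_mul_of_one_le_left h.Kc_pos.le h.lam_gt_one.le

theorem slope_pos (h : SplitNode r L s μ A Aext Kt Kp g c tc Kc κ f) : 0 < f.1 := h.step.piece.1

theorem piece_le (h : SplitNode r L s μ A Aext Kt Kp g c tc Kc κ f) {K : ℝ} (hK : 0 ≤ K) :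
    lineEval f K ≤ Aext K :=
  h.ext.polyhedral.lineEval_le_of_isPiece h.step.piece hK

theorem ext_zero (h : SplitNode r L s μ A Aext Kt Kp g c tc Kc κ f) : Aext 0 = 0 := by
  rw [h.ext.eq_A 0 le_rfl h.ext.Kt_pos.le, h.node.zero]

theorem ext_nonneg (h : SplitNode r L s μ A Aext Kt Kp g c tc Kc κ f) {K : ℝ} (hK : 0 ≤ K) :
    0 ≤ Aext K :=
  (h.node.law.put_nonneg K).trans (h.ext.european_le K hK)

theorem ext_le_upper (h : SplitNode r L s μ A Aext Kt Kp g c tc Kc κ f) {K : ℝ} (hK : 0 ≤ K) :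
    Aext K ≤ europeanPut r L μ (Real.exp (r * (L - tc)) * K) := h.step.le_upper K hK

theorem piece_Kc (h : SplitNode r L s μ A Aext Kt Kp g c tc Kc κ f) :
    lineEval f Kc = europeanPut r L μ κ := by
  have := h.step.touch
  rwa [upperBound, h.lam_mul] at this

theorem ext_Kc (h : SplitNode r L s μ A Aext Kt Kp g c tc Kc κ f) : Aext Kc = lineEval f Kc := by
  refine le_antisymm ?_ (h.piece_le h.Kc_pos.le)
  rw [h.piece_Kc]
  have := h.ext_le_upper h.Kc_pos.le
  rwa [h.lam_mul] at this

theorem intercept_nonneg (h : SplitNode r L s μ A Aext Kt Kp g c tc Kc κ f) : 0 ≤ f.2 := by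
  have := h.piece_le (K := 0) le_rfl
  rw [h.ext_zero] at this
  unfold lineEval at this
  linarith

theorem not_bound (h : SplitNode r L s μ A Aext Kt Kp g c tc Kc κ f) :
    ¬ Bound Aext (europeanPut r L μ) f :=
  not_bound_of_touch h.node.law.polyhedral_put h.lam_gt_one (fun _ hK => h.ext_le_upper hK)
    (fun _ hK => (h.piece_le hK).trans (h.ext_le_upper hK)) h.Kc_pos
    (by rw [h.lam_mul, h.piece_Kc])

theorem piece_left (h : SplitNode r L s μ A Aext Kt Kp g c tc Kc κ f) :
    f.1 ≤ g.1 ∧ ∃ a b, 0 ≤ a ∧ a < b ∧ b ≤ Kt ∧ ∀ K ∈ Set.Icc a b, A K = lineEval f K :=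
  (h.ext.piece_cases h.step.piece).resolve_right fun h' => h.not_bound h'.1

/-- The embedded piece, read as a function of the strike at maturity. -/
theorem tangent_le (h : SplitNode r L s μ A Aext Kt Kp g c tc Kc κ f) {K : ℝ} (hK : 0 ≤ K) :
    lineEval f (Real.exp (-(r * (L - tc))) * K) ≤ europeanPut r L μ K := by
  have hq : 0 ≤ Real.exp (-(r * (L - tc))) * K := mul_nonneg (Real.exp_pos _).le hK
  have := (h.piece_le hq).trans (h.ext_le_upper hq)
  rwa [← mul_assoc, ← Real.exp_add, add_neg_cancel, Real.exp_zero, one_mul] at this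

theorem tangent_atom (h : SplitNode r L s μ A Aext Kt Kp g c tc Kc κ f) :
    lineEval f (Real.exp (-(r * (L - tc))) * κ) = europeanPut r L μ κ := by
  rw [← h.Kc_eq, h.piece_Kc]

theorem exp_mul (r L tc : ℝ) : Real.exp (-(r * L)) =
    Real.exp (-(r * tc)) * Real.exp (-(r * (L - tc))) := by
  rw [← Real.exp_add]; congr 1; ring

/-- At a strike where `f` is followed it is at least `g`, and it is not steeper, so `f.2 ≤ g.2`. The
line `g` meets `K - s` at `Kt > 0` with slope below `1`, so `g.2 < s`. -/
theorem intercept_lt (h : SplitNode r L s μ A Aext Kt Kp g c tc Kc κ f) : f.2 < s := by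
  obtain ⟨hfg, a, b, ha, hab, hb, hA⟩ := h.piece_left
  have e1 := h.ext.line_le b (ha.trans hab.le)
  rw [h.ext.eq_A b (ha.trans hab.le) hb, hA b ⟨hab.le, le_rfl⟩] at e1
  have e2 := h.ext.eq_line Kt le_rfl h.ext.Kt_le
  rw [h.ext.eq_A Kt h.ext.Kt_pos.le le_rfl, h.ext.exercise Kt le_rfl] at e2
  have e3 := mul_le_mul_of_nonneg_right hfg (ha.trans hab.le)
  have e4 := mul_lt_mul_of_pos_right h.ext.slope_lt h.ext.Kt_pos
  unfold lineEval at *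
  linarith

/-- This is `p_d < 1`. A supporting line of `E` is no steeper than `e^{-rL}`; with equality it would
run below `e^{-rL} K - s` beyond the last atom, contrary to `f.2 < s`. -/
theorem slope_lt (h : SplitNode r L s μ A Aext Kt Kp g c tc Kc κ f) :
    f.1 < Real.exp (-(r * tc)) := by
  have hq := Real.exp_pos (-(r * (L - tc)))
  have hle : f.1 ≤ Real.exp (-(r * tc)) := by
    have e1 := h.tangent_le (K := κ + 1) (by linarith [h.step.atom_pos])
    have e2 := h.tangent_atom
    have e3 := h.node.law.put_sub_le (x := κ) (y := κ + 1) (by linarith)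
    rw [exp_mul r L tc] at e3
    set q := Real.exp (-(r * (L - tc)))
    have : f.1 * q ≤ Real.exp (-(r * tc)) * q := by unfold lineEval at *; linarith
    exact le_of_mul_le_mul_right this hq
  refine hle.lt_of_ne fun heq => ?_
  have hlt := h.intercept_lt
  obtain ⟨N, hN⟩ := μ.support.bddAbove
  have hN0 : 0 ≤ max N 0 := le_max_right _ _
  have e1 := h.tangent_le hN0
  rw [h.node.law.put_eq_of_ge (fun k hk => (hN hk).trans (le_max_left _ _)), exp_mul r L tc,
    ← heq] at e1
  unfold lineEval at e1
  linarith

theorem downMass_pos (h : SplitNode r L s μ A Aext Kt Kp g c tc Kc κ f) : 0 < downMass r tc f :=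
  mul_pos (Real.exp_pos _) h.slope_pos

theorem downMass_lt (h : SplitNode r L s μ A Aext Kt Kp g c tc Kc κ f) : downMass r tc f < 1 := by
  have := mul_lt_mul_of_pos_left h.slope_lt (Real.exp_pos (r * tc))
  rwa [← Real.exp_add, add_neg_cancel, Real.exp_zero] at this

theorem exp_mul_downMass (r tc : ℝ) (f : ℝ × ℝ) :
    Real.exp (-(r * tc)) * downMass r tc f = f.1 := by
  rw [downMass, ← mul_assoc, ← Real.exp_add]; simp

/-- A supporting line at `κ` is at least as steep as `E` on the left of `κ`. With the counterpart on
the right, this makes the masses left at `κ` non-negative. -/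
theorem le_downMass (h : SplitNode r L s μ A Aext Kt Kp g c tc Kc κ f) :
    expect (μ.filter (fun x => x < κ)) (fun _ => 1) ≤ downMass r tc f := by
  obtain ⟨x, hx0, hxκ, hx⟩ := h.node.law.exists_put_slope_left h.step.atom_pos
  have e1 := h.tangent_le hx0
  have e2 := h.tangent_atom
  have hX := exp_mul_downMass r tc f
  rw [exp_mul r L tc] at hx
  set q := Real.exp (-(r * (L - tc))) with hqdef
  set m := expect (μ.filter (fun x => x < κ)) (fun _ => 1)
  have hq : 0 < Real.exp (-(r * tc)) * q * (κ - x) :=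
    mul_pos (mul_pos (Real.exp_pos _) (Real.exp_pos _)) (sub_pos.2 hxκ)
  refine le_of_mul_le_mul_left ?_ hq
  have e3 : Real.exp (-(r * tc)) * q * (κ - x) * downMass r tc f = f.1 * q * (κ - x) := by
    rw [← hX]; ring
  rw [e3]
  unfold lineEval at *
  linarith

theorem downMass_le (h : SplitNode r L s μ A Aext Kt Kp g c tc Kc κ f) :
    downMass r tc f ≤ expect (μ.filter (fun x => x ≤ κ)) (fun _ => 1) := by
  obtain ⟨y, hyκ, hy⟩ := h.node.law.exists_put_slope_right κ
  have e1 := h.tangent_le (h.step.atom_pos.le.trans hyκ.le)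
  have e2 := h.tangent_atom
  have hX := exp_mul_downMass r tc f
  rw [exp_mul r L tc] at hy
  set q := Real.exp (-(r * (L - tc))) with hqdef
  set m := expect (μ.filter (fun x => x ≤ κ)) (fun _ => 1)
  have hq : 0 < Real.exp (-(r * tc)) * q * (y - κ) :=
    mul_pos (mul_pos (Real.exp_pos _) (Real.exp_pos _)) (sub_pos.2 hyκ)
  refine le_of_mul_le_mul_left ?_ hq
  have e3 : Real.exp (-(r * tc)) * q * (y - κ) * downMass r tc f = f.1 * q * (y - κ) := by
    rw [← hX]; ring
  rw [e3]
  unfold lineEval at *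
  linarith

theorem expect_lt_put (_h : SplitNode r L s μ A Aext Kt Kp g c tc Kc κ f) :
    Real.exp (-(r * L)) * expect (μ.filter (fun x => x < κ)) (fun k => κ - k) =
      europeanPut r L μ κ := by
  rw [europeanPut_eq, expect_filter]
  congr 1
  refine expect_congr fun k _ => ?_
  split_ifs with h1
  · rw [max_eq_left (by linarith)]
  · rw [max_eq_right (by linarith)]

/-- `E κ` involves only atoms below `κ`. Equating it with the value of `f` at `Kc` identifies the
zero of `f` with the discounted mean of the lower law. -/
theorem isLaw_lower (h : SplitNode r L s μ A Aext Kt Kp g c tc Kc κ f) :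
    IsLaw r (L - tc) (downSpot f) (lowerLaw μ κ (downMass r tc f)) := by
  have hp := h.downMass_pos
  refine ⟨lowerLaw_apply_nonneg h.node.law.nonneg hp h.le_downMass,
    fun k hk => h.node.law.atoms k (lowerLaw_support h.step.atom hk).1, ?_, ?_⟩
  · refine mul_left_cancel₀ hp.ne' ?_
    rw [expect_lowerLaw _ _ hp.ne']; ring
  · refine mul_left_cancel₀ hp.ne' ?_
    rw [expect_lowerLaw _ _ hp.ne']
    have e1 := h.expect_lt_put
    have e2 : expect (μ.filter (fun x => x < κ)) (fun k => κ - k) =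
        κ * expect (μ.filter (fun x => x < κ)) (fun _ => 1) -
          expect (μ.filter (fun x => x < κ)) (fun k => k) := by
      rw [← expect_const_mul, eq_sub_iff_add_eq, ← expect_add]
      exact expect_congr fun k _ => by ring
    rw [e2, ← h.tangent_atom, exp_mul r L tc] at e1
    have hX := exp_mul_downMass r tc f
    have hfd : f.1 * downSpot f = f.2 := by
      rw [downSpot, mul_div_cancel₀ _ h.slope_pos.ne']
    have hlq : Real.exp (-(r * (L - tc))) * Real.exp (r * (L - tc)) = 1 := by
      rw [← Real.exp_add]; simp
    have hE : 0 < Real.exp (-(r * tc)) * Real.exp (-(r * (L - tc))) :=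
      mul_pos (Real.exp_pos _) (Real.exp_pos _)
    refine mul_left_cancel₀ hE.ne' ?_
    set q := Real.exp (-(r * (L - tc)))
    set lam := Real.exp (r * (L - tc))
    set X := Real.exp (-(r * tc))
    set p := downMass r tc f
    unfold lineEval at e1
    linear_combination -e1 + (κ * q - downSpot f * q * lam) * hX - f.1 * downSpot f * hlq - hfd

theorem isLaw_upper (h : SplitNode r L s μ A Aext Kt Kp g c tc Kc κ f) :
    IsLaw r (L - tc) (upSpot r s tc f) (upperLaw μ κ (downMass r tc f)) := by
  have hp := h.downMass_pos
  have hp1 : 0 < 1 - downMass r tc f := sub_pos.2 h.downMass_lt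
  have hsplit := fun φ => expect_split μ (κ := κ) hp.ne' hp1.ne' φ
  refine ⟨upperLaw_apply_nonneg h.node.law.nonneg h.downMass_lt h.downMass_le,
    fun k hk => h.node.law.atoms k (upperLaw_support h.step.atom hk).1, ?_, ?_⟩
  · have := hsplit (fun _ => 1)
    rw [h.node.law.mass, h.isLaw_lower.mass] at this
    refine mul_left_cancel₀ hp1.ne' ?_
    linarith
  · have := hsplit (fun k => k)
    rw [h.node.law.mean, h.isLaw_lower.mean] at this
    refine mul_left_cancel₀ hp1.ne' ?_
    rw [upSpot, ← mul_assoc, mul_div_cancel₀ _ hp1.ne']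
    have hX : Real.exp (r * L) = Real.exp (r * tc) * Real.exp (r * (L - tc)) := by
      rw [← Real.exp_add]; congr 1; ring
    rw [hX] at this
    linear_combination -this

theorem put_lower_of_le (h : SplitNode r L s μ A Aext Kt Kp g c tc Kc κ f) {K : ℝ} (hK : K ≤ κ) :
    europeanPut r (L - tc) (lowerLaw μ κ (downMass r tc f)) K = f.1⁻¹ * europeanPut r L μ K := by
  have hp := h.downMass_pos
  have e1 := expect_lowerLaw μ (κ := κ) (fun k => max (K - k) 0) hp.ne'
  rw [max_eq_right (by linarith : K - κ ≤ 0), mul_zero, add_zero, expect_filter] at e1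
  have e2 : expect μ (fun k => if k < κ then max (K - k) 0 else 0) =
      expect μ (fun k => max (K - k) 0) := by
    refine expect_congr fun k _ => ?_
    split_ifs with h1
    · rfl
    · rw [max_eq_right (by linarith)]
  rw [e2] at e1
  rw [europeanPut_eq, europeanPut_eq, ← e1, exp_mul r L tc, eq_inv_mul_iff_mul_eq₀ h.slope_pos.ne',
    ← exp_mul_downMass r tc f]
  ring

/-- The lower law has no atom beyond `κ`, so its put price leaves the rescaled `E` there and
continues along the supporting line. -/
theorem put_lower_of_ge (h : SplitNode r L s μ A Aext Kt Kp g c tc Kc κ f) {K : ℝ} (hK : κ ≤ K) :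
    europeanPut r (L - tc) (lowerLaw μ κ (downMass r tc f)) K =
      f.1⁻¹ * lineEval f (Real.exp (-(r * (L - tc))) * K) := by
  rw [h.isLaw_lower.put_eq_of_ge fun k hk => (lowerLaw_support h.step.atom hk).2.trans hK,
    eq_inv_mul_iff_mul_eq₀ h.slope_pos.ne', mul_sub, downSpot, mul_div_cancel₀ _ h.slope_pos.ne']
  rfl

theorem put_split (h : SplitNode r L s μ A Aext Kt Kp g c tc Kc κ f) (K : ℝ) :
    europeanPut r (L - tc) (upperLaw μ κ (downMass r tc f)) K =
      Real.exp (r * tc) / (1 - downMass r tc f) * (europeanPut r L μ K -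
        f.1 * europeanPut r (L - tc) (lowerLaw μ κ (downMass r tc f)) K) := by
  have hp1 : 0 < 1 - downMass r tc f := sub_pos.2 h.downMass_lt
  have e1 := expect_split μ (κ := κ) h.downMass_pos.ne' hp1.ne' (fun k => max (K - k) 0)
  have hX : Real.exp (r * tc) * Real.exp (-(r * tc)) = 1 := by rw [← Real.exp_add]; simp
  rw [div_mul_eq_mul_div, eq_div_iff hp1.ne', europeanPut_eq, europeanPut_eq, europeanPut_eq, e1,
    exp_mul r L tc, ← exp_mul_downMass r tc f]
  set p := downMass r tc f
  set X := Real.exp (r * tc)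
  set Y := Real.exp (-(r * tc))
  linear_combination (-(Real.exp (-(r * (L - tc))) *
    (1 - p) * expect (upperLaw μ κ p) fun k => max (K - k) 0)) * hX

theorem put_upper_of_le (h : SplitNode r L s μ A Aext Kt Kp g c tc Kc κ f) {K : ℝ} (hK : K ≤ κ) :
    europeanPut r (L - tc) (upperLaw μ κ (downMass r tc f)) K = 0 := by
  rw [h.put_split, h.put_lower_of_le hK, mul_inv_cancel_left₀ h.slope_pos.ne', sub_self, mul_zero]

theorem put_upper_of_ge (h : SplitNode r L s μ A Aext Kt Kp g c tc Kc κ f) {K : ℝ} (hK : κ ≤ K) :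
    europeanPut r (L - tc) (upperLaw μ κ (downMass r tc f)) K =
      Real.exp (r * tc) / (1 - downMass r tc f) *
        (europeanPut r L μ K - lineEval f (Real.exp (-(r * (L - tc))) * K)) := by
  rw [h.put_split, h.put_lower_of_ge hK, mul_inv_cancel_left₀ h.slope_pos.ne']

/-! The American price functions after the split. -/

theorem lineMax_eq {P : Set (ℝ × ℝ)} {K v : ℝ} (hle : ∀ f ∈ P, lineEval f K ≤ v)
    (hex : ∃ f ∈ P, lineEval f K = v) : lineMax P K = v := by
  refine IsGreatest.csSup_eq ⟨?_, ?_⟩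
  · obtain ⟨f, hf, hfK⟩ := hex
    exact ⟨f, hf, hfK⟩
  · rintro _ ⟨f, hf, rfl⟩
    exact hle f hf

theorem scale_lower (_h : SplitNode r L s μ A Aext Kt Kp g c tc Kc κ f) :
    Real.exp (r * tc) / downMass r tc f = f.1⁻¹ := by
  rw [downMass, div_mul_cancel_left₀ (Real.exp_pos _).ne']

/-- The extension meets `f` at `Kc`, so by convexity no piece active before `Kc` is steeper than
`f`, and dropping the steeper ones changes nothing. -/
theorem american_lower_of_le (h : SplitNode r L s μ A Aext Kt Kp g c tc Kc κ f) {K : ℝ}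
    (hK0 : 0 ≤ K) (hK : K ≤ Kc) : lowerAmerican r tc Aext f K = f.1⁻¹ * Aext K := by
  rw [lowerAmerican, h.scale_lower]
  congr 1
  refine lineMax_eq ?_ ?_
  · rintro u (hu | hu)
    · rw [Set.mem_singleton_iff.1 hu]
      simpa [lineEval] using h.ext_nonneg hK0
    · exact h.ext.polyhedral.lineEval_le_of_isPiece hu.1 hK0
  · rcases hK.eq_or_lt with rfl | hlt
    · exact ⟨f, Or.inr ⟨h.step.piece, le_rfl⟩, h.ext_Kc.symm⟩
    obtain ⟨u, hu, huK⟩ := h.ext.polyhedral.exists_piece_or_zero h.ext_zero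
      (fun K hK => h.ext_nonneg hK) hK0
    refine ⟨u, ?_, huK.symm⟩
    rcases hu with hu | rfl
    · refine Or.inr ⟨hu, slope_le_of_lineEval_le hlt ((h.piece_le hK0).trans_eq huK) ?_⟩
      rw [← h.ext_Kc]
      exact h.ext.polyhedral.lineEval_le_of_isPiece hu h.Kc_pos.le
    · exact Or.inl rfl

theorem american_lower_of_ge (h : SplitNode r L s μ A Aext Kt Kp g c tc Kc κ f) {K : ℝ}
    (hK : Kc ≤ K) : lowerAmerican r tc Aext f K = f.1⁻¹ * lineEval f K := by
  rw [lowerAmerican, h.scale_lower]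
  congr 1
  refine lineMax_eq ?_ ⟨f, Or.inr ⟨h.step.piece, le_rfl⟩, rfl⟩
  rintro u (hu | hu)
  · rw [Set.mem_singleton_iff.1 hu]
    refine lineEval_le_of_le ?_ h.slope_pos.le hK
    rw [← h.ext_Kc]
    simpa [lineEval] using h.ext_nonneg h.Kc_pos.le
  · refine lineEval_le_of_le ?_ hu.2 hK
    rw [← h.ext_Kc]
    exact h.ext.polyhedral.lineEval_le_of_isPiece hu.1 h.Kc_pos.le

theorem exercise_le_upper (h : SplitNode r L s μ A Aext Kt Kp g c tc Kc κ f) (K : ℝ) :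
    lineEval (Real.exp (-(r * tc)), s) K ≤ europeanPut r L μ (Real.exp (r * (L - tc)) * K) := by
  have := h.node.law.put_lower (Real.exp (r * (L - tc)) * K)
  rw [← mul_assoc, ← Real.exp_add, show -(r * L) + r * (L - tc) = -(r * tc) by ring] at this
  exact this

/-- At `Kc` the exercise line is below the upper bound, which equals `f` there; being steeper than
`f`, it is below `f` further left. -/
theorem exercise_le_piece (h : SplitNode r L s μ A Aext Kt Kp g c tc Kc κ f) {K : ℝ}
    (hK : K ≤ Kc) : lineEval (Real.exp (-(r * tc)), s) K ≤ lineEval f K := by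
  refine lineEval_le_of_ge (x := Kc) ?_ h.slope_lt.le hK
  have := h.exercise_le_upper Kc
  rwa [h.lam_mul, ← h.piece_Kc] at this

theorem american_upper_of_le (h : SplitNode r L s μ A Aext Kt Kp g c tc Kc κ f) {K : ℝ}
    (hK : K ≤ Kc) : upperAmerican r s tc Aext f K = 0 := by
  rw [upperAmerican, lineMax_eq (v := lineEval f K) ?_
    ⟨f, Or.inl ⟨h.step.piece, le_rfl⟩, rfl⟩, sub_self, mul_zero]
  rintro u (hu | hu)
  · refine lineEval_le_of_ge ?_ hu.2 hK
    rw [← h.ext_Kc]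
    exact h.ext.polyhedral.lineEval_le_of_isPiece hu.1 h.Kc_pos.le
  · rw [Set.mem_singleton_iff.1 hu]
    exact h.exercise_le_piece hK

theorem american_upper_of_ge (h : SplitNode r L s μ A Aext Kt Kp g c tc Kc κ f) {K : ℝ}
    (hK : Kc ≤ K) : upperAmerican r s tc Aext f K = Real.exp (r * tc) / (1 - downMass r tc f) *
      (max (Aext K) (lineEval (Real.exp (-(r * tc)), s) K) - lineEval f K) := by
  have hK0 := h.Kc_pos.le.trans hK
  rw [upperAmerican, lineMax_eq (v := max (Aext K) (lineEval (Real.exp (-(r * tc)), s) K))]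
  · rintro u (hu | hu)
    · exact le_max_of_le_left (h.ext.polyhedral.lineEval_le_of_isPiece hu.1 hK0)
    · rw [Set.mem_singleton_iff.1 hu]
      exact le_max_right _ _
  · rcases le_total (Aext K) (lineEval (Real.exp (-(r * tc)), s) K) with hm | hm
    · rw [max_eq_right hm]
      exact ⟨_, Or.inr rfl, rfl⟩
    rw [max_eq_left hm]
    rcases hK.eq_or_lt with rfl | hlt
    · exact ⟨f, Or.inl ⟨h.step.piece, le_rfl⟩, h.ext_Kc.symm⟩
    obtain ⟨u, hu, huK⟩ := h.ext.polyhedral.exists_piece_or_zero h.ext_zero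
      (fun K hK => h.ext_nonneg hK) hK0
    refine ⟨u, ?_, huK.symm⟩
    have hslope : f.1 ≤ u.1 → u ∈ {g | IsPiece Aext g ∧ f.1 ≤ g.1} ∪
        {(Real.exp (-(r * tc)), s)} := fun h1 => by
      rcases hu with hu | rfl
      · exact Or.inl ⟨hu, h1⟩
      · exact absurd h1 (not_le.2 h.slope_pos)
    refine hslope (slope_le_of_lineEval_le hlt ?_ ((h.piece_le hK0).trans_eq huK))
    rw [← h.ext_Kc]
    rcases hu with hu | rfl
    · exact h.ext.polyhedral.lineEval_le_of_isPiece hu h.Kc_pos.le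
    · simpa [lineEval] using h.ext_nonneg h.Kc_pos.le

end SplitNode

end AmericanPut

/-! ### The invariant for the two successors, and the recursion for American prices. -/

namespace AmericanPut

open Filter Topology

namespace SplitNode

variable {r L s : ℝ} {μ : ℝ →₀ ℝ} {A Aext : ℝ → ℝ} {Kt Kp c tc Kc κ : ℝ} {g f : ℝ × ℝ}

theorem node_lower (h : SplitNode r L s μ A Aext Kt Kp g c tc Kc κ f) :
    Node r (L - tc) (downSpot f) (lowerLaw μ κ (downMass r tc f)) (lowerAmerican r tc Aext f) := by
  have ha := h.slope_pos
  have hi : 0 ≤ f.1⁻¹ := inv_nonneg.2 ha.le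
  have hKc := h.Kc_pos
  have hKcκ := h.Kc_le
  have hlaw := h.isLaw_lower
  have hpoly : Polyhedral (lowerAmerican r tc Aext f) := by
    have h1 : Polyhedral (fun K => if K ≤ Kc then Aext K else lineEval f K) := by
      refine Polyhedral.glue (l := f) hKc.le h.ext.polyhedral (polyhedral_lineEval f) h.ext_Kc rfl
        (fun K hK _ => h.piece_le hK) (fun _ _ => le_rfl) (fun K _ hK => by simp [hK])
        (fun K hK => ?_)
      rcases hK.eq_or_lt with rfl | hlt
      · simp [h.ext_Kc]
      · simp [not_le.2 hlt]
    refine (h1.const_mul hi).congr fun K hK => ?_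
    split_ifs with hle
    · exact h.american_lower_of_le hK hle
    · exact h.american_lower_of_ge (not_le.1 hle).le
  have hleg : ∀ x y, 0 < x → x ≤ y →
      (lowerAmerican r tc Aext f x - europeanPut r (L - tc) (lowerLaw μ κ (downMass r tc f)) x) * y ≤
      (lowerAmerican r tc Aext f y - europeanPut r (L - tc) (lowerLaw μ κ (downMass r tc f)) y) * x := by
    intro x y hx hxy
    refine glue_div_mono (D := fun K => lowerAmerican r tc Aext f K -
      europeanPut r (L - tc) (lowerLaw μ κ (downMass r tc f)) K) (b := κ) (B := y)
      -- Up to `Kc` the difference is that of the parent, rescaled. On `[Kc, κ]` the curve is the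
      -- line `f`, and chords of `E` before the contact with its supporting line have intercepts
      -- bounded by `f.2`. Beyond `κ` both are lines with the same intercept and the quotient is
      -- constant.
      h.step.atom_pos ?_ ?_ hx hxy le_rfl
    · intro x y hx hxy hy
      refine glue_div_mono (D := fun K => lowerAmerican r tc Aext f K -
        europeanPut r (L - tc) (lowerLaw μ κ (downMass r tc f)) K) (b := Kc) (B := κ)
        hKc ?_ ?_ hx hxy hy
      · intro x y hx hxy hy
        have := mul_le_mul_of_nonneg_left (h.ext.legendre x y hx hxy) hi
        simp only [h.american_lower_of_le hx.le (hxy.trans hy),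
          h.american_lower_of_le (hx.le.trans hxy) hy,
          h.put_lower_of_le ((hxy.trans hy).trans hKcκ), h.put_lower_of_le (hy.trans hKcκ)]
        linarith
      · intro x y hx hxy hy
        have e1 := h.node.law.polyhedral_put.intercept_le
          (f := (f.1 * Real.exp (-(r * (L - tc))), f.2)) (z := κ)
          (fun K hK => by
            have := h.tangent_le hK
            unfold lineEval at *; linarith) (hKc.le.trans hx) hxy hy (by
            have := h.tangent_atom
            unfold lineEval at *; linarith)
        have := mul_le_mul_of_nonneg_left e1 hi
        simp only [h.american_lower_of_ge hx, h.american_lower_of_ge (hx.trans hxy),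
          h.put_lower_of_le (hxy.trans hy), h.put_lower_of_le hy]
        unfold lineEval
        linarith
    · intro x y hx hxy _
      simp only [h.american_lower_of_ge (hKcκ.trans hx),
        h.american_lower_of_ge ((hKcκ.trans hx).trans hxy),
        h.put_lower_of_ge hx, h.put_lower_of_ge (hx.trans hxy)]
      unfold lineEval
      apply le_of_eq; ring
  have hKcle : europeanPut r (L - tc) (lowerLaw μ κ (downMass r tc f)) Kc ≤
      lowerAmerican r tc Aext f Kc := by
    rw [h.american_lower_of_le hKc.le le_rfl, h.put_lower_of_le hKcκ]
    exact mul_le_mul_of_nonneg_left (h.ext.european_le Kc hKc.le) hi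
  refine ⟨h.node.rate_pos, sub_pos.2 h.step.tc_lt, hlaw, hpoly, ?_, hleg, ?_, ?_, ?_⟩
  · rw [h.american_lower_of_le le_rfl hKc.le, h.ext_zero, mul_zero]
  · intro K hK
    rcases le_total K Kc with h1 | h1
    · rw [h.american_lower_of_le hK h1, h.put_lower_of_le (h1.trans hKcκ)]
      exact mul_le_mul_of_nonneg_left (h.ext.european_le K hK) hi
    · have e1 := (mul_nonneg (sub_nonneg.2 hKcle) hK).trans (hleg Kc K hKc h1)
      exact sub_nonneg.1 (nonneg_of_mul_nonneg_left e1 hKc)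
  · intro K hK
    have e1 : K - downSpot f = f.1⁻¹ * lineEval f K := by
      rw [downSpot, lineEval]; field_simp
    rw [e1]
    rcases le_total K Kc with h1 | h1
    · rw [h.american_lower_of_le hK h1]
      exact mul_le_mul_of_nonneg_left (h.piece_le hK) hi
    · rw [h.american_lower_of_ge h1]
  · intro K hK
    have hlam := Real.exp_pos (r * (L - tc))
    rcases le_total K Kc with h1 | h1
    · rw [h.american_lower_of_le hK h1, h.put_lower_of_le]
      · exact mul_le_mul_of_nonneg_left (h.ext_le_upper hK) hi
      · rw [← h.lam_mul]; exact mul_le_mul_of_nonneg_left h1 hlam.le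
    · rw [h.american_lower_of_ge h1, h.put_lower_of_ge]
      · rw [← mul_assoc, ← Real.exp_add]; simp
      · rw [← h.lam_mul]; exact mul_le_mul_of_nonneg_left h1 hlam.le

theorem scale_pos (h : SplitNode r L s μ A Aext Kt Kp g c tc Kc κ f) :
    0 < Real.exp (r * tc) / (1 - downMass r tc f) :=
  div_pos (Real.exp_pos _) (sub_pos.2 h.downMass_lt)

theorem scale_mul (h : SplitNode r L s μ A Aext Kt Kp g c tc Kc κ f) :
    Real.exp (r * tc) / (1 - downMass r tc f) * (Real.exp (-(r * tc)) - f.1) = 1 := by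
  have hX : Real.exp (r * tc) * Real.exp (-(r * tc)) = 1 := by rw [← Real.exp_add]; simp
  have hp1 : 1 - downMass r tc f ≠ 0 := (sub_pos.2 h.downMass_lt).ne'
  rw [div_mul_eq_mul_div, div_eq_one_iff_eq hp1, mul_sub, hX, downMass]

/-- Subtracting `f` from the exercise line and rescaling to slope `1` gives the exercise line of the
upper node. -/
theorem intrinsic_upper (h : SplitNode r L s μ A Aext Kt Kp g c tc Kc κ f) (K : ℝ) :
    K - upSpot r s tc f = Real.exp (r * tc) / (1 - downMass r tc f) *
      (lineEval (Real.exp (-(r * tc)), s) K - lineEval f K) := by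
  have h1 := h.scale_mul
  have h2 : upSpot r s tc f = Real.exp (r * tc) / (1 - downMass r tc f) * (s - f.2) := by
    rw [upSpot, downMass, downSpot, div_mul_eq_mul_div]
    congr 1
    field_simp [h.slope_pos.ne']
  rw [h2]
  simp only [lineEval]
  linear_combination (-K) * h1

theorem ext_max_le_upper (h : SplitNode r L s μ A Aext Kt Kp g c tc Kc κ f) {K : ℝ} (hK : 0 ≤ K) :
    max (Aext K) (lineEval (Real.exp (-(r * tc)), s) K) ≤
      europeanPut r L μ (Real.exp (r * (L - tc)) * K) :=
  max_le (h.ext_le_upper hK) (h.exercise_le_upper K)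

theorem american_upper_nonneg (h : SplitNode r L s μ A Aext Kt Kp g c tc Kc κ f) {K : ℝ}
    (hK : 0 ≤ K) : 0 ≤ upperAmerican r s tc Aext f K := by
  rcases le_total K Kc with h1 | h1
  · rw [h.american_upper_of_le h1]
  · rw [h.american_upper_of_ge h1]
    exact mul_nonneg h.scale_pos.le (sub_nonneg.2 ((h.piece_le hK).trans (le_max_left _ _)))

theorem node_upper (h : SplitNode r L s μ A Aext Kt Kp g c tc Kc κ f) :
    Node r (L - tc) (upSpot r s tc f) (upperLaw μ κ (downMass r tc f))
      (upperAmerican r s tc Aext f) := by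
  have hC := h.scale_pos
  have hKc := h.Kc_pos
  have hKcκ := h.Kc_le
  have hκ := h.step.atom_pos
  have hlaw := h.isLaw_upper
  have hzero : upperAmerican r s tc Aext f 0 = 0 := h.american_upper_of_le hKc.le
  have hpoly : Polyhedral (upperAmerican r s tc Aext f) := by
    have h1 : Polyhedral (fun K => max (Aext K) (lineEval (Real.exp (-(r * tc)), s) K) -
        lineEval f K) := by
      refine ((h.ext.polyhedral.max (polyhedral_lineEval (Real.exp (-(r * tc)), s))).add
        (polyhedral_lineEval (-f.1, -f.2))).congr fun K _ => ?_
      simp only [lineEval]; ring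
    have h2 := h1.const_mul hC.le
    refine Polyhedral.glue (l := (0, 0)) hKc.le polyhedral_zero h2 (by simp [lineEval]) ?_
      (fun K _ _ => by simp [lineEval]) (fun K hK => ?_) (fun K _ hK => h.american_upper_of_le hK)
      (fun K hK => h.american_upper_of_ge hK)
    · rw [h.ext_Kc, max_eq_left (h.exercise_le_piece le_rfl)]
      simp [lineEval]
    · have : lineEval (0, 0) K = 0 := by simp [lineEval]
      rw [this]
      exact mul_nonneg hC.le (sub_nonneg.2
        ((h.piece_le (hKc.le.trans hK)).trans (le_max_left _ _)))
  have hleg : ∀ x y, 0 < x → x ≤ y →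
      (upperAmerican r s tc Aext f x -
        europeanPut r (L - tc) (upperLaw μ κ (downMass r tc f)) x) * y ≤
      (upperAmerican r s tc Aext f y -
        europeanPut r (L - tc) (upperLaw μ κ (downMass r tc f)) y) * x := by
    intro x y hx hxy
    refine glue_div_mono (D := fun K => upperAmerican r s tc Aext f K -
      europeanPut r (L - tc) (upperLaw μ κ (downMass r tc f)) K) (b := κ) (B := y)
      hκ ?_ ?_ hx hxy le_rfl
    · intro x y hx hxy hy
      simp only [h.put_upper_of_le (hxy.trans hy), h.put_upper_of_le hy, sub_zero]
      exact hpoly.div_mono hzero.le hx.le hxy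
    · intro x y hx hxy _
      have hx0 : 0 < x := hκ.trans_le hx
      -- Where the exercise line is active its intercept `s` bounds those of the chords of `E`. The
      -- lines subtracted from the two curves of the upper node have the same intercept, so they
      -- differ by a multiple of the strike and drop out of the comparison.
      have hmax : (max (Aext x) (lineEval (Real.exp (-(r * tc)), s) x) - europeanPut r L μ x) * y ≤
          (max (Aext y) (lineEval (Real.exp (-(r * tc)), s) y) - europeanPut r L μ y) * x := by
        rcases le_total (Aext x) (lineEval (Real.exp (-(r * tc)), s) x) with hm | hm
        · rw [max_eq_right hm]
          have e1 := h.node.law.put_intercept_le hx0.le hxy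
          have e2 := mul_le_mul_of_nonneg_right
            (le_max_right (Aext y) (lineEval (Real.exp (-(r * tc)), s) y)) hx0.le
          generalize max (Aext y) (lineEval (Real.exp (-(r * tc)), s) y) = m at *
          simp only [lineEval] at *
          linarith
        · rw [max_eq_left hm]
          refine (h.ext.legendre x y hx0 hxy).trans ?_
          exact mul_le_mul_of_nonneg_right (sub_le_sub_right (le_max_left _ _) _) hx0.le
      have hmul := mul_le_mul_of_nonneg_left hmax hC.le
      simp only [h.american_upper_of_ge (hKcκ.trans hx),
        h.american_upper_of_ge ((hKcκ.trans hx).trans hxy), h.put_upper_of_ge hx,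
        h.put_upper_of_ge (hx.trans hxy)]
      generalize max (Aext y) (lineEval (Real.exp (-(r * tc)), s) y) = m₁ at *
      generalize max (Aext x) (lineEval (Real.exp (-(r * tc)), s) x) = m₂ at *
      simp only [lineEval] at *
      linarith
  have hEκ : europeanPut r (L - tc) (upperLaw μ κ (downMass r tc f)) κ ≤
      upperAmerican r s tc Aext f κ := by
    rw [h.put_upper_of_le le_rfl]
    exact h.american_upper_nonneg hκ.le
  refine ⟨h.node.rate_pos, sub_pos.2 h.step.tc_lt, hlaw, hpoly, hzero, hleg, ?_, ?_, ?_⟩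
  · intro K hK
    rcases le_total K κ with h1 | h1
    · rw [h.put_upper_of_le h1]
      exact h.american_upper_nonneg hK
    · have e1 := (mul_nonneg (sub_nonneg.2 hEκ) hK).trans (hleg κ K hκ h1)
      exact sub_nonneg.1 (nonneg_of_mul_nonneg_left e1 hκ)
  · intro K hK
    rw [h.intrinsic_upper]
    rcases le_total K Kc with h1 | h1
    · rw [h.american_upper_of_le h1]
      exact mul_nonpos_of_nonneg_of_nonpos hC.le (sub_nonpos.2 (h.exercise_le_piece h1))
    · rw [h.american_upper_of_ge h1]
      exact mul_le_mul_of_nonneg_left (sub_le_sub_right (le_max_right _ _) _) hC.le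
  · intro K hK
    rcases le_total K Kc with h1 | h1
    · rw [h.american_upper_of_le h1]
      exact hlaw.put_nonneg _
    · have hlam := Real.exp_pos (r * (L - tc))
      rw [h.american_upper_of_ge h1, h.put_upper_of_ge
        (by rw [← h.lam_mul]; exact mul_le_mul_of_nonneg_left h1 hlam.le)]
      rw [← mul_assoc (Real.exp (-(r * (L - tc)))), ← Real.exp_add, neg_add_cancel, Real.exp_zero,
        one_mul]
      exact mul_le_mul_of_nonneg_left (sub_le_sub_right (h.ext_max_le_upper hK) _) hC.le

/-- The American prices at the node, in terms of those at its successors. -/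
theorem american_eq (h : SplitNode r L s μ A Aext Kt Kp g c tc Kc κ f) {K : ℝ} (hK : 0 ≤ K) :
    A K = max (max (K - s) 0) (Real.exp (-(r * tc)) * (downMass r tc f *
      lowerAmerican r tc Aext f K + (1 - downMass r tc f) * upperAmerican r s tc Aext f K)) := by
  have hp1 : 1 - downMass r tc f ≠ 0 := (sub_pos.2 h.downMass_lt).ne'
  have hX : Real.exp (-(r * tc)) * Real.exp (r * tc) = 1 := by rw [← Real.exp_add]; simp
  -- The lower curve supplies the extension up to `Kc` and `f` beyond; the upper curve adds there
  -- what lies above `f`. Besides the extension, only the line `e^{-r tc} K - s` appears, which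
  -- immediate exercise dominates.
  have hcont : Real.exp (-(r * tc)) * (downMass r tc f * lowerAmerican r tc Aext f K +
      (1 - downMass r tc f) * upperAmerican r s tc Aext f K) =
      if K ≤ Kc then Aext K else max (Aext K) (lineEval (Real.exp (-(r * tc)), s) K) := by
    rw [mul_add, ← mul_assoc, exp_mul_downMass]
    split_ifs with h1
    · rw [h.american_lower_of_le hK h1, h.american_upper_of_le h1,
        mul_inv_cancel_left₀ h.slope_pos.ne']
      ring
    · rw [h.american_lower_of_ge (not_le.1 h1).le, h.american_upper_of_ge (not_le.1 h1).le,
        mul_inv_cancel_left₀ h.slope_pos.ne', ← mul_assoc (1 - downMass r tc f),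
        mul_div_cancel₀ _ hp1, ← mul_assoc, hX]
      ring
  have hh : lineEval (Real.exp (-(r * tc)), s) K ≤ K - s := by
    have : Real.exp (-(r * tc)) ≤ 1 := Real.exp_le_one_iff.2
      (neg_nonpos.2 (mul_nonneg h.node.rate_pos.le h.step.tc_nonneg))
    have := mul_le_mul_of_nonneg_right this hK
    simp only [lineEval]
    linarith
  have hs := h.node.intrinsic_le K hK
  rw [hcont]
  refine le_antisymm ?_ (max_le (max_le hs (h.node.nonneg hK)) ?_)
  · rcases le_total K Kt with h1 | h1
    · refine le_max_of_le_right ?_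
      rw [← h.ext.eq_A K hK h1]
      split_ifs
      · exact le_rfl
      · exact le_max_left _ _
    · exact le_max_of_le_left ((h.ext.exercise K h1).le.trans (le_max_left _ _))
  · split_ifs
    · exact h.ext.le_A K hK
    · exact max_le (h.ext.le_A K hK) (hh.trans hs)

end SplitNode

/-! ### Termination -/

/-- The pieces of `F`, except the one of slope `1`, that are not tied to `E`. -/
def freePieces (F E : ℝ → ℝ) : Set (ℝ × ℝ) := {f | IsPiece F f ∧ f.1 < 1 ∧ ¬ Bound F E f}

theorem Polyhedral.finite_freePieces {F : ℝ → ℝ} (hF : Polyhedral F) (E : ℝ → ℝ) :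
    (freePieces F E).Finite :=
  hF.finite_pieces.subset fun _ hf => hf.1

namespace SplitNode

variable {r L s : ℝ} {μ : ℝ →₀ ℝ} {A Aext : ℝ → ℝ} {Kt Kp c tc Kc κ : ℝ} {g f : ℝ × ℝ}

theorem piece_mem_free (h : SplitNode r L s μ A Aext Kt Kp g c tc Kc κ f) :
    f ∈ freePieces A (europeanPut r L μ) := by
  obtain ⟨hfg, hf⟩ := h.piece_left
  exact ⟨h.ext.isPiece_of_left h.slope_pos hf, hfg.trans_lt h.ext.slope_lt, fun hb =>
    h.not_bound ((h.ext.bound_iff hf).1 hb)⟩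

/-- The extension adds only bound pieces, so its free pieces were already free in `A`. -/
theorem mem_free_of_not_bound (h : SplitNode r L s μ A Aext Kt Kp g c tc Kc κ f) {v : ℝ × ℝ}
    (hv : IsPiece Aext v) (hb : ¬ Bound Aext (europeanPut r L μ) v) :
    v ∈ freePieces A (europeanPut r L μ) := by
  obtain ⟨hvg, hv'⟩ := (h.ext.piece_cases hv).resolve_right fun h' => hb h'.1
  exact ⟨h.ext.isPiece_of_left hv.1 hv', hvg.trans_lt h.ext.slope_lt, fun hb' =>
    hb ((h.ext.bound_iff hv').1 hb')⟩

/-- Undoing the rescaling embeds the free pieces of the lower node into those of `A` that are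
flatter than `f`. The free piece `f` is missed, having become the exercise line of slope `1`. -/
theorem ncard_free_lower (h : SplitNode r L s μ A Aext Kt Kp g c tc Kc κ f) :
    (freePieces (lowerAmerican r tc Aext f)
      (europeanPut r (L - tc) (lowerLaw μ κ (downMass r tc f)))).ncard <
    (freePieces A (europeanPut r L μ)).ncard := by
  have ha := h.slope_pos
  have hlin : ∀ (u : ℝ × ℝ) K, lineEval (f.1 • u) K = f.1 * lineEval u K := by
    intro u K; simp only [lineEval, Prod.smul_fst, Prod.smul_snd, smul_eq_mul]; ring
  have hinj : Function.Injective fun u : ℝ × ℝ => f.1 • u := smul_right_injective _ ha.ne'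
  rw [← Set.ncard_image_of_injective _ hinj]
  refine Set.ncard_lt_ncard ?_ (h.node.polyhedral.finite_freePieces _)
  have hlt : ∀ u ∈ freePieces (lowerAmerican r tc Aext f)
      (europeanPut r (L - tc) (lowerLaw μ κ (downMass r tc f))), (f.1 • u).1 < f.1 := by
    intro u hu
    exact mul_lt_of_lt_one_right ha hu.2.1
  rw [Set.ssubset_iff_of_subset]
  · refine ⟨f, h.piece_mem_free, ?_⟩
    rintro ⟨u, hu, huf⟩
    have := hlt u hu
    simp only [huf, lt_irrefl] at this
  rintro _ ⟨u, hu, rfl⟩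
  have hu1 := hlt u hu
  obtain ⟨⟨hu0, α, β, hα, hαβ, huαβ⟩, -, hnb⟩ := hu
  simp only
  have hAu : ∀ K ∈ Set.Icc α β, f.1 * lowerAmerican r tc Aext f K = lineEval (f.1 • u) K :=
    fun K hK => by rw [huαβ K hK, hlin]
  have hαKc : α < Kc := by
    by_contra! hc
    refine hu1.ne (congrArg Prod.fst (lineEval_ext (f := f.1 • u) (g := f) hαβ ?_ ?_))
    · rw [← hAu α ⟨le_rfl, hαβ.le⟩, h.american_lower_of_ge hc, mul_inv_cancel_left₀ ha.ne']
    · rw [← hAu β ⟨hαβ.le, le_rfl⟩, h.american_lower_of_ge (hc.trans hαβ.le),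
        mul_inv_cancel_left₀ ha.ne']
  have hAext : ∀ K ∈ Set.Icc α (min β Kc), Aext K = lineEval (f.1 • u) K := fun K hK => by
    rw [← hAu K ⟨hK.1, hK.2.trans (min_le_left _ _)⟩,
      h.american_lower_of_le (hα.trans hK.1) (hK.2.trans (min_le_right _ _)),
      mul_inv_cancel_left₀ ha.ne']
  refine h.mem_free_of_not_bound ⟨mul_pos ha hu0, α, min β Kc, hα, lt_min hαβ hαKc, hAext⟩ ?_
  rintro ⟨x, y, c', hx, hxy, e1, e2, e3⟩
  refine hnb ?_
  have hxα : x ≤ α := by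
    by_contra! hc
    exact absurd (hAext α ⟨le_rfl, le_min hαβ.le hαKc.le⟩) (e2 α hα hc).ne'
  have hxKc : x < Kc := hxα.trans_lt hαKc
  have hxκ : x < κ := hxKc.trans_le h.Kc_le
  refine ⟨x, min y κ, f.1⁻¹ * c', hx, lt_min hxy hxκ, ?_, fun K hK hKx => ?_, fun K hK => ?_⟩
  · rw [h.american_lower_of_le hx.le hxKc.le, e1, hlin, inv_mul_cancel_left₀ ha.ne']
  · rw [h.american_lower_of_le hK (hKx.le.trans hxKc.le), lt_inv_mul_iff₀ ha, ← hlin]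
    exact e2 K hK hKx
  · rw [h.put_lower_of_le (hK.2.trans (min_le_right _ _)),
      e3 K ⟨hK.1, hK.2.trans (min_le_left _ _)⟩, hlin, mul_sub, inv_mul_cancel_left₀ ha.ne']
    ring

/-- Undoing the rescaling and the subtraction of `f` yields pieces of `A` steeper than `f`, so `f`
is missed. Below `κ` the new put price vanishes and retains nothing of `E`; that no atom is below
`κ` ensures that a piece tied to `E` remains tied to the new price. -/
theorem ncard_free_upper (h : SplitNode r L s μ A Aext Kt Kp g c tc Kc κ f)
    (hmin : ∀ k ∈ μ.support, κ ≤ k) :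
    (freePieces (upperAmerican r s tc Aext f)
      (europeanPut r (L - tc) (upperLaw μ κ (downMass r tc f)))).ncard <
    (freePieces A (europeanPut r L μ)).ncard := by
  have hC := h.scale_pos
  have hCm := h.scale_mul
  have hKc := h.Kc_pos
  have hKcκ : Kc < κ := by
    rw [← h.lam_mul]; exact lt_mul_of_one_lt_left hKc h.lam_gt_one
  have hupper := fun K => h.american_upper_of_ge (K := K)
  have hput := fun K => h.put_upper_of_ge (K := K)
  set C := Real.exp (r * tc) / (1 - downMass r tc f) with hCdef
  set H : ℝ × ℝ := (Real.exp (-(r * tc)), s) with hH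
  have hlin : ∀ (u : ℝ × ℝ) K, lineEval (C⁻¹ • u + f) K = C⁻¹ * lineEval u K + lineEval f K := by
    intro u K
    simp only [lineEval, Prod.smul_fst, Prod.smul_snd, smul_eq_mul, Prod.fst_add, Prod.snd_add]
    ring
  have hlin' : ∀ (u : ℝ × ℝ) K, lineEval u K = C * (lineEval (C⁻¹ • u + f) K - lineEval f K) := by
    intro u K
    rw [hlin, add_sub_cancel_right, mul_inv_cancel_left₀ hC.ne']
  have hinj : Function.Injective fun u : ℝ × ℝ => C⁻¹ • u + f :=
    (add_left_injective f).comp (smul_right_injective _ (inv_pos.2 hC).ne')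
  rw [← Set.ncard_image_of_injective _ hinj]
  refine Set.ncard_lt_ncard ?_ (h.node.polyhedral.finite_freePieces _)
  have hgt : ∀ u ∈ freePieces (upperAmerican r s tc Aext f)
      (europeanPut r (L - tc) (upperLaw μ κ (downMass r tc f))), f.1 < (C⁻¹ • u + f).1 := by
    intro u hu
    exact lt_add_of_pos_left _ (mul_pos (inv_pos.2 hC) hu.1.1)
  rw [Set.ssubset_iff_of_subset]
  · refine ⟨f, h.piece_mem_free, ?_⟩
    rintro ⟨u, hu, huf⟩
    have := hgt u hu
    simp only [huf, lt_irrefl] at this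
  rintro _ ⟨u, hu, rfl⟩
  have hv1 := hgt u hu
  obtain ⟨⟨hu0, α, β, hα, hαβ, huαβ⟩, hu1, hnb⟩ := hu
  simp only
  have huv := hlin' u
  set v : ℝ × ℝ := C⁻¹ • u + f with hv
  -- Slopes below `1` at the upper node correspond to slopes below `e^{-r tc}`. Hence `v` is
  -- strictly above the exercise line before `β` and must be a piece of the extension.
  have hvH : v.1 < H.1 := by
    have e1 : C⁻¹ = Real.exp (-(r * tc)) - f.1 := inv_eq_of_mul_eq_one_right hCm
    have e2 : C⁻¹ * u.1 < C⁻¹ := mul_lt_of_lt_one_right (inv_pos.2 hC) hu1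
    have e3 : v.1 = C⁻¹ * u.1 + f.1 := rfl
    have e4 : H.1 = Real.exp (-(r * tc)) := rfl
    linarith
  have hβKc : Kc < β := by
    by_contra! hc
    have : u = (0, 0) := by
      refine lineEval_ext hαβ ?_ ?_
      · rw [← huαβ α ⟨le_rfl, hαβ.le⟩, h.american_upper_of_le (hαβ.le.trans hc)]
        simp [lineEval]
      · rw [← huαβ β ⟨hαβ.le, le_rfl⟩, h.american_upper_of_le hc]
        simp [lineEval]
    rw [this] at hu0
    exact lt_irrefl _ hu0
  set α' := max α Kc with hα'
  have hα'β : α' < β := max_lt hαβ hβKc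
  have hα'0 : 0 ≤ α' := hα.trans (le_max_left _ _)
  have hmax : ∀ K ∈ Set.Icc α' β, max (Aext K) (lineEval H K) = lineEval v K := fun K hK => by
    have e1 := huαβ K ⟨(le_max_left _ _).trans hK.1, hK.2⟩
    rw [hupper K ((le_max_right _ _).trans hK.1), huv K] at e1
    have := mul_left_cancel₀ hC.ne' e1
    linarith
  have hHv : ∀ K, K < β → lineEval H K < lineEval v K := fun K hK => by
    have e1 : lineEval H β ≤ lineEval v β := by
      rw [← hmax β ⟨hα'β.le, le_rfl⟩]; exact le_max_right _ _
    unfold lineEval at *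
    nlinarith [mul_lt_mul_of_pos_right hvH (sub_pos.2 hK)]
  have hAext : ∀ K ∈ Set.Icc α' ((α' + β) / 2), Aext K = lineEval v K := fun K hK => by
    have hKβ : K < β := by linarith [hK.2]
    rcases max_choice (Aext K) (lineEval H K) with h1 | h1
    · rw [← hmax K ⟨hK.1, hKβ.le⟩, h1]
    · have := hmax K ⟨hK.1, hKβ.le⟩
      rw [h1] at this
      exact absurd this (hHv K hKβ).ne
  have hpv : IsPiece Aext v :=
    ⟨h.slope_pos.trans hv1, α', (α' + β) / 2, hα'0, by linarith, hAext⟩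
  refine h.mem_free_of_not_bound hpv ?_
  rintro ⟨x, y, c', hx, hxy, e1, e2, e3⟩
  refine hnb ?_
  have hxα : x ≤ α' := by
    by_contra! hc
    exact absurd (hAext α' ⟨le_rfl, by linarith⟩) (e2 α' hα'0 hc).ne'
  have hvKc : lineEval v Kc ≤ lineEval f Kc := by
    rw [← h.ext_Kc]; exact h.ext.polyhedral.lineEval_le_of_isPiece hpv hKc.le
  -- Below the smallest atom `E` vanishes, so a line tied to it there would pass through the origin.
  -- But `v` is steeper than `f` and at most `f` at `Kc`, so its intercept exceeds `f.2 ≥ 0`.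
  have hκx : κ ≤ x := by
    by_contra! hc
    have e4 : ∀ K ≤ κ, europeanPut r L μ K = 0 := fun K hK =>
      h.node.law.put_eq_zero fun k hk => hK.trans (hmin k hk)
    have e5 : v = (c', 0) := by
      refine lineEval_ext (lt_min hxy hc) ?_ ?_
      · have := e3 x ⟨le_rfl, hxy.le⟩
        rw [e4 x hc.le] at this
        simp only [lineEval] at *
        linarith
      · have := e3 (min y κ) ⟨le_min hxy.le hc.le, min_le_left _ _⟩
        rw [e4 _ (min_le_right _ _)] at this
        simp only [lineEval] at *
        linarith
    have e6 : v.2 = 0 := by rw [e5]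
    have e7 := mul_lt_mul_of_pos_right hv1 hKc
    have e8 := h.intercept_nonneg
    unfold lineEval at hvKc
    linarith
  have hKcx : Kc < x := hKcκ.trans_le hκx
  have hvKc' : lineEval v Kc < lineEval f Kc := by
    rw [← h.ext_Kc]; exact e2 Kc hKc.le hKcx
  refine ⟨x, y, C * (c' + f.1 * Real.exp (-(r * (L - tc))) - f.1), hx, hxy, ?_,
    fun K hK hKx => ?_, fun K hK => ?_⟩
  · rw [hupper x hKcx.le, e1, max_eq_left (hHv x (hxα.trans_lt hα'β)).le, ← huv]
  · rw [huv K]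
    rcases le_total K Kc with h1 | h1
    · rw [h.american_upper_of_le h1]
      refine mul_neg_of_pos_of_neg hC (sub_neg.2 ?_)
      unfold lineEval at *
      nlinarith [mul_le_mul_of_nonneg_right hv1.le (sub_nonneg.2 h1)]
    · rw [hupper K h1]
      refine mul_lt_mul_of_pos_left (sub_lt_sub_right ?_ _) hC
      exact (e2 K hK hKx).trans_le (le_max_left _ _)
  · rw [hput K (hκx.trans hK.1), e3 K hK, huv K]
    unfold lineEval
    ring

theorem card_support_lower (h : SplitNode r L s μ A Aext Kt Kp g c tc Kc κ f) :
    (lowerLaw μ κ (downMass r tc f)).support.card ≤ μ.support.card :=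
  Finset.card_le_card fun _ hk => (lowerLaw_support h.step.atom hk).1

theorem card_support_upper (h : SplitNode r L s μ A Aext Kt Kp g c tc Kc κ f) :
    (upperLaw μ κ (downMass r tc f)).support.card ≤ μ.support.card :=
  Finset.card_le_card fun _ hk => (upperLaw_support h.step.atom hk).1

theorem card_support_upper_lt (h : SplitNode r L s μ A Aext Kt Kp g c tc Kc κ f)
    (hk : ∃ k ∈ μ.support, k < κ) :
    (upperLaw μ κ (downMass r tc f)).support.card < μ.support.card := by
  obtain ⟨k, hk, hkκ⟩ := hk
  refine Finset.card_lt_card (Finset.ssubset_iff_of_subset (fun _ hk =>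
    (upperLaw_support h.step.atom hk).1) |>.2 ⟨k, hk, fun hk' => ?_⟩)
  exact absurd (upperLaw_support h.step.atom hk').2 (not_le.2 hkκ)

end SplitNode

end AmericanPut

namespace AmericanPut

open Filter Topology

/-! ### Trees produced by the algorithm -/

/-- The relations between the prices, laws and American prices at the nodes of a price tree that
are used in the analysis of the market model. -/
inductive IsModel (r T : ℝ) : ℝ → ℝ → (ℝ →₀ ℝ) → (ℝ → ℝ) → PriceTree → Prop
  | embed (t s : ℝ) (μ : ℝ →₀ ℝ) (A : ℝ → ℝ) (ht : t < T) (law : IsLaw r (T - t) s μ)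
      (trivial_picture : IsTrivial r (T - t) s μ A) : IsModel r T t s μ A (PriceTree.embed t s μ)
  | split (t s : ℝ) (μ : ℝ →₀ ℝ) (A : ℝ → ℝ) (t' p κ s₁ : ℝ) (μ₁ : ℝ →₀ ℝ) (A₁ : ℝ → ℝ) (s₂ : ℝ)
      (μ₂ : ℝ →₀ ℝ) (A₂ : ℝ → ℝ) (d u : PriceTree) (ht : t ≤ t') (hp : 0 < p) (hp1 : p < 1)
      (law : IsLaw r (T - t) s μ)
      (law_split : ∀ φ, expect μ φ = p * expect μ₁ φ + (1 - p) * expect μ₂ φ)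
      (support₁ : ∀ k ∈ μ₁.support, k ∈ μ.support ∧ k ≤ κ)
      (support₂ : ∀ k ∈ μ₂.support, k ∈ μ.support ∧ κ ≤ k)
      (american : ∀ K, 0 ≤ K → A K = max (max (K - s) 0)
        (Real.exp (-(r * (t' - t))) * (p * A₁ K + (1 - p) * A₂ K)))
      (down : IsModel r T t' s₁ μ₁ A₁ d) (up : IsModel r T t' s₂ μ₂ A₂ u) :
      IsModel r T t s μ A (PriceTree.split t s t' p d u)

/-- The algorithm terminates. -/
theorem Node.exists_tree {r T : ℝ} (N : ℕ ×ₗ ℕ) :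
    ∀ (t s : ℝ) (μ : ℝ →₀ ℝ) (A : ℝ → ℝ), Node r (T - t) s μ A →
      toLex (μ.support.card, (freePieces A (europeanPut r (T - t) μ)).ncard) = N →
      ∃ M, Builds r T t s μ A M ∧ IsModel r T t s μ A M := by
  induction N using WellFoundedLT.induction with
  | ind N ih =>
    intro t s μ A hnode hN
    by_cases htriv : IsTrivial r (T - t) s μ A
    · exact ⟨_, Builds.embed t s μ A htriv,
        IsModel.embed t s μ A (sub_pos.1 hnode.length_pos) hnode.law htriv⟩
    obtain ⟨Aext, Kt, Kp, g, c, hext, hisext⟩ := hnode.exists_extended htriv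
    obtain ⟨tc, Kc, κ, f, hstep, h1, h2, h3⟩ := hnode.exists_step htriv hext
    have h : SplitNode r (T - t) s μ A Aext Kt Kp g c tc Kc κ f :=
      ⟨hnode, hext, hstep⟩
    have hsub : T - (t + tc) = T - t - tc := by ring
    have hκ : Kc * Real.exp (r * (T - (t + tc))) = κ := by
      rw [hsub, mul_comm]; exact h.lam_mul
    have hdn := h.node_lower
    rw [← hsub] at hdn
    obtain ⟨d, hd, hd'⟩ := ih _ (by
      rw [← hN, hsub, Prod.Lex.toLex_lt_toLex]
      rcases h.card_support_lower.lt_or_eq with hlt | heq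
      · exact Or.inl hlt
      · exact Or.inr ⟨heq, h.ncard_free_lower⟩) (t + tc) _ _ _ hdn rfl
    have hun := h.node_upper
    rw [← hsub] at hun
    obtain ⟨u, hu, hu'⟩ := ih _ (by
      rw [← hN, hsub, Prod.Lex.toLex_lt_toLex]
      -- Atoms below `κ` are lost to the upper node. If there are none, `κ` is the smallest atom and
      -- the count of free pieces drops instead.
      by_cases hk : ∃ k ∈ μ.support, k < κ
      · exact Or.inl (h.card_support_upper_lt hk)
      · push Not at hk
        rcases h.card_support_upper.lt_or_eq with hlt | heq
        · exact Or.inl hlt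
        · exact Or.inr ⟨heq, h.ncard_free_upper hk⟩) (t + tc) _ _ _ hun rfl
    refine ⟨PriceTree.split t s (t + tc) (downMass r tc f) d u, ?_, ?_⟩
    · refine Builds.split t s μ A Aext Kp tc Kc f d u htriv hisext h1 h2 h3 ?_ ?_
      · rw [hκ]; exact hd
      · rw [hκ]; exact hu
    · refine IsModel.split t s μ A (t + tc) _ κ _ _ _ _ _ _ d u
        (le_add_of_nonneg_right hstep.tc_nonneg) h.downMass_pos h.downMass_lt hnode.law
        (fun φ => expect_split μ h.downMass_pos.ne' (sub_pos.2 h.downMass_lt).ne' φ)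
        (fun k hk => lowerLaw_support hstep.atom hk) (fun k hk => upperLaw_support hstep.atom hk)
        (fun K hK => ?_) hd' hu'
      rw [add_sub_cancel_left]
      exact h.american_eq hK

end AmericanPut

namespace AmericanPut

open Filter Topology

namespace PriceTree

/-! ### Expectations over the outcomes of a tree -/

noncomputable instance instFintypeOutcome : (M : PriceTree) → Fintype M.Outcome
  | embed _ _ μ => inferInstanceAs (Fintype {k : ℝ // k ∈ μ.support})
  | split _ _ _ _ d u =>
    letI := instFintypeOutcome d
    letI := instFintypeOutcome u
    inferInstanceAs (Fintype (d.Outcome ⊕ u.Outcome))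

/-- An outcome of the lower subtree. -/
def toDown {t s t' p : ℝ} {d u : PriceTree} (ω : d.Outcome) : (split t s t' p d u).Outcome :=
  Sum.inl ω

/-- An outcome of the upper subtree. -/
def toUp {t s t' p : ℝ} {d u : PriceTree} (ω : u.Outcome) : (split t s t' p d u).Outcome :=
  Sum.inr ω

theorem forall_outcome {t s t' p : ℝ} {d u : PriceTree} {P : (split t s t' p d u).Outcome → Prop}
    (hd : ∀ ω : d.Outcome, P (toDown ω)) (hu : ∀ ω : u.Outcome, P (toUp ω)) (ω) : P ω := by
  rcases ω with ω | ω
  exacts [hd ω, hu ω]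

/-- The expectation of a function of the outcome. -/
noncomputable def wsum (M : PriceTree) (φ : M.Outcome → ℝ) : ℝ := ∑ ω, M.weight ω * φ ω

theorem wsum_embed (t s : ℝ) (μ : ℝ →₀ ℝ) (ψ : ℝ → ℝ) :
    wsum (embed t s μ) (fun x => ψ x.1) = expect μ ψ := by
  rw [expect_eq_sum]
  exact Finset.sum_coe_sort μ.support (fun k => μ k * ψ k)

theorem wsum_split (t s t' p : ℝ) (d u : PriceTree) (φ : (split t s t' p d u).Outcome → ℝ) :
    wsum (split t s t' p d u) φ = p * wsum d (fun ω => φ (toDown ω)) +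
      (1 - p) * wsum u (fun ω => φ (toUp ω)) := by
  refine (Fintype.sum_sum_type (α₁ := d.Outcome) (α₂ := u.Outcome) _).trans ?_
  simp only [wsum, Finset.mul_sum, ← mul_assoc]
  rfl

theorem wsum_add (M : PriceTree) (φ ψ : M.Outcome → ℝ) :
    M.wsum (fun ω => φ ω + ψ ω) = M.wsum φ + M.wsum ψ := by
  simp only [wsum, mul_add, Finset.sum_add_distrib]

theorem wsum_const_mul (M : PriceTree) (c : ℝ) (φ : M.Outcome → ℝ) :
    M.wsum (fun ω => c * φ ω) = c * M.wsum φ := by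
  simp only [wsum, Finset.mul_sum]
  exact Finset.sum_congr rfl fun ω _ => by ring

theorem wsum_sub (M : PriceTree) (φ ψ : M.Outcome → ℝ) :
    M.wsum (fun ω => φ ω - ψ ω) = M.wsum φ - M.wsum ψ := by
  simp only [wsum, mul_sub, Finset.sum_sub_distrib]

theorem wsum_sum (M : PriceTree) {ι : Type*} (S : Finset ι) (φ : ι → M.Outcome → ℝ) :
    M.wsum (fun ω => ∑ i ∈ S, φ i ω) = ∑ i ∈ S, M.wsum (φ i) := by
  simp only [wsum, Finset.mul_sum]
  exact Finset.sum_comm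

/-- The time of the first jump. -/
def firstJump (T : ℝ) : PriceTree → ℝ
  | embed _ _ _ => T
  | split _ _ t' _ _ _ => t'

/-- The price paths of two outcomes agree up to time `v`. -/
def Agree (r T : ℝ) (M : PriceTree) (v : ℝ) (ω ω' : M.Outcome) : Prop :=
  ∀ w, 0 ≤ w → w ≤ v → M.branchPrice r T w ω = M.branchPrice r T w ω'

/-- A random time that is determined by the price path up to this time. -/
def Adapted (r T : ℝ) (M : PriceTree) (τ : M.Outcome → ℝ) : Prop :=
  ∀ ω ω', Agree r T M (τ ω) ω ω' → τ ω' = τ ω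

theorem Agree.mono {r T : ℝ} {M : PriceTree} {v w : ℝ} {ω ω' : M.Outcome} (h : Agree r T M v ω ω')
    (hw : w ≤ v) : Agree r T M w ω ω' := fun x hx hxw => h x hx (hxw.trans hw)

theorem branchPrice_of_lt (r : ℝ) {T : ℝ} {M : PriceTree} {v : ℝ} (hv : v < M.firstJump T) :
    ∃ t s, ∀ (ω : M.Outcome) (w : ℝ), w ≤ v → M.branchPrice r T w ω = s * Real.exp (r * (w - t)) := by
  cases M with
  | embed t s μ => exact ⟨t, s, fun ω w hw => if_pos (hw.trans_lt hv)⟩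
  | split t s t' p d u =>
    refine ⟨t, s, fun ω w hw => ?_⟩
    rcases ω with ω | ω
    · exact if_pos (hw.trans_lt hv)
    · exact if_pos (hw.trans_lt hv)

theorem agree_of_lt (r : ℝ) {T : ℝ} {M : PriceTree} {v : ℝ} (hv : v < M.firstJump T)
    (ω ω' : M.Outcome) : Agree r T M v ω ω' := by
  obtain ⟨t, s, h⟩ := branchPrice_of_lt r hv
  intro w _ hw
  rw [h ω w hw, h ω' w hw]

section Split

variable {r T t s t' p : ℝ} {d u : PriceTree}

theorem branchPrice_toDown {v : ℝ} (hv : t' ≤ v) (ω : d.Outcome) :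
    (split t s t' p d u).branchPrice r T v (toDown ω) = d.branchPrice r T v ω :=
  if_neg (not_lt.2 hv)

theorem branchPrice_toUp {v : ℝ} (hv : t' ≤ v) (ω : u.Outcome) :
    (split t s t' p d u).branchPrice r T v (toUp ω) = u.branchPrice r T v ω :=
  if_neg (not_lt.2 hv)

theorem Agree.toDown {v : ℝ} {ω ω' : d.Outcome} (h : Agree r T d v ω ω') :
    Agree r T (split t s t' p d u) v (toDown ω) (toDown ω') := by
  intro w hw hwv
  rcases lt_or_ge w t' with h1 | h1
  · exact agree_of_lt (M := split t s t' p d u) r h1 _ _ w hw le_rfl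
  · rw [branchPrice_toDown h1, branchPrice_toDown h1]; exact h w hw hwv

theorem Agree.toUp {v : ℝ} {ω ω' : u.Outcome} (h : Agree r T u v ω ω') :
    Agree r T (split t s t' p d u) v (toUp ω) (toUp ω') := by
  intro w hw hwv
  rcases lt_or_ge w t' with h1 | h1
  · exact agree_of_lt (M := split t s t' p d u) r h1 _ _ w hw le_rfl
  · rw [branchPrice_toUp h1, branchPrice_toUp h1]; exact h w hw hwv

end Split

end PriceTree

open PriceTree

/-! ### Expected prices and the value of exercise rules in a tree. -/

namespace IsModel

variable {r T t s : ℝ} {μ : ℝ →₀ ℝ} {A : ℝ → ℝ} {M : PriceTree}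

theorem isLaw (h : IsModel r T t s μ A M) : IsLaw r (T - t) s μ := by
  cases h <;> assumption

theorem le_firstJump (h : IsModel r T t s μ A M) : t ≤ M.firstJump T := by
  cases h with
  | embed _ _ _ _ ht => exact ht.le
  | split _ _ _ _ _ _ _ _ _ _ _ _ _ _ _ ht => exact ht

theorem lt_maturity (h : IsModel r T t s μ A M) : t < T := by
  induction h with
  | embed _ _ _ _ ht => exact ht
  | split _ _ _ _ _ _ _ _ _ _ _ _ _ _ _ ht _ _ _ _ _ _ _ _ _ ih => exact ht.trans_lt ih

theorem weight_nonneg (h : IsModel r T t s μ A M) (ω : M.Outcome) : 0 ≤ M.weight ω := by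
  induction h with
  | embed _ _ _ _ _ law => exact law.nonneg _
  | split _ _ _ _ _ p _ _ _ _ _ _ _ _ _ _ hp hp1 _ _ _ _ _ _ _ ih1 ih2 =>
    rcases ω with ω | ω
    · exact mul_nonneg hp.le (ih1 ω)
    · exact mul_nonneg (sub_pos.2 hp1).le (ih2 ω)

theorem wsum_one (h : IsModel r T t s μ A M) : M.wsum (fun _ => 1) = 1 := by
  induction h with
  | embed t s μ _ _ law => exact (wsum_embed t s μ fun _ => 1).trans law.mass
  | split _ _ _ _ _ p _ _ _ _ _ _ _ _ _ _ _ _ _ _ _ _ _ _ _ ih1 ih2 =>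
    rw [wsum_split, ih1, ih2]; ring

theorem wsum_const (h : IsModel r T t s μ A M) (c : ℝ) : M.wsum (fun _ => c) = c := by
  have := M.wsum_const_mul c (fun _ => 1)
  rw [h.wsum_one] at this
  simpa using this

theorem wsum_mono (h : IsModel r T t s μ A M) {φ ψ : M.Outcome → ℝ} (hle : ∀ ω, φ ω ≤ ψ ω) :
    M.wsum φ ≤ M.wsum ψ :=
  Finset.sum_le_sum fun ω _ => mul_le_mul_of_nonneg_left (hle ω) (h.weight_nonneg ω)

theorem branchPrice_eq_of_lt (h : IsModel r T t s μ A M) {v : ℝ} (hv : v < M.firstJump T)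
    (ω : M.Outcome) : M.branchPrice r T v ω = s * Real.exp (r * (v - t)) := by
  cases h with
  | embed => exact if_pos hv
  | split => rcases ω with ω | ω <;> exact if_pos hv

theorem intrinsic_le (h : IsModel r T t s μ A M) {K : ℝ} (hK : 0 ≤ K) : max (K - s) 0 ≤ A K := by
  cases h with
  | embed _ _ _ _ _ _ htriv => rw [htriv K hK]; exact le_max_right _ _
  | split _ _ _ _ _ _ _ _ _ _ _ _ _ _ _ _ _ _ _ _ _ _ american =>
    rw [american K hK]; exact le_max_left _ _

/-- Each price is the discounted mean of its law, so the splitting of the law makes the jump a fair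
one. -/
theorem spot_split {t' p s₁ s₂ : ℝ} {μ₁ μ₂ : ℝ →₀ ℝ} (law : IsLaw r (T - t) s μ)
    (law₁ : IsLaw r (T - t') s₁ μ₁) (law₂ : IsLaw r (T - t') s₂ μ₂)
    (hsplit : ∀ φ, expect μ φ = p * expect μ₁ φ + (1 - p) * expect μ₂ φ) :
    Real.exp (-(r * t)) * s =
      p * (Real.exp (-(r * t')) * s₁) + (1 - p) * (Real.exp (-(r * t')) * s₂) := by
  have h1 := hsplit (fun k => k)
  rw [law.mean, law₁.mean, law₂.mean] at h1
  have e1 : ∀ x, Real.exp (r * (T - x)) = Real.exp (r * T) * Real.exp (-(r * x)) := fun x => by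
    rw [← Real.exp_add]; congr 1; ring
  rw [e1, e1] at h1
  refine mul_left_cancel₀ (Real.exp_pos (r * T)).ne' ?_
  linear_combination h1

/-- The discounted price has constant expectation. -/
theorem wsum_discounted (h : IsModel r T t s μ A M) {v : ℝ} (hv : t ≤ v) :
    M.wsum (fun ω => Real.exp (-(r * v)) * M.branchPrice r T v ω) = Real.exp (-(r * t)) * s := by
  induction h with
  | embed t s μ A ht law _ =>
    rw [wsum_const_mul]
    rcases lt_or_ge v T with h1 | h1
    · have := wsum_embed t s μ (fun _ => s * Real.exp (r * (v - t)))
      rw [law.expect_const] at this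
      have e : (PriceTree.embed t s μ).wsum ((PriceTree.embed t s μ).branchPrice r T v) =
        s * Real.exp (r * (v - t)) := by
        rw [← this]; congr 1; funext ω; exact if_pos h1
      rw [e, mul_left_comm, ← Real.exp_add, mul_comm]
      congr 2; ring
    · have := wsum_embed t s μ (fun k => Real.exp (r * (v - T)) * k)
      rw [expect_const_mul, law.mean] at this
      have e : (PriceTree.embed t s μ).wsum ((PriceTree.embed t s μ).branchPrice r T v) =
        Real.exp (r * (v - T)) * (s * Real.exp (r * (T - t))) := by
        rw [← this]; congr 1; funext ω
        exact (if_neg (not_lt.2 h1)).trans (mul_comm _ _)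
      rw [e, mul_left_comm _ s, mul_left_comm _ s, ← Real.exp_add, ← Real.exp_add, mul_comm]
      congr 2; ring
  | split t s μ A t' p κ s₁ μ₁ A₁ s₂ μ₂ A₂ d u ht hp hp1 law hsplit hs1 hs2 ham hd hu ih1 ih2 =>
    rcases lt_or_ge v t' with h1 | h1
    · have hM := IsModel.split t s μ A t' p κ s₁ μ₁ A₁ s₂ μ₂ A₂ d u ht hp hp1 law hsplit hs1 hs2 ham
        hd hu
      have e : (fun ω => Real.exp (-(r * v)) * (PriceTree.split t s t' p d u).branchPrice r T v ω) =
          fun _ => Real.exp (-(r * t)) * s := by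
        funext ω
        rw [hM.branchPrice_eq_of_lt h1, mul_left_comm, ← Real.exp_add, mul_comm]
        congr 2; ring
      rw [e, hM.wsum_const]
    · rw [wsum_split]
      simp only [branchPrice_toDown h1, branchPrice_toUp h1]
      rw [ih1 h1, ih2 h1, spot_split law hd.isLaw hu.isLaw hsplit]

/-- Optional sampling. -/
theorem optional_sampling (h : IsModel r T t s μ A M) {V : ℝ} {τ : M.Outcome → ℝ}
    {H : M.Outcome → ℝ} (hτ : Adapted r T M τ) (hH : ∀ ω ω', Agree r T M (τ ω) ω ω' → H ω' = H ω)
    (ht : ∀ ω, t ≤ τ ω) (hV : ∀ ω, τ ω ≤ V) :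
    M.wsum (fun ω => H ω * (Real.exp (-(r * V)) * M.branchPrice r T V ω)) =
      M.wsum (fun ω => H ω * (Real.exp (-(r * τ ω)) * M.branchPrice r T (τ ω) ω)) := by
  -- All paths agree before the first jump, so a rule that stops there on one outcome is constant,
  -- and so is `H`. Any other rule stops after the jump and restricts to the subtrees.
  have early : ∀ {t s : ℝ} {μ : ℝ →₀ ℝ} {A : ℝ → ℝ} {M : PriceTree} {τ H : M.Outcome → ℝ},
      IsModel r T t s μ A M → Adapted r T M τ → (∀ ω ω', Agree r T M (τ ω) ω ω' → H ω' = H ω) →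
      (∀ ω, t ≤ τ ω) → (∀ ω, τ ω ≤ V) → (∃ ω, τ ω < M.firstJump T) →
      M.wsum (fun ω => H ω * (Real.exp (-(r * V)) * M.branchPrice r T V ω)) =
        M.wsum (fun ω => H ω * (Real.exp (-(r * τ ω)) * M.branchPrice r T (τ ω) ω)) := by
    rintro t s μ A M τ H h hτ hH ht hV ⟨ω₀, hω₀⟩
    have e1 : ∀ ω, τ ω = τ ω₀ := fun ω => hτ ω₀ ω (agree_of_lt r hω₀ _ _)
    have e2 : ∀ ω, H ω = H ω₀ := fun ω => hH ω₀ ω (agree_of_lt r hω₀ _ _)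
    simp only [e1, e2]
    rw [wsum_const_mul M (H ω₀), wsum_const_mul M (H ω₀), h.wsum_discounted (ht ω₀),
      h.wsum_discounted ((ht ω₀).trans (hV ω₀))]
  induction h with
  | embed t s μ A htT law htriv =>
    by_cases hex : ∃ ω, τ ω < (PriceTree.embed t s μ).firstJump T
    · exact early (IsModel.embed t s μ A htT law htriv) hτ hH ht hV hex
    · push Not at hex
      congr 1; funext ω
      have h1 : T ≤ τ ω := hex ω
      have e : ∀ v, T ≤ v → Real.exp (-(r * v)) * (PriceTree.embed t s μ).branchPrice r T v ω =
          ω.1 * Real.exp (-(r * T)) := by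
        intro v hv
        have : (PriceTree.embed t s μ).branchPrice r T v ω = ω.1 * Real.exp (r * (v - T)) :=
          if_neg (not_lt.2 hv)
        rw [this, mul_left_comm, ← Real.exp_add]
        congr 2; ring
      rw [e _ h1, e _ (h1.trans (hV ω))]
  | split t s μ A t' p κ s₁ μ₁ A₁ s₂ μ₂ A₂ d u htt hp hp1 law hsplit hs1 hs2 ham hd hu ih1 ih2 =>
    by_cases hex : ∃ ω, τ ω < (PriceTree.split t s t' p d u).firstJump T
    · exact early (IsModel.split t s μ A t' p κ s₁ μ₁ A₁ s₂ μ₂ A₂ d u htt hp hp1 law hsplit hs1 hs2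
        ham hd hu) hτ hH ht hV hex
    · push Not at hex
      have h1 : ∀ ω, t' ≤ τ ω := hex
      have hV' : ∀ ω, t' ≤ V := fun ω => (h1 ω).trans (hV ω)
      rw [wsum_split, wsum_split]
      congr 2
      · have := ih1 (τ := fun ω => τ (toDown ω)) (H := fun ω => H (toDown ω))
          (fun ω ω' ha => hτ _ _ ha.toDown) (fun ω ω' ha => hH _ _ ha.toDown) (fun ω => h1 _)
          (fun ω => hV _)
        simp only [branchPrice_toDown (h1 _)]
        rw [← this]
        congr 1; funext ω
        rw [branchPrice_toDown (hV' (toDown ω))]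
      · have := ih2 (τ := fun ω => τ (toUp ω)) (H := fun ω => H (toUp ω))
          (fun ω ω' ha => hτ _ _ ha.toUp) (fun ω ω' ha => hH _ _ ha.toUp) (fun ω => h1 _)
          (fun ω => hV _)
        simp only [branchPrice_toUp (h1 _)]
        rw [← this]
        congr 1; funext ω
        rw [branchPrice_toUp (hV' (toUp ω))]

theorem discounted_payoff (r v K x : ℝ) : Real.exp (-(r * v)) * max (K - x) 0 =
    max (Real.exp (-(r * v)) * K - Real.exp (-(r * v)) * x) 0 := by
  rw [mul_max_of_nonneg _ _ (Real.exp_pos _).le, mul_zero, mul_sub]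

theorem embed_price {t s T r : ℝ} {μ : ℝ →₀ ℝ} (K : ℝ) :
    (PriceTree.embed t s μ).wsum (fun ω => Real.exp (-(r * T)) *
      max (K - (PriceTree.embed t s μ).branchPrice r T T ω) 0) =
      Real.exp (-(r * t)) * europeanPut r (T - t) μ K := by
  rw [wsum_const_mul, europeanPut_eq, ← mul_assoc, ← Real.exp_add]
  congr 1
  · congr 1; ring
  · rw [← wsum_embed t s μ]
    congr 1; funext ω
    have : (PriceTree.embed t s μ).branchPrice r T T ω = ω.1 * Real.exp (r * (T - T)) := if_neg (lt_irrefl _)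
    rw [this, sub_self, mul_zero, Real.exp_zero, mul_one]

/-- No stopping rule earns more than the American price. -/
theorem american_upper (h : IsModel r T t s μ A M) (hr : 0 < r) {K : ℝ} (hK : 0 ≤ K)
    {τ : M.Outcome → ℝ} (hτ : Adapted r T M τ) (ht : ∀ ω, t ≤ τ ω) (hT : ∀ ω, τ ω ≤ T) :
    M.wsum (fun ω => Real.exp (-(r * τ ω)) * max (K - M.branchPrice r T (τ ω) ω) 0) ≤
      Real.exp (-(r * t)) * A K := by
  -- Before the first jump the discounted price is constant while the discounted strike decreases,
  -- so waiting earns no more than exercise at `t`.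
  have early : ∀ {t s : ℝ} {μ : ℝ →₀ ℝ} {A : ℝ → ℝ} {M : PriceTree} {τ : M.Outcome → ℝ},
      IsModel r T t s μ A M → Adapted r T M τ → (∀ ω, t ≤ τ ω) → (∃ ω, τ ω < M.firstJump T) →
      M.wsum (fun ω => Real.exp (-(r * τ ω)) * max (K - M.branchPrice r T (τ ω) ω) 0) ≤
      Real.exp (-(r * t)) * A K := by
    rintro t s μ A M τ h hτ ht ⟨ω₀, hω₀⟩
    have e1 : ∀ ω, τ ω = τ ω₀ := fun ω => hτ ω₀ ω (agree_of_lt r hω₀ _ _)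
    simp only [e1, h.branchPrice_eq_of_lt hω₀]
    rw [h.wsum_const]
    refine le_trans ?_ (mul_le_mul_of_nonneg_left (h.intrinsic_le hK) (Real.exp_pos _).le)
    rw [discounted_payoff, discounted_payoff, mul_left_comm, ← Real.exp_add,
      show -(r * τ ω₀) + r * (τ ω₀ - t) = -(r * t) by ring, mul_comm s]
    refine max_le_max (sub_le_sub_right (mul_le_mul_of_nonneg_right ?_ hK) _) le_rfl
    exact Real.exp_le_exp.2 (neg_le_neg (mul_le_mul_of_nonneg_left (ht ω₀) hr.le))
  induction h with
  | embed t s μ A htT law htriv =>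
    by_cases hex : ∃ ω, τ ω < (PriceTree.embed t s μ).firstJump T
    · exact early (IsModel.embed t s μ A htT law htriv) hτ ht hex
    · push Not at hex
      have h1 : ∀ ω, τ ω = T := fun ω => le_antisymm (hT ω) (hex ω)
      simp only [h1]
      rw [embed_price, htriv K hK]
      exact mul_le_mul_of_nonneg_left (le_max_left _ _) (Real.exp_pos _).le
  | split t s μ A t' p κ s₁ μ₁ A₁ s₂ μ₂ A₂ d u htt hp hp1 law hsplit hs1 hs2 ham hd hu ih1 ih2 =>
    by_cases hex : ∃ ω, τ ω < (PriceTree.split t s t' p d u).firstJump T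
    · exact early (IsModel.split t s μ A t' p κ s₁ μ₁ A₁ s₂ μ₂ A₂ d u htt hp hp1 law hsplit hs1 hs2
        ham hd hu) hτ ht hex
    · push Not at hex
      have h1 : ∀ ω, t' ≤ τ ω := hex
      have i1 := ih1 (τ := fun ω => τ (toDown ω)) (fun ω ω' ha => hτ _ _ ha.toDown) (fun ω => h1 _)
        (fun ω => hT _)
      have i2 := ih2 (τ := fun ω => τ (toUp ω)) (fun ω ω' ha => hτ _ _ ha.toUp) (fun ω => h1 _)
        (fun ω => hT _)
      rw [wsum_split]
      simp only [branchPrice_toDown (h1 _), branchPrice_toUp (h1 _)]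
      refine (add_le_add (mul_le_mul_of_nonneg_left i1 hp.le)
        (mul_le_mul_of_nonneg_left i2 (sub_pos.2 hp1).le)).trans ?_
      rw [ham K hK]
      refine le_trans (le_of_eq ?_) (mul_le_mul_of_nonneg_left (le_max_right _ _)
        (Real.exp_pos _).le)
      rw [← mul_assoc (Real.exp (-(r * t))), ← Real.exp_add,
        show -(r * t) + -(r * (t' - t)) = -(r * t') by ring]
      ring

/-- The law of the price at maturity. -/
theorem wsum_terminal (h : IsModel r T t s μ A M) (ψ : ℝ → ℝ) :
    M.wsum (fun ω => ψ (M.branchPrice r T T ω)) = expect μ ψ := by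
  induction h with
  | embed t s μ A htT law htriv =>
    rw [← wsum_embed t s μ]
    congr 1; funext ω
    have : (PriceTree.embed t s μ).branchPrice r T T ω = ω.1 * Real.exp (r * (T - T)) :=
      if_neg (lt_irrefl _)
    rw [this, sub_self, mul_zero, Real.exp_zero, mul_one]
  | split t s μ A t' p κ s₁ μ₁ A₁ s₂ μ₂ A₂ d u htt hp hp1 law hsplit hs1 hs2 ham hd hu ih1 ih2 =>
    rw [wsum_split, hsplit, ← ih1, ← ih2]
    simp only [branchPrice_toDown hd.lt_maturity.le, branchPrice_toUp hd.lt_maturity.le]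

theorem branchPrice_nonneg (h : IsModel r T t s μ A M) (v : ℝ) (ω : M.Outcome) :
    0 ≤ M.branchPrice r T v ω := by
  induction h with
  | embed t s μ A htT law htriv =>
    unfold branchPrice
    split_ifs
    · exact mul_nonneg law.mean_nonneg (Real.exp_pos _).le
    · exact mul_nonneg (law.atoms _ ω.2) (Real.exp_pos _).le
  | split t s μ A t' p κ s₁ μ₁ A₁ s₂ μ₂ A₂ d u htt hp hp1 law hsplit hs1 hs2 ham hd hu ih1 ih2 =>
    rcases lt_or_ge v t' with h1 | h1
    · rw [(IsModel.split t s μ A t' p κ s₁ μ₁ A₁ s₂ μ₂ A₂ d u htt hp hp1 law hsplit hs1 hs2 ham hd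
        hu).branchPrice_eq_of_lt h1]
      exact mul_nonneg law.mean_nonneg (Real.exp_pos _).le
    · revert ω
      refine forall_outcome (fun ω => ?_) (fun ω => ?_)
      · rw [branchPrice_toDown h1]; exact ih1 ω
      · rw [branchPrice_toUp h1]; exact ih2 ω

end IsModel

/-- Right-continuity recovers the branch price at time `0` from later prices and makes a short delay
of exercise harmless. -/
theorem PriceTree.continuousWithinAt_branchPrice (r T : ℝ) (M : PriceTree) (ω : M.Outcome) (v : ℝ) :
    ContinuousWithinAt (fun w => M.branchPrice r T w ω) (Set.Ici v) v := by
  have key : ∀ {f g : ℝ → ℝ} {b : ℝ}, Continuous f → ContinuousWithinAt g (Set.Ici v) v →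
      ContinuousWithinAt (fun w => if w < b then f w else g w) (Set.Ici v) v := by
    intro f g b hf hg
    rcases lt_or_ge v b with h | h
    · refine hf.continuousWithinAt.congr_of_eventuallyEq ?_ (if_pos h)
      filter_upwards [mem_nhdsWithin_of_mem_nhds (Iio_mem_nhds h)] with w hw using if_pos hw
    · exact hg.congr (fun w hw => if_neg (not_lt.2 (h.trans hw))) (if_neg (not_lt.2 h))
  induction M with
  | embed t s μ => exact key (by fun_prop) (by fun_prop)
  | split t s t' p d u ih1 ih2 =>
    rcases ω with ω | ω
    · exact key (by fun_prop) (ih1 ω)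
    · exact key (by fun_prop) (ih2 ω)

end AmericanPut

namespace AmericanPut

open Filter Topology

open PriceTree

/-! ### Optimal exercise in a price tree -/

theorem IsLaw.expect_gap {r L s : ℝ} {μ : ℝ →₀ ℝ} (h : IsLaw r L s μ) (e κ : ℝ) :
    expect μ (fun k => e * (κ - k)) = e * (κ - s * Real.exp (r * L)) := by
  rw [expect_const_mul, h.expect_affine]

theorem IsLaw.gap_nonneg {r L s : ℝ} {μ : ℝ →₀ ℝ} (h : IsLaw r L s μ) {e κ : ℝ}
    (hκ : ∀ k ∈ μ.support, 0 ≤ e * (κ - k)) : 0 ≤ e * (κ - s * Real.exp (r * L)) := by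
  rw [← h.expect_gap, expect_eq_sum]
  exact Finset.sum_nonneg fun k hk => mul_nonneg (h.nonneg k) (hκ k hk)

/-- A non-negative gap with zero integral vanishes at every atom. The factor `e` handles upper and
lower bounds of the support at once. -/
theorem IsLaw.eq_of_mean_extreme {r L s : ℝ} {μ : ℝ →₀ ℝ} (h : IsLaw r L s μ) {e κ : ℝ}
    (he : e ≠ 0) (hκ : ∀ k ∈ μ.support, 0 ≤ e * (κ - k)) (hmean : s * Real.exp (r * L) = κ) :
    ∀ k ∈ μ.support, k = κ := by
  intro k hk
  have h1 := h.expect_gap e κ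
  rw [hmean, sub_self, mul_zero, expect_eq_sum, Finset.sum_eq_zero_iff_of_nonneg
    fun k hk => mul_nonneg (h.nonneg k) (hκ k hk)] at h1
  have h2 := h1 k hk
  rcases mul_eq_zero.1 h2 with h3 | h3
  · exact absurd h3 (h.pos hk).ne'
  · rcases mul_eq_zero.1 h3 with h4 | h4
    · exact absurd h4 he
    · linarith

theorem exp_shift (r s t T v : ℝ) :
    s * Real.exp (r * (v - t)) = s * Real.exp (r * (T - t)) * Real.exp (r * (v - T)) := by
  rw [mul_assoc, ← Real.exp_add]; congr 2; ring

namespace IsModel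

variable {r T t s : ℝ} {μ : ℝ →₀ ℝ} {A : ℝ → ℝ} {M : PriceTree}

/-- If the law at maturity is degenerate, the price is deterministic. -/
theorem branchPrice_of_degenerate (h : IsModel r T t s μ A M) {κ : ℝ}
    (hκ : ∀ k ∈ μ.support, k = κ) (v : ℝ) (ω : M.Outcome) :
    M.branchPrice r T v ω = κ * Real.exp (r * (v - T)) := by
  have early : ∀ {t s : ℝ} {μ : ℝ →₀ ℝ} {A : ℝ → ℝ} {M : PriceTree} (ω : M.Outcome),
      IsModel r T t s μ A M → (∀ k ∈ μ.support, k = κ) → v < M.firstJump T →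
      M.branchPrice r T v ω = κ * Real.exp (r * (v - T)) := by
    intro t s μ A M ω h hκ hv
    have h1 := h.isLaw.mean
    rw [expect_congr (ψ := fun _ => κ) hκ, h.isLaw.expect_const] at h1
    rw [h.branchPrice_eq_of_lt hv, exp_shift r s t T v, ← h1]
  induction h with
  | embed t s μ A htT law htriv =>
    rcases lt_or_ge v T with h1 | h1
    · exact early ω (IsModel.embed t s μ A htT law htriv) hκ h1
    · have : (PriceTree.embed t s μ).branchPrice r T v ω = ω.1 * Real.exp (r * (v - T)) :=
        if_neg (not_lt.2 h1)
      rw [this, hκ _ ω.2]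
  | split t s μ A t' p κ' s₁ μ₁ A₁ s₂ μ₂ A₂ d u htt hp hp1 law hsplit hs1 hs2 ham hd hu ih1 ih2 =>
    rcases lt_or_ge v t' with h1 | h1
    · exact early ω (IsModel.split t s μ A t' p κ' s₁ μ₁ A₁ s₂ μ₂ A₂ d u htt hp hp1 law hsplit hs1
        hs2 ham hd hu) hκ h1
    · revert ω
      refine forall_outcome (fun ω => ?_) (fun ω => ?_)
      · rw [branchPrice_toDown h1]; exact ih1 (fun k hk => hκ k (hs1 k hk).1) ω
      · rw [branchPrice_toUp h1]; exact ih2 (fun k hk => hκ k (hs2 k hk).1) ω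

/-- A bound for the law at maturity is a bound for the forward price; once it is attained, the
price is deterministic. -/
theorem branchPrice_extreme (h : IsModel r T t s μ A M) {e κ : ℝ} (he : e ≠ 0)
    (hκ : ∀ k ∈ μ.support, 0 ≤ e * (κ - k)) (v : ℝ) (ω : M.Outcome) :
    0 ≤ e * (κ * Real.exp (r * (v - T)) - M.branchPrice r T v ω) ∧
      (M.branchPrice r T v ω = κ * Real.exp (r * (v - T)) → ∀ w, v ≤ w →
        M.branchPrice r T w ω = κ * Real.exp (r * (w - T))) := by
  have early : ∀ {t s : ℝ} {μ : ℝ →₀ ℝ} {A : ℝ → ℝ} {M : PriceTree} (ω : M.Outcome),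
      IsModel r T t s μ A M → (∀ k ∈ μ.support, 0 ≤ e * (κ - k)) → v < M.firstJump T →
      0 ≤ e * (κ * Real.exp (r * (v - T)) - M.branchPrice r T v ω) ∧
      (M.branchPrice r T v ω = κ * Real.exp (r * (v - T)) → ∀ w, v ≤ w →
        M.branchPrice r T w ω = κ * Real.exp (r * (w - T))) := by
    intro t s μ A M ω h hκ hv
    rw [h.branchPrice_eq_of_lt hv, exp_shift r s t T v]
    constructor
    · rw [← sub_mul, ← mul_assoc]
      exact mul_nonneg (h.isLaw.gap_nonneg hκ) (Real.exp_pos _).le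
    · intro heq w _
      exact h.branchPrice_of_degenerate (h.isLaw.eq_of_mean_extreme he hκ
        (mul_right_cancel₀ (Real.exp_pos _).ne' heq)) w ω
  induction h with
  | embed t s μ A htT law htriv =>
    rcases lt_or_ge v T with h1 | h1
    · exact early ω (IsModel.embed t s μ A htT law htriv) hκ h1
    · have hb : ∀ w, T ≤ w →
          (PriceTree.embed t s μ).branchPrice r T w ω = ω.1 * Real.exp (r * (w - T)) :=
        fun w hw => if_neg (not_lt.2 hw)
      rw [hb v h1]
      constructor
      · rw [← sub_mul, ← mul_assoc]
        exact mul_nonneg (hκ _ ω.2) (Real.exp_pos _).le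
      · intro heq w hw
        rw [hb w (h1.trans hw), mul_right_cancel₀ (Real.exp_pos _).ne' heq]
  | split t s μ A t' p κ' s₁ μ₁ A₁ s₂ μ₂ A₂ d u htt hp hp1 law hsplit hs1 hs2 ham hd hu ih1 ih2 =>
    rcases lt_or_ge v t' with h1 | h1
    · exact early ω (IsModel.split t s μ A t' p κ' s₁ μ₁ A₁ s₂ μ₂ A₂ d u htt hp hp1 law hsplit hs1
        hs2 ham hd hu) hκ h1
    · revert ω
      refine forall_outcome (fun ω => ?_) (fun ω => ?_)
      · obtain ⟨i1, i2⟩ := ih1 (fun k hk => hκ k (hs1 k hk).1) ω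
        rw [branchPrice_toDown h1]
        refine ⟨i1, fun heq w hw => ?_⟩
        rw [branchPrice_toDown (h1.trans hw)]
        exact i2 heq w hw
      · obtain ⟨i1, i2⟩ := ih2 (fun k hk => hκ k (hs2 k hk).1) ω
        rw [branchPrice_toUp h1]
        refine ⟨i1, fun heq w hw => ?_⟩
        rw [branchPrice_toUp (h1.trans hw)]
        exact i2 heq w hw

/-- Along a deterministic path the discounted price is constant and the discounted strike decreases,
so early exercise is best. -/
theorem frozen_payoff {r T κ K v w : ℝ} (hr : 0 < r) (hK : 0 ≤ K) (hvw : v ≤ w) :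
    Real.exp (-(r * w)) * max (K - κ * Real.exp (r * (w - T))) 0 ≤
      Real.exp (-(r * v)) * max (K - κ * Real.exp (r * (v - T))) 0 := by
  have e : ∀ x, Real.exp (-(r * x)) * (κ * Real.exp (r * (x - T))) = κ * Real.exp (-(r * T)) := by
    intro x
    rw [mul_left_comm, ← Real.exp_add]; congr 2; ring
  rw [discounted_payoff, discounted_payoff, e, e]
  refine max_le_max (sub_le_sub_right (mul_le_mul_of_nonneg_right ?_ hK) _) le_rfl
  exact Real.exp_le_exp.2 (neg_le_neg (mul_le_mul_of_nonneg_left hvw hr.le))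

theorem adapted_const (r T : ℝ) (M : PriceTree) (v : ℝ) : Adapted r T M (fun _ => v) :=
  fun _ _ _ => rfl

/-- A jump may happen at `t` itself, so the branch price there need not be `s`; Jensen's inequality
gives the bound all the same. -/
theorem intrinsic_attained (h : IsModel r T t s μ A M) (K : ℝ) :
    Real.exp (-(r * t)) * max (K - s) 0 ≤
      M.wsum (fun ω => Real.exp (-(r * t)) * max (K - M.branchPrice r T t ω) 0) := by
  rw [discounted_payoff]
  refine max_le ?_ ?_
  · have h1 := M.wsum_sub (fun _ => Real.exp (-(r * t)) * K)
      (fun ω => Real.exp (-(r * t)) * M.branchPrice r T t ω)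
    rw [h.wsum_const, h.wsum_discounted le_rfl] at h1
    rw [← h1]
    refine h.wsum_mono fun ω => ?_
    rw [discounted_payoff]
    exact le_max_left _ _
  · exact (h.wsum_const 0).ge.trans
      (h.wsum_mono fun ω => mul_nonneg (Real.exp_pos _).le (le_max_right _ _))

/-- The American price is earned by some stopping rule. -/
theorem american_attained (h : IsModel r T t s μ A M) (hr : 0 < r) {K : ℝ} (hK : 0 ≤ K)
    (ht0 : 0 ≤ t) :
    ∃ τ : M.Outcome → ℝ, Adapted r T M τ ∧ (∀ ω, t ≤ τ ω) ∧ (∀ ω, τ ω ≤ T) ∧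
      Real.exp (-(r * t)) * A K ≤
        M.wsum (fun ω => Real.exp (-(r * τ ω)) * max (K - M.branchPrice r T (τ ω) ω) 0) := by
  have early : ∀ {t s : ℝ} {μ : ℝ →₀ ℝ} {A : ℝ → ℝ} {M : PriceTree},
      IsModel r T t s μ A M → A K ≤ max (K - s) 0 →
      ∃ τ : M.Outcome → ℝ, Adapted r T M τ ∧ (∀ ω, t ≤ τ ω) ∧ (∀ ω, τ ω ≤ T) ∧
      Real.exp (-(r * t)) * A K ≤
        M.wsum (fun ω => Real.exp (-(r * τ ω)) * max (K - M.branchPrice r T (τ ω) ω) 0) :=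
    fun {t s μ A M} h hA => ⟨fun _ => t, adapted_const r T M t, fun _ => le_rfl,
      fun _ => h.lt_maturity.le,
      (mul_le_mul_of_nonneg_left hA (Real.exp_pos _).le).trans (h.intrinsic_attained K)⟩
  induction h with
  | embed t s μ A htT law htriv =>
    rcases le_total (europeanPut r (T - t) μ K) (max (K - s) 0) with h1 | h1
    · exact early (IsModel.embed t s μ A htT law htriv) (by rw [htriv K hK, max_eq_right h1])
    · refine ⟨fun _ => T, adapted_const _ _ _ _, fun _ => htT.le, fun _ => le_rfl, ?_⟩
      rw [htriv K hK, max_eq_left h1, embed_price]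
  | split t s μ A t' p κ s₁ μ₁ A₁ s₂ μ₂ A₂ d u htt hp hp1 law hsplit hs1 hs2 ham hd hu ih1 ih2 =>
    rcases le_total (Real.exp (-(r * (t' - t))) * (p * A₁ K + (1 - p) * A₂ K)) (max (K - s) 0)
      with h1 | h1
    · exact early (IsModel.split t s μ A t' p κ s₁ μ₁ A₁ s₂ μ₂ A₂ d u htt hp hp1 law hsplit hs1 hs2
        ham hd hu) (by rw [ham K hK, max_eq_left h1])
    obtain ⟨τ₁, a1, b1, c1, d1⟩ := ih1 (ht0.trans htt)
    obtain ⟨τ₂, a2, b2, c2, d2⟩ := ih2 (ht0.trans htt)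
    have htT : t' < T := hd.lt_maturity
    have ht'0 : 0 ≤ t' := ht0.trans htt
    have x1 := fun v ω => hd.branchPrice_extreme (e := 1) (κ := κ) one_ne_zero
      (fun k hk => by have := (hs1 k hk).2; linarith) v ω
    have x2 := fun v ω => hu.branchPrice_extreme (e := -1) (κ := κ) (by norm_num)
      (fun k hk => by have := (hs2 k hk).2; linarith) v ω
    set z := κ * Real.exp (r * (t' - T)) with hz
    classical
    -- Prices at `t'` are at most `z` in the lower subtree and at least `z` in the upper one, so the
    -- path fails to reveal the branch only when both equal `z`. The rule then stops at once; as `z`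
    -- is extreme, the price is deterministic from there on and nothing is lost.
    set τ : (PriceTree.split t s t' p d u).Outcome → ℝ := fun ω =>
      if (PriceTree.split t s t' p d u).branchPrice r T t' ω = z then t'
      else Sum.elim τ₁ τ₂ ω with hτ
    have hτ1 : ∀ ω : d.Outcome, τ (toDown ω) =
        if d.branchPrice r T t' ω = z then t' else τ₁ ω := fun ω => by
      simp only [hτ, branchPrice_toDown (le_refl t')]; rfl
    have hτ2 : ∀ ω : u.Outcome, τ (toUp ω) =
        if u.branchPrice r T t' ω = z then t' else τ₂ ω := fun ω => by
      simp only [hτ, branchPrice_toUp (le_refl t')]; rfl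
    have hge : ∀ ω, t' ≤ τ ω := by
      refine forall_outcome (fun ω => ?_) (fun ω => ?_)
      · rw [hτ1]; split_ifs; exacts [le_rfl, b1 ω]
      · rw [hτ2]; split_ifs; exacts [le_rfl, b2 ω]
    have hfreeze : ∀ ω ω', Agree r T (PriceTree.split t s t' p d u) (τ ω) ω ω' →
        (PriceTree.split t s t' p d u).branchPrice r T t' ω =
          (PriceTree.split t s t' p d u).branchPrice r T t' ω' :=
      fun ω ω' ha => ha t' ht'0 (hge ω)
    have hcross : ∀ (ω : d.Outcome) (ω' : u.Outcome),
        d.branchPrice r T t' ω = u.branchPrice r T t' ω' →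
        d.branchPrice r T t' ω = z ∧ u.branchPrice r T t' ω' = z := by
      intro ω ω' heq
      have y1 := (x1 t' ω).1
      have y2 := (x2 t' ω').1
      rw [← hz] at y1 y2
      constructor <;> linarith
    refine ⟨τ, ?_, fun ω => htt.trans (hge ω), ?_, ?_⟩
    · refine forall_outcome (fun ω => ?_) (fun ω => ?_)
      · refine forall_outcome (fun ω' => ?_) (fun ω' => ?_)
        · intro ha
          have hf := hfreeze _ _ ha
          rw [branchPrice_toDown le_rfl, branchPrice_toDown le_rfl] at hf
          rw [hτ1, hτ1, ← hf]
          rw [hτ1] at ha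
          split_ifs at ha ⊢ with hc
          · rfl
          -- The subtree also prescribes prices before `t'`, but these are the same on all its
          -- branches; from `t'` on they coincide with prices in the whole tree.
          · refine a1 ω ω' fun w hw hwv => ?_
            rcases lt_or_ge w t' with h2 | h2
            · exact agree_of_lt r (h2.trans_le hd.le_firstJump) ω ω' w hw le_rfl
            · have := ha w hw hwv
              rwa [branchPrice_toDown h2, branchPrice_toDown h2] at this
        · intro ha
          have hf := hfreeze _ _ ha
          rw [branchPrice_toDown le_rfl, branchPrice_toUp le_rfl] at hf
          obtain ⟨z1, z2⟩ := hcross ω ω' hf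
          rw [hτ1, hτ2, if_pos z1, if_pos z2]
      · refine forall_outcome (fun ω' => ?_) (fun ω' => ?_)
        · intro ha
          have hf := hfreeze _ _ ha
          rw [branchPrice_toDown le_rfl, branchPrice_toUp le_rfl] at hf
          obtain ⟨z1, z2⟩ := hcross ω' ω hf.symm
          rw [hτ1, hτ2, if_pos z1, if_pos z2]
        · intro ha
          have hf := hfreeze _ _ ha
          rw [branchPrice_toUp le_rfl, branchPrice_toUp le_rfl] at hf
          rw [hτ2, hτ2, ← hf]
          rw [hτ2] at ha
          split_ifs at ha ⊢ with hc
          · rfl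
          · refine a2 ω ω' fun w hw hwv => ?_
            rcases lt_or_ge w t' with h2 | h2
            · exact agree_of_lt r (h2.trans_le hu.le_firstJump) ω ω' w hw le_rfl
            · have := ha w hw hwv
              rwa [branchPrice_toUp h2, branchPrice_toUp h2] at this
    · refine forall_outcome (fun ω => ?_) (fun ω => ?_)
      · rw [hτ1]; split_ifs; exacts [htT.le, c1 ω]
      · rw [hτ2]; split_ifs; exacts [htT.le, c2 ω]
    · rw [ham K hK, max_eq_right h1, wsum_split, ← mul_assoc, ← Real.exp_add,
        show -(r * t) + -(r * (t' - t)) = -(r * t') by ring]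
      have i1 : Real.exp (-(r * t')) * A₁ K ≤ d.wsum (fun ω => Real.exp (-(r * τ (toDown ω))) *
          max (K - (PriceTree.split t s t' p d u).branchPrice r T (τ (toDown ω)) (toDown ω)) 0) := by
        refine d1.trans (hd.wsum_mono fun ω => ?_)
        rw [branchPrice_toDown (hge _), hτ1]
        split_ifs with hc
        · rw [(x1 t' ω).2 hc _ (b1 ω), hc]
          exact frozen_payoff hr hK (b1 ω)
        · exact le_rfl
      have i2 : Real.exp (-(r * t')) * A₂ K ≤ u.wsum (fun ω => Real.exp (-(r * τ (toUp ω))) *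
          max (K - (PriceTree.split t s t' p d u).branchPrice r T (τ (toUp ω)) (toUp ω)) 0) := by
        refine d2.trans (hu.wsum_mono fun ω => ?_)
        rw [branchPrice_toUp (hge _), hτ2]
        split_ifs with hc
        · rw [(x2 t' ω).2 hc _ (b2 ω), hc]
          exact frozen_payoff hr hK (b2 ω)
        · exact le_rfl
      have j1 := mul_le_mul_of_nonneg_left i1 hp.le
      have j2 := mul_le_mul_of_nonneg_left i2 (sub_pos.2 hp1).le
      linarith

end IsModel

end AmericanPut

namespace AmericanPut

open Filter Topology

namespace PriceTree

/-! ### The price process and its natural filtration -/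

theorem measurableSet_outcome {M : PriceTree} (B : Set M.Outcome) : MeasurableSet B :=
  MeasurableSpace.measurableSet_top

instance (M : PriceTree) : MeasurableSingletonClass M.Outcome := ⟨fun _ => measurableSet_outcome _⟩

theorem prob_eq (M : PriceTree) :
    M.prob = ∑ ω, ENNReal.ofReal (M.weight ω) • Measure.dirac ω := by
  rw [prob, Measure.sum_fintype]

theorem integral_prob {M : PriceTree} (hM : ∀ ω, 0 ≤ M.weight ω) (φ : M.Outcome → ℝ) :
    ∫ ω, φ ω ∂M.prob = M.wsum φ := by
  have hfin : ∀ ω, Integrable φ (ENNReal.ofReal (M.weight ω) • Measure.dirac ω) := fun ω => by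
    have : IsFiniteMeasure (ENNReal.ofReal (M.weight ω) • Measure.dirac ω) :=
      Measure.smul_finite _ ENNReal.ofReal_ne_top
    exact Integrable.of_finite
  rw [prob_eq, integral_finsetSum_measure fun ω _ => hfin ω, wsum]
  refine Finset.sum_congr rfl fun ω _ => ?_
  rw [integral_smul_measure, integral_dirac, ENNReal.toReal_ofReal (hM ω), smul_eq_mul]

theorem isProbabilityMeasure_prob {M : PriceTree} (hM : ∀ ω, 0 ≤ M.weight ω)
    (h1 : M.wsum (fun _ => 1) = 1) : IsProbabilityMeasure M.prob := by
  refine ⟨?_⟩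
  rw [prob_eq]
  simp only [Measure.finsetSum_apply, Measure.smul_apply, measure_univ, smul_eq_mul, mul_one]
  rw [← ENNReal.ofReal_sum_of_nonneg fun ω _ => hM ω]
  simp only [wsum, mul_one] at h1
  rw [h1, ENNReal.ofReal_one]

variable {r T : ℝ} {M : PriceTree}

theorem spot_zero (r T : ℝ) (M : PriceTree) (ω : M.Outcome) : M.spot r T 0 ω = M.rootPrice :=
  if_pos rfl

theorem spot_of_pos (r T : ℝ) (M : PriceTree) {v : ℝ≥0} (hv : 0 < v) (ω : M.Outcome) :
    M.spot r T v ω = M.branchPrice r T v ω := if_neg hv.ne'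

/-- The paths of the price process agree up to time `v`. -/
def SpotAgree (r T : ℝ) (M : PriceTree) (v : ℝ≥0) (ω ω' : M.Outcome) : Prop :=
  ∀ w ≤ v, M.spot r T w ω = M.spot r T w ω'

/-- A random time that is determined by the price process up to this time. -/
def SpotAdapted (r T : ℝ) (M : PriceTree) (τ : M.Outcome → ℝ≥0) : Prop :=
  ∀ ω ω', SpotAgree r T M (τ ω) ω ω' → τ ω' = τ ω

theorem SpotAgree.symm {v : ℝ≥0} {ω ω' : M.Outcome} (h : SpotAgree r T M v ω ω') :
    SpotAgree r T M v ω' ω := fun w hw => (h w hw).symm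

theorem SpotAgree.mono {v w : ℝ≥0} {ω ω' : M.Outcome} (h : SpotAgree r T M v ω ω') (hw : w ≤ v) :
    SpotAgree r T M w ω ω' := fun x hx => h x (hx.trans hw)

theorem spotAgree_zero (r T : ℝ) (M : PriceTree) (ω ω' : M.Outcome) : SpotAgree r T M 0 ω ω' := by
  intro w hw
  rw [nonpos_iff_eq_zero.1 hw, spot_zero, spot_zero]

theorem Agree.spotAgree {v : ℝ≥0} {ω ω' : M.Outcome} (h : Agree r T M v ω ω') :
    SpotAgree r T M v ω ω' := by
  intro w hw
  rcases eq_or_ne w 0 with rfl | h0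
  · rw [spot_zero, spot_zero]
  · rw [spot_of_pos _ _ _ h0.bot_lt, spot_of_pos _ _ _ h0.bot_lt]
    exact h w w.2 hw

/-- At time `0` the price process shows only the root price. The branch price there is the limit of
later ones, which requires `v > 0`. -/
theorem SpotAgree.agree {v : ℝ≥0} (hv : 0 < v) {ω ω' : M.Outcome} (h : SpotAgree r T M v ω ω') :
    Agree r T M v ω ω' := by
  have pos : ∀ w : ℝ, 0 < w → w ≤ v → M.branchPrice r T w ω = M.branchPrice r T w ω' := by
    intro w hw hwv
    have h1 := h ⟨w, hw.le⟩ hwv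
    rwa [spot_of_pos _ _ _ (show (0 : ℝ≥0) < ⟨w, hw.le⟩ from hw),
      spot_of_pos _ _ _ (show (0 : ℝ≥0) < ⟨w, hw.le⟩ from hw)] at h1
  intro w hw hwv
  rcases hw.eq_or_lt with rfl | hw'
  · have c : ∀ ω, Tendsto (fun w => M.branchPrice r T w ω) (𝓝[>] 0) (𝓝 (M.branchPrice r T 0 ω)) :=
      fun ω => (continuousWithinAt_branchPrice r T M ω 0).mono_left
        (nhdsWithin_mono _ Set.Ioi_subset_Ici_self)
    refine tendsto_nhds_unique_of_eventuallyEq (c ω) (c ω') ?_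
    filter_upwards [Ioc_mem_nhdsGT (show (0 : ℝ) < v from hv)] with w hw using pos w hw.1 hw.2
  · exact pos w hw' hwv

/-- The events of the natural filtration are those that are determined by the past. -/
theorem measurableSet_filtration_iff (v : ℝ≥0) (B : Set M.Outcome) :
    MeasurableSet[M.filtration r T v] B ↔
      ∀ ω ω', SpotAgree r T M v ω ω' → ω ∈ B → ω' ∈ B := by
  constructor
  -- The sets closed under agreement of paths form a σ-algebra that contains the generators.
  -- Conversely, with finitely many outcomes such a set is a finite union of finite intersections of
  -- level sets at times up to `v`.
  · let m : MeasurableSpace M.Outcome :=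
      { MeasurableSet' := fun B => ∀ ω ω', SpotAgree r T M v ω ω' → ω ∈ B → ω' ∈ B
        measurableSet_empty := fun _ _ _ h => h
        measurableSet_compl := fun B hB ω ω' h hω hω' => hω (hB ω' ω h.symm hω')
        measurableSet_iUnion := fun f hf ω ω' h hω => by
          obtain ⟨i, hi⟩ := Set.mem_iUnion.1 hω
          exact Set.mem_iUnion.2 ⟨i, hf i ω ω' h hi⟩ }
    have hle : (M.filtration r T v : MeasurableSpace M.Outcome) ≤ m := by
      refine iSup₂_le fun w hw => ?_
      rintro _ ⟨S, _, rfl⟩ ω ω' h hω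
      change M.spot r T w ω' ∈ S
      rw [← h w hw]
      exact hω
    exact hle B
  · intro hB
    have hsep : ∀ ω ω', ω ∈ B → ω' ∉ B → ∃ w ≤ v, M.spot r T w ω ≠ M.spot r T w ω' := by
      intro ω ω' hω hω'
      by_contra! hcon
      exact hω' (hB ω ω' hcon hω)
    choose! g hg hne using hsep
    have e : B = ⋃ ω ∈ B, ⋂ ω' ∈ Bᶜ, {x | M.spot r T (g ω ω') x = M.spot r T (g ω ω') ω} := by
      ext x
      simp only [Set.mem_iUnion, Set.mem_iInter]
      refine ⟨fun hx => ⟨x, hx, fun ω' _ => rfl⟩, ?_⟩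
      rintro ⟨ω, hω, h⟩
      by_contra hx
      exact hne ω x hω hx (h x hx).symm
    rw [e]
    refine MeasurableSet.biUnion (Set.to_countable _) fun ω hω =>
      MeasurableSet.biInter (Set.to_countable _) fun ω' hω' => ?_
    have hm : MeasurableSet[M.filtration r T (g ω ω')]
        {x | M.spot r T (g ω ω') x = M.spot r T (g ω ω') ω} :=
      (Filtration.stronglyAdapted_natural (M.stronglyMeasurable_spot r T) (g ω ω')).measurable
        (measurableSet_singleton (M.spot r T (g ω ω') ω))
    exact (M.filtration r T).mono (hg ω ω' hω hω') _ hm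

theorem isStoppingTime_iff (τ : M.Outcome → ℝ≥0) :
    IsStoppingTime (M.filtration r T) (fun ω => (τ ω : WithTop ℝ≥0)) ↔ SpotAdapted r T M τ := by
  simp only [IsStoppingTime, WithTop.coe_le_coe, measurableSet_filtration_iff]
  constructor
  · intro h ω ω' ha
    have h1 : τ ω' ≤ τ ω := h (τ ω) ω ω' ha (le_refl (τ ω))
    exact le_antisymm h1 (h (τ ω') ω' ω (ha.mono h1).symm (le_refl (τ ω')))
  · intro h i ω ω' ha (hω : τ ω ≤ i)
    exact (h ω ω' (ha.mono hω)).le.trans hω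

end PriceTree

open PriceTree

/-! ### The martingale property and the optimal stopping problem. -/

namespace IsModel

variable {r S₀ : ℝ} {T : ℝ≥0} {μ : ℝ →₀ ℝ} {A : ℝ → ℝ} {M : PriceTree}

theorem rootPrice_eq {r T t s : ℝ} (h : IsModel r T t s μ A M) : M.rootPrice = s := by
  cases h <;> rfl

theorem spot_zero (h : IsModel r T 0 S₀ μ A M) (ω : M.Outcome) : M.spot r T 0 ω = S₀ :=
  (PriceTree.spot_zero r T M ω).trans h.rootPrice_eq

theorem spot_nonneg (h : IsModel r T 0 S₀ μ A M) (v : ℝ≥0) (ω : M.Outcome) :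
    0 ≤ M.spot r T v ω := by
  rcases eq_or_ne v 0 with rfl | h0
  · rw [h.spot_zero]; exact h.isLaw.mean_nonneg
  · rw [spot_of_pos _ _ _ h0.bot_lt]; exact h.branchPrice_nonneg _ _

theorem maturity_pos (h : IsModel r T 0 S₀ μ A M) : 0 < T := h.lt_maturity

theorem wsum_discounted_spot (h : IsModel r T 0 S₀ μ A M) (v : ℝ≥0) :
    M.wsum (fun ω => Real.exp (-(r * v)) * M.spot r T v ω) = S₀ := by
  rcases eq_or_ne v 0 with rfl | h0
  · simp only [h.spot_zero, NNReal.coe_zero, mul_zero, neg_zero, Real.exp_zero, one_mul]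
    exact h.wsum_const _
  · have := h.wsum_discounted (v := v) v.2
    simp only [spot_of_pos _ _ _ h0.bot_lt]
    rw [this, mul_zero, neg_zero, Real.exp_zero, one_mul]

/-- Optional sampling for the price process. -/
theorem optional_sampling_spot (h : IsModel r T 0 S₀ μ A M) {V : ℝ≥0} {τ : M.Outcome → ℝ≥0}
    {H : M.Outcome → ℝ} (hτ : SpotAdapted r T M τ)
    (hH : ∀ ω ω', SpotAgree r T M (τ ω) ω ω' → H ω' = H ω) (hV : ∀ ω, τ ω ≤ V) :
    M.wsum (fun ω => H ω * (Real.exp (-(r * V)) * M.spot r T V ω)) =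
      M.wsum (fun ω => H ω * (Real.exp (-(r * τ ω)) * M.spot r T (τ ω) ω)) := by
  -- All paths agree at time `0`, so a stopping time that vanishes on one outcome vanishes on all;
  -- otherwise price and branch price coincide at `τ`.
  by_cases hex : ∃ ω, τ ω = 0
  · obtain ⟨ω₀, h0⟩ := hex
    have e : ∀ ω, SpotAgree r T M (τ ω₀) ω₀ ω := fun ω => by rw [h0]; exact spotAgree_zero r T M _ _
    simp only [fun ω => hτ ω₀ ω (e ω), fun ω => hH ω₀ ω (e ω)]
    rw [wsum_const_mul M (H ω₀), wsum_const_mul M (H ω₀), h.wsum_discounted_spot,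
      h.wsum_discounted_spot]
  · push Not at hex
    have hpos : ∀ ω, 0 < τ ω := fun ω => (hex ω).bot_lt
    have := h.optional_sampling (V := V) (τ := fun ω => (τ ω : ℝ)) (H := H)
      (fun ω ω' ha => congrArg _ (hτ ω ω' ha.spotAgree)) (fun ω ω' ha => hH ω ω' ha.spotAgree)
      (fun ω => (τ ω).2) (fun ω => hV ω)
    simp only [fun ω => spot_of_pos r T M (hpos ω) ω]
    rw [← this]
    congr 1; funext ω
    rw [spot_of_pos _ _ _ ((hpos ω).trans_le (hV ω))]

theorem isProbabilityMeasure (h : IsModel r T 0 S₀ μ A M) : IsProbabilityMeasure M.prob :=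
  isProbabilityMeasure_prob h.weight_nonneg h.wsum_one

/-- The discounted price process is a martingale. -/
theorem martingale (h : IsModel r T 0 S₀ μ A M) :
    Martingale (fun (t : ℝ≥0) ω => Real.exp (-(r * t)) * M.spot r T t ω)
      (M.filtration r T) M.prob := by
  have := h.isProbabilityMeasure
  refine ⟨fun t => (Filtration.stronglyAdapted_natural
    (M.stronglyMeasurable_spot r T) t).const_mul _, fun i j hij => ?_⟩
  symm
  refine ae_eq_condExp_of_forall_setIntegral_eq ((M.filtration r T).le i) Integrable.of_finite
    (fun _ _ _ => Integrable.of_finite.integrableOn) (fun B hB _ => ?_)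
    ((Filtration.stronglyAdapted_natural
    (M.stronglyMeasurable_spot r T) i).const_mul _).aestronglyMeasurable
  rw [← integral_indicator (measurableSet_outcome B), ← integral_indicator (measurableSet_outcome B),
    integral_prob h.weight_nonneg, integral_prob h.weight_nonneg]
  have hs := h.optional_sampling_spot (V := j) (τ := fun _ => i) (H := B.indicator 1)
    (fun _ _ _ => rfl) (fun ω ω' ha => ?_) (fun _ => hij)
  · have e : ∀ φ : M.Outcome → ℝ, B.indicator φ = fun ω => B.indicator 1 ω * φ ω := fun φ => by
      funext ω
      by_cases hω : ω ∈ B <;> simp [hω]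
    rw [e (fun ω => Real.exp (-(r * i)) * M.spot r T i ω),
      e (fun ω => Real.exp (-(r * j)) * M.spot r T j ω)]
    exact hs.symm
  · have h1 := (measurableSet_filtration_iff i B).1 hB
    by_cases hω : ω ∈ B
    · simp [hω, h1 ω ω' ha hω]
    · have : ω' ∉ B := fun h' => hω (h1 ω' ω ha.symm h')
      simp [hω, this]

theorem european_price (h : IsModel r T 0 S₀ μ A M) (K : ℝ) :
    Real.exp (-(r * T)) * M.wsum (fun ω => max (K - M.spot r T T ω) 0) = europeanPut r T μ K := by
  simp only [spot_of_pos _ _ _ h.maturity_pos]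
  rw [h.wsum_terminal (fun x => max (K - x) 0), europeanPut_eq]

/-- No stopping time earns more than the American price. -/
theorem exercise_le (h : IsModel r T 0 S₀ μ A M) (hr : 0 < r) {K : ℝ} (hK : 0 ≤ K)
    {τ : M.Outcome → ℝ≥0} (hτ : SpotAdapted r T M τ) (hT : ∀ ω, τ ω ≤ T) :
    M.wsum (fun ω => Real.exp (-(r * τ ω)) * max (K - M.spot r T (τ ω) ω) 0) ≤ A K := by
  by_cases hex : ∃ ω, τ ω = 0
  · obtain ⟨ω₀, h0⟩ := hex
    have e : ∀ ω, τ ω = 0 := fun ω => by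
      rw [hτ ω₀ ω (by rw [h0]; exact spotAgree_zero r T M _ _), h0]
    simp only [e, h.spot_zero, NNReal.coe_zero, mul_zero, neg_zero, Real.exp_zero, one_mul]
    rw [h.wsum_const]
    exact h.intrinsic_le hK
  · push Not at hex
    have hpos : ∀ ω, 0 < τ ω := fun ω => (hex ω).bot_lt
    have := h.american_upper hr hK (τ := fun ω => (τ ω : ℝ))
      (fun ω ω' ha => congrArg _ (hτ ω ω' ha.spotAgree)) (fun ω => (τ ω).2) (fun ω => hT ω)
    simp only [fun ω => spot_of_pos r T M (hpos ω) ω]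
    simpa using this

/-- The American price is approximated by stopping times. -/
theorem exists_exercise_gt (h : IsModel r T 0 S₀ μ A M) (hr : 0 < r) {K : ℝ} (hK : 0 ≤ K)
    {c : ℝ} (hc : c < A K) :
    ∃ τ : M.Outcome → ℝ≥0, SpotAdapted r T M τ ∧ (∀ ω, τ ω ≤ T) ∧
      c < M.wsum (fun ω => Real.exp (-(r * τ ω)) * max (K - M.spot r T (τ ω) ω) 0) := by
  obtain ⟨σ, hσ, hσ0, hσT, hσA⟩ := h.american_attained hr hK le_rfl
  rw [mul_zero, neg_zero, Real.exp_zero, one_mul] at hσA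
  -- The optimal rule may use a jump at time `0` that the price process reveals only afterwards.
  -- Waiting at least until `δ > 0` makes it a stopping time, at a cost that vanishes with `δ`.
  have hlim : Tendsto (fun δ : ℝ => M.wsum (fun ω => Real.exp (-(r * max (σ ω) δ)) *
      max (K - M.branchPrice r T (max (σ ω) δ) ω) 0)) (𝓝[>] 0)
      (𝓝 (M.wsum (fun ω => Real.exp (-(r * σ ω)) * max (K - M.branchPrice r T (σ ω) ω) 0))) := by
    refine tendsto_finsetSum _ fun ω _ => Tendsto.const_mul _ ?_
    have h1 : Tendsto (fun δ : ℝ => max (σ ω) δ) (𝓝[>] 0) (𝓝[≥] (σ ω)) := by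
      refine tendsto_nhdsWithin_iff.2 ⟨?_, Eventually.of_forall fun δ => le_max_left (σ ω) δ⟩
      have : Tendsto (fun δ : ℝ => max (σ ω) δ) (𝓝 0) (𝓝 (max (σ ω) 0)) :=
        Continuous.tendsto (by fun_prop) 0
      rw [max_eq_left (hσ0 ω)] at this
      exact this.mono_left nhdsWithin_le_nhds
    have h2 : ContinuousWithinAt (fun w => Real.exp (-(r * w)) *
        max (K - M.branchPrice r T w ω) 0) (Set.Ici (σ ω)) (σ ω) := by
      have h3 := continuousWithinAt_branchPrice r T M ω (σ ω)
      have h4 : ContinuousWithinAt (fun w => K - M.branchPrice r T w ω) (Set.Ici (σ ω)) (σ ω) :=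
        continuousWithinAt_const.sub h3
      exact ContinuousWithinAt.mul (by fun_prop) (h4.max continuousWithinAt_const)
    exact h2.tendsto.comp h1
  have hT : (0 : ℝ) < T := h.maturity_pos
  obtain ⟨δ, hδc, hδ0, hδT⟩ := ((hlim.eventually_const_lt (hc.trans_le hσA)).and
    (Ioc_mem_nhdsGT hT)).exists
  have hmax : ∀ ω, 0 < max (σ ω) δ := fun ω => hδ0.trans_le (le_max_right _ _)
  refine ⟨fun ω => ⟨max (σ ω) δ, (hmax ω).le⟩, fun ω ω' ha => ?_, fun ω => max_le (hσT ω) hδT, ?_⟩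
  · have h1 : Agree r T M (max (σ ω) δ) ω ω' := ha.agree (hmax ω)
    have h2 := hσ ω ω' (h1.mono (le_max_left _ _))
    exact Subtype.ext (congrArg (max · δ) h2)
  · refine hδc.trans_eq ?_
    congr 1; funext ω
    rw [spot_of_pos _ _ _ (show (0 : ℝ≥0) < ⟨max (σ ω) δ, (hmax ω).le⟩ from hmax ω)]
    rfl

/-- The American price is the value of the optimal stopping problem. -/
theorem isLUB_exerciseValues (h : IsModel r T 0 S₀ μ A M) (hr : 0 < r) {K : ℝ} (hK : 0 ≤ K) :
    IsLUB (M.exerciseValues r T K) (A K) := by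
  constructor
  · rintro _ ⟨τ, hτ, hT, rfl⟩
    rw [integral_prob h.weight_nonneg]
    exact h.exercise_le hr hK ((isStoppingTime_iff τ).1 hτ) hT
  · intro b hb
    by_contra! hlt
    obtain ⟨τ, hτ, hT, hτA⟩ := h.exists_exercise_gt hr hK hlt
    refine hτA.not_ge (hb ⟨τ, (isStoppingTime_iff τ).2 hτ, hT, ?_⟩)
    rw [integral_prob h.weight_nonneg]

end IsModel

end AmericanPut

namespace AmericanPut

open Filter Topology

open PriceTree

namespace IsModel

variable {r S₀ : ℝ} {T : ℝ≥0} {μ : ℝ →₀ ℝ} {A : ℝ → ℝ} {M : PriceTree}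

/-! ### Absence of model-independent arbitrage -/

/-- The scenario of an outcome of the model, where the holders exercise at the times `τ`. -/
noncomputable def scenario (h : IsModel r T 0 S₀ μ A M) {n : ℕ} (τ : Fin n → M.Outcome → ℝ≥0)
    (hT : ∀ j ω, τ j ω ≤ T) (ω : M.Outcome) : Scenario S₀ T n where
  path v := M.spot r T v ω
  path_nonneg v := h.spot_nonneg v ω
  path_zero := h.spot_zero ω
  exercise j := τ j ω
  exercise_le j := hT j ω

theorem agreeUpTo_scenario (h : IsModel r T 0 S₀ μ A M) {n : ℕ} {τ : Fin n → M.Outcome → ℝ≥0}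
    (hT : ∀ j ω, τ j ω ≤ T) (hτ : ∀ j, SpotAdapted r T M (τ j)) {v : ℝ≥0} {ω ω' : M.Outcome}
    (ha : SpotAgree r T M v ω ω') :
    Scenario.AgreeUpTo v (h.scenario τ hT ω) (h.scenario τ hT ω') := by
  refine ⟨ha, ?_⟩
  rintro j (hj | hj)
  · exact (hτ j ω ω' (ha.mono hj)).symm
  · exact hτ j ω' ω (ha.mono hj).symm

theorem wsum_trade (h : IsModel r T 0 S₀ μ A M) {σ τ : M.Outcome → ℝ≥0} {H : M.Outcome → ℝ}
    (hσ : SpotAdapted r T M σ) (hτ : SpotAdapted r T M τ) (hle : ∀ ω, σ ω ≤ τ ω)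
    (hT : ∀ ω, τ ω ≤ T) (hH : ∀ ω ω', SpotAgree r T M (σ ω) ω ω' → H ω' = H ω) :
    M.wsum (fun ω => H ω * (Real.exp (-(r * τ ω)) * M.spot r T (τ ω) ω -
      Real.exp (-(r * σ ω)) * M.spot r T (σ ω) ω)) = 0 := by
  simp only [mul_sub]
  rw [wsum_sub, ← h.optional_sampling_spot hτ (fun ω ω' ha => hH ω ω' (ha.mono (hle ω))) hT,
    ← h.optional_sampling_spot hσ hH fun ω => (hle ω).trans (hT ω), sub_self]

/-- In the model European puts earn their price on average, long American puts at most theirs, and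
trading earns nothing. Non-negative wealth would thus contradict a negative initial value, once
holders of short puts exercise almost optimally. -/
theorem not_arbitrage (h : IsModel r T 0 S₀ μ A M) (hr : 0 < r) {E : ℝ → ℝ}
    (hE : ∀ K, 0 ≤ K → europeanPut r T μ K = E K) : ¬ ModelIndependentArbitrage r S₀ T A E := by
  rintro ⟨P, hneg, hnonneg⟩
  -- The slack `ε` per short put is needed because the supremum over stopping times need not be
  -- attained.
  obtain ⟨ε, hε, hεP⟩ : ∃ ε > 0, P.initialValue A E + ε * ∑ i, P.shortPosition i < 0 := by
    have hlim : Tendsto (fun ε => P.initialValue A E + ε * ∑ i, P.shortPosition i) (𝓝[>] 0)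
        (𝓝 (P.initialValue A E + 0 * ∑ i, P.shortPosition i)) :=
      (Continuous.tendsto (by fun_prop) 0).mono_left nhdsWithin_le_nhds
    rw [zero_mul, add_zero] at hlim
    obtain ⟨ε, h1, h2⟩ := ((hlim.eventually_lt_const hneg).and self_mem_nhdsWithin).exists
    exact ⟨ε, h2, h1⟩
  have hex := fun i => h.exists_exercise_gt hr (P.shortStrike_nonneg i)
    (sub_lt_self (A (P.shortStrike i)) hε)
  choose τ hτ hτT hτA using hex
  set θ := h.scenario τ hτT with hθ
  have agree : ∀ {v : ℝ≥0} {ω ω' : M.Outcome}, SpotAgree r T M v ω ω' →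
      Scenario.AgreeUpTo v (θ ω) (θ ω') := fun ha => h.agreeUpTo_scenario hτT hτ ha
  have adapted : ∀ {σ : Scenario S₀ T P.numShort → ℝ≥0}, NonAnticipating σ →
      SpotAdapted r T M (fun ω => σ (θ ω)) := fun hσ ω ω' ha => hσ _ _ (agree ha)
  have heur : M.wsum (fun ω => ∑ i, P.europeanPosition i *
      (Real.exp (-(r * T)) * max (P.europeanStrike i - M.spot r T T ω) 0)) =
      ∑ i, P.europeanPosition i * E (P.europeanStrike i) := by
    rw [wsum_sum]
    refine Finset.sum_congr rfl fun i _ => ?_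
    rw [wsum_const_mul, wsum_const_mul, h.european_price, hE _ (P.europeanStrike_nonneg i)]
  have hlong : M.wsum (fun ω => ∑ i, P.longPosition i *
      (Real.exp (-(r * P.exerciseTime i (θ ω))) *
        max (P.longStrike i - M.spot r T (P.exerciseTime i (θ ω)) ω) 0)) ≤
      ∑ i, P.longPosition i * A (P.longStrike i) := by
    rw [wsum_sum]
    refine Finset.sum_le_sum fun i _ => ?_
    rw [wsum_const_mul]
    exact mul_le_mul_of_nonneg_left (h.exercise_le hr (P.longStrike_nonneg i)
      (adapted (P.exerciseTime_nonAnticipating i)) fun ω => P.exerciseTime_le i _)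
      (P.longPosition_nonneg i)
  have hshort : ∑ i, P.shortPosition i * A (P.shortStrike i) - ε * ∑ i, P.shortPosition i ≤
      M.wsum (fun ω => ∑ i, P.shortPosition i * (Real.exp (-(r * τ i ω)) *
        max (P.shortStrike i - M.spot r T (τ i ω) ω) 0)) := by
    rw [wsum_sum, Finset.mul_sum, ← Finset.sum_sub_distrib]
    refine Finset.sum_le_sum fun i _ => ?_
    rw [wsum_const_mul, mul_comm ε, ← mul_sub]
    exact mul_le_mul_of_nonneg_left (hτA i).le (P.shortPosition_nonneg i)
  have htrade : M.wsum (fun ω => ∑ l : Fin P.numTrades, P.holding l (θ ω) *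
      (Real.exp (-(r * P.tradeTime l.succ (θ ω))) * M.spot r T (P.tradeTime l.succ (θ ω)) ω -
        Real.exp (-(r * P.tradeTime l.castSucc (θ ω))) *
          M.spot r T (P.tradeTime l.castSucc (θ ω)) ω)) = 0 := by
    rw [wsum_sum]
    refine Finset.sum_eq_zero fun l _ => ?_
    exact h.wsum_trade (adapted (P.tradeTime_nonAnticipating _))
      (adapted (P.tradeTime_nonAnticipating _))
      (fun ω => P.tradeTime_mono (θ ω) (Fin.castSucc_lt_succ).le) (fun ω => P.tradeTime_le _ _)
      (fun ω ω' ha => P.holding_nonAnticipating l _ _ (agree ha))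
  have htot : 0 ≤ M.wsum (fun ω => P.terminalValue r (θ ω)) :=
    (h.wsum_const 0).ge.trans (h.wsum_mono fun ω => hnonneg (θ ω))
  have hsplit : M.wsum (fun ω => P.terminalValue r (θ ω)) = P.cash + _ + _ - _ + _ :=
    ((M.wsum_add _ _).trans (congrArg (· + _) ((M.wsum_sub _ _).trans (congrArg (· - _)
      ((M.wsum_add _ _).trans (congrArg (· + _) ((M.wsum_add _ _).trans
        (congrArg (· + _) (h.wsum_const P.cash)))))))))
  rw [hsplit] at htot
  change 0 ≤ P.cash + M.wsum (fun ω => ∑ i, P.europeanPosition i *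
      (Real.exp (-(r * T)) * max (P.europeanStrike i - M.spot r T T ω) 0)) +
    M.wsum (fun ω => ∑ i, P.longPosition i *
      (Real.exp (-(r * P.exerciseTime i (θ ω))) *
        max (P.longStrike i - M.spot r T (P.exerciseTime i (θ ω)) ω) 0)) -
    M.wsum (fun ω => ∑ i, P.shortPosition i * (Real.exp (-(r * τ i ω)) *
        max (P.shortStrike i - M.spot r T (τ i ω) ω) 0)) +
    M.wsum (fun ω => ∑ l : Fin P.numTrades, P.holding l (θ ω) *
      (Real.exp (-(r * P.tradeTime l.succ (θ ω))) * M.spot r T (P.tradeTime l.succ (θ ω)) ω -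
        Real.exp (-(r * P.tradeTime l.castSucc (θ ω))) *
          M.spot r T (P.tradeTime l.castSucc (θ ω)) ω)) at htot
  unfold SemiStaticPortfolio.initialValue at hεP
  linarith

end IsModel

end AmericanPut

/-! ### The main theorem. -/

theorem mainTheorem2 (r S₀ : ℝ) (T : ℝ≥0) (hr : 0 < r) (hT : 0 < T)
    (americanQuotes europeanQuotes : List (ℝ × ℝ))
    (hAm : AmericanPut.StrikesIncreasing americanQuotes)
    (hEu : AmericanPut.StrikesIncreasing europeanQuotes)
    (A E : ℝ → ℝ)
    (hA : A = AmericanPut.interpolate 1 americanQuotes)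
    (hE : E = AmericanPut.interpolate (Real.exp (-(r * T))) europeanQuotes)
    (hEcond : AmericanPut.EuropeanConditions r T S₀ E)
    (hAcond : AmericanPut.AmericanConditions r T S₀ A E) :
    (∃ (μ : ℝ →₀ ℝ) (M : AmericanPut.PriceTree),
      AmericanPut.IsImpliedLaw r T S₀ E μ ∧
      AmericanPut.Builds r T 0 S₀ μ A M ∧
      IsProbabilityMeasure M.prob ∧
      (∀ ω, M.spot r T 0 ω = S₀) ∧
      Martingale (fun (t : ℝ≥0) ω => Real.exp (-(r * t)) * M.spot r T t ω)
        (M.filtration r T) M.prob ∧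
      (∀ K, 0 ≤ K → Real.exp (-(r * T)) * ∫ ω, max (K - M.spot r T T ω) 0 ∂M.prob = E K) ∧
      (∀ K, 0 ≤ K → IsLUB (M.exerciseValues r T K) (A K))) ∧
    ¬ AmericanPut.ModelIndependentArbitrage r S₀ T A E := by
  obtain ⟨μ, hμ, hnode⟩ :=
    AmericanPut.exists_root hr hT hAm hEu hA hE hEcond hAcond
  obtain ⟨M, hB, hM⟩ := AmericanPut.Node.exists_tree (r := r) (T := T) _ 0 S₀ μ A
    (by rwa [sub_zero]) rfl
  refine ⟨⟨μ, M, hμ, hB, hM.isProbabilityMeasure, hM.spot_zero, hM.martingale, fun K hK => ?_,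
    fun K hK => hM.isLUB_exerciseValues hr hK⟩, hM.not_arbitrage hr hμ.price⟩
  rw [AmericanPut.PriceTree.integral_prob hM.weight_nonneg, hM.european_price]
  exact hμ.price K hK
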